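/- Let $f\in C^2([0,1])$ satisfy $f(0)=f(1)=0$, $f'(0)=1$ and $f''<0$ on $[0,1]$. There is a constant $C>0$, depending only on $f$, such that the following holds. Let $\kappa,v_0,H>0$, let $u\in C^1([0,H])$ satisfy $\int_0^H u(y)\,dy=0$, and let $T=T(x,y,t)$, $0\le T\le 1$, be a classical solution of $$T_t+u(y)T_x=\kappa\,(T_{xx}+T_{yy})+\frac{v_0^2}{4\kappa}f(T),\qquad t>0,$$ either in the strip $\Omega=\mathbb R\times[0,H]$ with Neumann conditions $T_y(x,0,t)=T_y(x,H,t)=0$, or in $\mathbb R\times\mathbb R$ with the periodicity condition $T(x,y+H,t)=T(x,y,t)$ (in which case $u$ is extended to be $H$-periodic). Here "classical" means that $T$ is continuous for $t\ge0$ and that $T_t,T_x,T_y,T_{xx},T_{yy}$ exist and are continuous for $t>0$, up to the boundary in the Neumann case. Suppose that the initial data $T_0=T(\cdot,\cdot,0)$ are localized: for some $\lambda>0$, uniformly in $y$, $T_0(x,y)=1-O(e^{\lambda x})$ for $x<0$ and $T_0(x,y)=O(e^{-\lambda x})$ for $x>0$. Put $$V(t)=\int_{\mathbb R\times[0,H]}T_t(x,y,t)\,\frac{dx\,dy}{H},\qquad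 \langle V\rangle_\tau=\frac1\tau\int_0^\tau V(s)\,ds,$$ $$\|u\|_1=\int_0^H|u(y)|\,\frac{dy}{H},\qquad \|u\|_\infty=\sup_{[0,H]}|u|,\qquad \|u'\|_\infty=\sup_{[0,H]}|u'|,\qquad h_u=\frac{\|u\|_1}{\|u'\|_\infty}.$$ Then for every $\tau\ge\max\left[\frac{\kappa}{v_0^2},\frac{H}{v_0}\right]$ the average $\langle V\rangle_\tau$ is well defined ($T_t(\cdot,\cdot,t)$ is integrable over $\mathbb R\times[0,H]$ for almost every $t\in(0,\tau]$, and $V$ is integrable on $(0,\tau)$), and $$\langle V\rangle_\tau\ \ge\ C\left(1+\frac{\kappa^2}{v_0^2h_u^2}\right)^{-1}\frac{\|u\|_1^2}{\|u\|_\infty},$$ where the right-hand side is read as $0$ if $u\equiv0$. -/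

import Mathlib

open MeasureTheory Set

noncomputable section

namespace BulkBurning

/-- Concave KPP nonlinearity on `[0, 1]`: `f ∈ C²`, `f 0 = f 1 = 0`, `f' 0 = 1`, `f'' < 0`. -/
structure IsConcaveKPP (f : ℝ → ℝ) : Prop where
  contDiffOn : ContDiffOn ℝ 2 f (Icc 0 1)
  map_zero : f 0 = 0
  map_one : f 1 = 0
  deriv_zero : derivWithin f (Icc 0 1) 0 = 1
  deriv2_neg : ∀ s ∈ Icc (0 : ℝ) 1, iteratedDerivWithin 2 f (Icc 0 1) s < 0

/-! Partial derivatives of a function `T t x y`. The `y`-derivative is taken within the set `Y` of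
admissible values of `y`, so that it is one-sided at the walls of a closed strip. -/

/-- `∂T/∂t`. -/
def dt (T : ℝ → ℝ → ℝ → ℝ) (t x y : ℝ) : ℝ := deriv (fun s => T s x y) t

/-- `∂T/∂x`. -/
def dx (T : ℝ → ℝ → ℝ → ℝ) (t x y : ℝ) : ℝ := deriv (fun ξ => T t ξ y) x

/-- `∂T/∂y`. -/
def dy (Y : Set ℝ) (T : ℝ → ℝ → ℝ → ℝ) (t x y : ℝ) : ℝ := derivWithin (fun η => T t x η) Y y

/-- `F` is continuous in `(t, x, y)` jointly, for `t ∈ I`, `x ∈ ℝ`, `y ∈ Y`. -/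
def JointlyContinuousOn (I Y : Set ℝ) (F : ℝ → ℝ → ℝ → ℝ) : Prop :=
  ContinuousOn (fun p : ℝ × ℝ × ℝ => F p.1 p.2.1 p.2.2) (I ×ˢ (univ ×ˢ Y))

/-- `T` is continuous for `t ≥ 0`, and the derivatives `T_t, T_x, T_y, T_xx, T_yy` exist and are
continuous for `t > 0` (for `x ∈ ℝ` and `y ∈ Y`, boundary points included). -/
structure IsClassical (Y : Set ℝ) (T : ℝ → ℝ → ℝ → ℝ) : Prop where
  cont : JointlyContinuousOn (Ici 0) Y T
  diff_t : ∀ t > 0, ∀ x, ∀ y ∈ Y, DifferentiableAt ℝ (fun s => T s x y) t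
  diff_x : ∀ t > 0, ∀ x, ∀ y ∈ Y, DifferentiableAt ℝ (fun ξ => T t ξ y) x
  diff_y : ∀ t > 0, ∀ x, ∀ y ∈ Y, DifferentiableWithinAt ℝ (fun η => T t x η) Y y
  diff_xx : ∀ t > 0, ∀ x, ∀ y ∈ Y, DifferentiableAt ℝ (fun ξ => dx T t ξ y) x
  diff_yy : ∀ t > 0, ∀ x, ∀ y ∈ Y, DifferentiableWithinAt ℝ (fun η => dy Y T t x η) Y y
  cont_t : JointlyContinuousOn (Ioi 0) Y (dt T)
  cont_x : JointlyContinuousOn (Ioi 0) Y (dx T)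
  cont_y : JointlyContinuousOn (Ioi 0) Y (dy Y T)
  cont_xx : JointlyContinuousOn (Ioi 0) Y (dx (dx T))
  cont_yy : JointlyContinuousOn (Ioi 0) Y (dy Y (dy Y T))

/-- The function `T₀` is front-like: uniformly in `y ∈ Y`, for some `lam > 0`,
`T₀ = 1 - O(exp (lam x))` for `x < 0` and `T₀ = O(exp (-lam x))` for `x > 0`. -/
def IsLocalized (Y : Set ℝ) (T₀ : ℝ → ℝ → ℝ) : Prop :=
  ∃ lam > 0, ∃ A : ℝ, ∀ y ∈ Y,
    (∀ x < 0, |1 - T₀ x y| ≤ A * Real.exp (lam * x)) ∧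
    (∀ x > 0, |T₀ x y| ≤ A * Real.exp (-lam * x))

/-- `T` is a classical solution with values in `[0, 1]` of
`T_t + u(y) T_x = κ (T_xx + T_yy) + v₀² / (4 κ) f(T)` for `t > 0`, `x ∈ ℝ`, `y ∈ Y`,
with localized initial data. -/
structure IsSolution (f : ℝ → ℝ) (κ v₀ : ℝ) (u : ℝ → ℝ) (Y : Set ℝ)
    (T : ℝ → ℝ → ℝ → ℝ) : Prop where
  classical : IsClassical Y T
  range : ∀ t ≥ 0, ∀ x, ∀ y ∈ Y, T t x y ∈ Icc (0 : ℝ) 1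
  localized : IsLocalized Y (T 0)
  pde : ∀ t > 0, ∀ x, ∀ y ∈ Y,
    dt T t x y + u y * dx T t x y =
      κ * (dx (dx T) t x y + dy Y (dy Y T) t x y) + v₀ ^ 2 / (4 * κ) * f (T t x y)

/-- Solution in the strip `ℝ × [0, H]` with Neumann conditions `T_y = 0` at `y = 0` and `y = H`. -/
structure IsNeumannSolution (f : ℝ → ℝ) (κ v₀ H : ℝ) (u : ℝ → ℝ)
    (T : ℝ → ℝ → ℝ → ℝ) : Prop where
  solution : IsSolution f κ v₀ u (Icc 0 H) T
  bottom : ∀ t > 0, ∀ x, dy (Icc 0 H) T t x 0 = 0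
  top : ∀ t > 0, ∀ x, dy (Icc 0 H) T t x H = 0

/-- Solution in the plane that is `H`-periodic in `y` (the flow being `H`-periodic as well). -/
structure IsPeriodicSolution (f : ℝ → ℝ) (κ v₀ H : ℝ) (u : ℝ → ℝ)
    (T : ℝ → ℝ → ℝ → ℝ) : Prop where
  solution : IsSolution f κ v₀ u univ T
  flow_periodic : Function.Periodic u H
  periodic : ∀ t ≥ 0, ∀ x y, T t x (y + H) = T t x y

/-- A mean-zero, continuously differentiable shear profile on `[0, H]`. -/
structure IsShear (H : ℝ) (u : ℝ → ℝ) : Prop where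
  contDiffOn : ContDiffOn ℝ 1 u (Icc 0 H)
  mean_zero : ∫ y in (0 : ℝ)..H, u y = 0

/-- The strip `Ω = ℝ × [0, H]` (one period in the periodic case). -/
def strip (H : ℝ) : Set (ℝ × ℝ) := univ ×ˢ Icc 0 H

/-- Bulk burning rate `V(t) = ∫_Ω T_t dx dy / H`. -/
def burningRate (H : ℝ) (T : ℝ → ℝ → ℝ → ℝ) (t : ℝ) : ℝ :=
  (∫ p in strip H, dt T t p.1 p.2) / H

/-- Time average `⟨V⟩_τ = (1/τ) ∫₀^τ V(s) ds`. -/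
def avgBurningRate (H : ℝ) (T : ℝ → ℝ → ℝ → ℝ) (τ : ℝ) : ℝ :=
  (1 / τ) * ∫ s in (0 : ℝ)..τ, burningRate H T s

/-- `‖u‖₁ = ∫₀^H |u(y)| dy / H`. -/
def norm1 (H : ℝ) (u : ℝ → ℝ) : ℝ := (∫ y in (0 : ℝ)..H, |u y|) / H

/-- Supremum of `|g|` over `[0, H]` (used for continuous `g`). -/
def normSup (H : ℝ) (g : ℝ → ℝ) : ℝ := sSup ((fun y => |g y|) '' Icc 0 H)

/-- `h_u = ‖u‖₁ / ‖u'‖_∞`. -/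
def shearScale (H : ℝ) (u : ℝ → ℝ) : ℝ :=
  norm1 H u / normSup H (derivWithin u (Icc 0 H))

end BulkBurning

end

/-! ### Bounds on the nonlinearity, and reduction of both boundary conditions to one closed strip.
-/

namespace BulkBurning

/-! Test the equation with `u(y) F'(T)`, where `F(s) = 3s² - 2s³` climbs from 0 to 1 and `F'(s) =
6s(1-s)` vanishes at both ends. Advection then contributes `-∫ u² ∂ₓF(T)`, which is exactly `∫₀ᴴ u²`
per unit time, because `T` runs from 1 on the left to 0 on the right. Everything else is bounded by
the dissipation `κ|∇T|² + 4c T(1-T)`, with `c = v²/(4κ)`, and by the reaction `c f(T)`: the term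
with `u'` by Young's inequality, the term with `F''` since `F''` is bounded, and the terms `∫ u
F(T)` at the two end times because `u` has mean zero, so that only the oscillation of `F(T)` across
the strip matters (`Front.flow_energy_le`).

Dissipation is in turn controlled by reaction. Testing with `1 - 2T` bounds the time integral of
`κ|∇T|²` by the reaction and by `∫ T(1-T)` at the final time (`Front.grad_energy`), and concavity
gives `f(s) ≥ γ s(1-s)` (`IsConcaveKPP.bounds`). Averaging selects times at which single-time
integrals are at most a constant over `τ` times the space-time integrals; the bound `κ/v² ≤ τ` pays
for this at the final time of the gradient estimate, and `H/v ≤ τ` pays for the mean-zero terms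
(`Front.flow_energy_le_reaction`). Cauchy–Schwarz passes from the `L²` to the `L¹` norm of `u`, and
`final_ratio` brings in `h_u`.

The rest is justification as `|x| → ∞`. That the burning rate equals the total reaction
(`Front.integral_time_eq`) needs `T_t` to be integrable. A maximum principle gives exponential decay
to the front (`StripSol.exp_bound`); this feeds energy estimates with weight `(1+x²)²`, first for
`∇T`, then for `T_t` (`Front.weighted_grad_integrable`, `Front.weighted_time_integrable`), where
cutoffs in `x` are removed by Fatou's lemma. The second estimate differentiates `|∇T|²` in time
although mixed derivatives need not exist; difference quotients get around this
(`StripSol.time_energy`). -/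

lemma IsConcaveKPP.bounds {f : ℝ → ℝ} (hf : IsConcaveKPP f) :
    ∃ γ > 0, ∃ K > 0, ∀ s ∈ Icc (0 : ℝ) 1, γ * (s * (1 - s)) ≤ f s ∧ f s ≤ s ∧ f s ≤ K * (1 - s) := by
  set I : Set ℝ := Icc 0 1
  have hU : UniqueDiffOn ℝ I := uniqueDiffOn_Icc one_pos
  set f1 := derivWithin f I
  set f2 := derivWithin f1 I
  have hd : ∀ s ∈ I, HasDerivWithinAt f (f1 s) I s := fun s hs =>
    ((hf.contDiffOn.differentiableOn (by norm_num)) s hs).hasDerivWithinAt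
  have hc1 : ContDiffOn ℝ 1 f1 I := hf.contDiffOn.derivWithin hU (by norm_num)
  have hd1 : ∀ s ∈ I, HasDerivWithinAt f1 (f2 s) I s := fun s hs =>
    ((hc1.differentiableOn (by norm_num)) s hs).hasDerivWithinAt
  have hc2 : ContinuousOn f2 I := hc1.continuousOn_derivWithin hU (by norm_num)
  have h2 : ∀ s ∈ I, f2 s < 0 := by
    intro s hs
    have h := hf.deriv2_neg s hs
    rw [iteratedDerivWithin_succ, iteratedDerivWithin_one] at h
    exact h
  obtain ⟨s0, hs0, hmax⟩ := (isCompact_Icc : IsCompact I).exists_isMaxOn ⟨0, by simp⟩ hc2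
  set m := -f2 s0
  have hm : 0 < m := by have := h2 s0 hs0; simp only [m]; linarith
  have hi : interior I ⊆ I := interior_subset
  -- By compactness `f'' ≤ -m`, so subtracting `(m/2) s(1-s)`, whose second derivative is `-m`,
  -- keeps concavity. The difference vanishes at 0 and 1, hence is nonnegative between them.
  have hconc : ConcaveOn ℝ I (fun s => f s - m / 2 * (s * (1 - s))) := by
    refine concaveOn_of_hasDerivWithinAt2_nonpos (f' := fun s => f1 s - m / 2 * (1 - 2 * s))
      (f'' := fun s => f2 s - m / 2 * (-2)) (convex_Icc 0 1) ?_ ?_ ?_ ?_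
    · exact hf.contDiffOn.continuousOn.sub (by fun_prop)
    · intro s hs
      have h := (hd s (hi hs)).mono hi
      have h' : HasDerivAt (fun s : ℝ => m / 2 * (s * (1 - s))) (m / 2 * (1 - 2 * s)) s := by
        exact (((hasDerivAt_id s).mul ((hasDerivAt_id s).const_sub 1)).const_mul (m / 2)).congr_deriv
          (by simp only [id]; ring)
      exact h.sub h'.hasDerivWithinAt
    · intro s hs
      have h := (hd1 s (hi hs)).mono hi
      have h' : HasDerivAt (fun s : ℝ => m / 2 * (1 - 2 * s)) (m / 2 * (-2)) s := by
        exact ((((hasDerivAt_id s).const_mul 2).const_sub 1).const_mul (m / 2)).congr_deriv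
          (by ring)
      exact h.sub h'.hasDerivWithinAt
    · intro s hs
      have := hmax (hi hs)
      have h' : f2 s ≤ f2 s0 := this
      simp only [m]; linarith
  have hconc' : ConcaveOn ℝ I f := by
    refine concaveOn_of_hasDerivWithinAt2_nonpos (f' := f1) (f'' := f2) (convex_Icc 0 1)
      hf.contDiffOn.continuousOn (fun s hs => (hd s (hi hs)).mono hi)
      (fun s hs => (hd1 s (hi hs)).mono hi) (fun s hs => (h2 s (hi hs)).le)
  have h0I : (0 : ℝ) ∈ I := by simp [I]
  have h1I : (1 : ℝ) ∈ I := by simp [I]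
  -- The upper bounds are the tangent lines of the concave `f` at 0, with slope 1, and at 1; the
  -- added 1 only makes `K` positive.
  refine ⟨m / 2, by positivity, |f1 1| + 1, by positivity, fun s hs => ⟨?_, ?_, ?_⟩⟩
  · have := hconc.2 h0I h1I (sub_nonneg.2 hs.2) hs.1 (sub_add_cancel 1 s)
    simp [hf.map_zero, hf.map_one] at this
    linarith
  · rcases hs.1.eq_or_lt with h | h
    · rw [← h, hf.map_zero]
    · have := hconc'.slope_le_of_hasDerivWithinAt h0I hs h (hd 0 h0I)
      have h1 : f1 0 = 1 := hf.deriv_zero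
      rw [h1, slope_def_field, hf.map_zero, div_le_one (by linarith)] at this
      linarith
  · rcases hs.2.eq_or_lt with h | h
    · rw [h, hf.map_one]; simp
    · have := hconc'.le_slope_of_hasDerivWithinAt hs h1I h (hd 1 h1I)
      rw [slope_def_field, hf.map_one, le_div_iff₀ (by linarith)] at this
      have h3 := neg_abs_le (f1 1)
      nlinarith

/-- A solution in the closed strip together with its derivatives, as functions of `(t, x, y)`,
with Neumann or periodic boundary conditions. -/
structure StripSol (f u : ℝ → ℝ) (κ c H : ℝ) (T Tt Tx Ty Txx Tyy : ℝ × ℝ × ℝ → ℝ) : Prop where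
  cont_f : Continuous f
  cont_u : Continuous u
  cont : ContinuousOn T (Ici 0 ×ˢ strip H)
  has_t : ∀ t > 0, ∀ x, ∀ y ∈ Icc 0 H, HasDerivAt (fun s => T (s, x, y)) (Tt (t, x, y)) t
  has_x : ∀ t > 0, ∀ x, ∀ y ∈ Icc 0 H, HasDerivAt (fun s => T (t, s, y)) (Tx (t, x, y)) x
  has_y : ∀ t > 0, ∀ x, ∀ y ∈ Icc 0 H,
    HasDerivWithinAt (fun s => T (t, x, s)) (Ty (t, x, y)) (Icc 0 H) y
  has_xx : ∀ t > 0, ∀ x, ∀ y ∈ Icc 0 H, HasDerivAt (fun s => Tx (t, s, y)) (Txx (t, x, y)) x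
  has_yy : ∀ t > 0, ∀ x, ∀ y ∈ Icc 0 H,
    HasDerivWithinAt (fun s => Ty (t, x, s)) (Tyy (t, x, y)) (Icc 0 H) y
  cont_t : ContinuousOn Tt (Ioi 0 ×ˢ strip H)
  cont_x : ContinuousOn Tx (Ioi 0 ×ˢ strip H)
  cont_y : ContinuousOn Ty (Ioi 0 ×ˢ strip H)
  cont_xx : ContinuousOn Txx (Ioi 0 ×ˢ strip H)
  cont_yy : ContinuousOn Tyy (Ioi 0 ×ˢ strip H)
  range : ∀ t ≥ 0, ∀ x, ∀ y ∈ Icc 0 H, T (t, x, y) ∈ Icc (0 : ℝ) 1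
  pde : ∀ t > 0, ∀ x, ∀ y ∈ Icc 0 H, Tt (t, x, y) + u y * Tx (t, x, y) =
    κ * (Txx (t, x, y) + Tyy (t, x, y)) + c * f (T (t, x, y))
  bdry : (∀ t > 0, ∀ x, Ty (t, x, 0) = 0 ∧ Ty (t, x, H) = 0) ∨
    (u 0 = u H ∧ ∀ t > 0, ∀ x, T (t, x, 0) = T (t, x, H) ∧ Ty (t, x, 0) = Ty (t, x, H))

/-- `F t x y` as a function of the triple `(t, x, y)`. -/
def unc (F : ℝ → ℝ → ℝ → ℝ) (p : ℝ × ℝ × ℝ) : ℝ := F p.1 p.2.1 p.2.2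

/-- Only the values of `f` on `[0, 1]` and of `u` on `[0, H]` enter the equation, so both may be
exchanged for functions continuous on the whole line. -/
lemma IsSolution.stripSol {f u f' u' : ℝ → ℝ} {κ v₀ H : ℝ} {T : ℝ → ℝ → ℝ → ℝ} (hH : 0 < H)
    (h : IsSolution f κ v₀ u (Icc 0 H) T) (cf : Continuous f') (cu : Continuous u')
    (ef : EqOn f' f (Icc 0 1)) (eu : EqOn u' u (Icc 0 H))
    (hb : (∀ t > 0, ∀ x, dy (Icc 0 H) T t x 0 = 0 ∧ dy (Icc 0 H) T t x H = 0) ∨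
    (u 0 = u H ∧ ∀ t > 0, ∀ x, T t x 0 = T t x H ∧ dy (Icc 0 H) T t x 0 = dy (Icc 0 H) T t x H)) :
    StripSol f' u' κ (v₀ ^ 2 / (4 * κ)) H (unc T) (unc (dt T)) (unc (dx T)) (unc (dy (Icc 0 H) T))
      (unc (dx (dx T))) (unc (dy (Icc 0 H) (dy (Icc 0 H) T))) where
  cont_f := cf
  cont_u := cu
  cont := h.classical.cont
  has_t t ht x y hy := (h.classical.diff_t t ht x y hy).hasDerivAt
  has_x t ht x y hy := (h.classical.diff_x t ht x y hy).hasDerivAt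
  has_y t ht x y hy := (h.classical.diff_y t ht x y hy).hasDerivWithinAt
  has_xx t ht x y hy := (h.classical.diff_xx t ht x y hy).hasDerivAt
  has_yy t ht x y hy := (h.classical.diff_yy t ht x y hy).hasDerivWithinAt
  cont_t := h.classical.cont_t
  cont_x := h.classical.cont_x
  cont_y := h.classical.cont_y
  cont_xx := h.classical.cont_xx
  cont_yy := h.classical.cont_yy
  range := h.range
  pde t ht x y hy := by
    have := h.pde t ht x y hy
    rw [← eu hy, ← ef (h.range t (le_of_lt ht) x y hy)] at this
    exact this
  bdry := by
    rw [eu (left_mem_Icc.2 hH.le), eu (right_mem_Icc.2 hH.le)]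
    exact hb

/-- A derivative on the line is also the derivative within `Icc 0 H`, a set on which derivatives are
unique. One period of a periodic solution thus lives in the same closed strip as the Neumann
problem. -/
lemma IsSolution.of_univ {f u : ℝ → ℝ} {κ v₀ H : ℝ} {T : ℝ → ℝ → ℝ → ℝ} (hH : 0 < H)
    (h : IsSolution f κ v₀ u univ T) :
    (∀ t > 0, ∀ x, ∀ y ∈ Icc 0 H, dy (Icc 0 H) T t x y = dy univ T t x y) ∧
    IsSolution f κ v₀ u (Icc 0 H) T := by
  have hU : UniqueDiffOn ℝ (Icc 0 H) := uniqueDiffOn_Icc hH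
  have e1 : ∀ t > 0, ∀ x, ∀ y ∈ Icc 0 H, dy (Icc 0 H) T t x y = dy univ T t x y :=
    fun t ht x y hy => derivWithin_subset (subset_univ _) (hU y hy)
      (h.classical.diff_y t ht x y (mem_univ _))
  have e2 : ∀ t > 0, ∀ x, ∀ y ∈ Icc 0 H,
      dy (Icc 0 H) (dy (Icc 0 H) T) t x y = dy univ (dy univ T) t x y := by
    intro t ht x y hy
    have h1 : dy (Icc 0 H) (dy (Icc 0 H) T) t x y = dy (Icc 0 H) (dy univ T) t x y :=
      derivWithin_congr (fun η hη => e1 t ht x η hη) (e1 t ht x y hy)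
    rw [h1]
    exact derivWithin_subset (subset_univ _) (hU y hy) (h.classical.diff_yy t ht x y (mem_univ _))
  have hs : ∀ I : Set ℝ, I ×ˢ ((univ : Set ℝ) ×ˢ Icc 0 H) ⊆ I ×ˢ (univ ×ˢ (univ : Set ℝ)) :=
    fun I => prod_mono le_rfl (prod_mono le_rfl (subset_univ _))
  refine ⟨e1, ⟨⟨h.classical.cont.mono (hs _), fun t ht x y _ => h.classical.diff_t t ht x y trivial,
    fun t ht x y _ => h.classical.diff_x t ht x y trivial,
    fun t ht x y _ => (h.classical.diff_y t ht x y trivial).mono (subset_univ _),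
    fun t ht x y _ => h.classical.diff_xx t ht x y trivial, ?_,
    h.classical.cont_t.mono (hs _), h.classical.cont_x.mono (hs _), ?_,
    h.classical.cont_xx.mono (hs _), ?_⟩, fun t ht x y _ => h.range t ht x y trivial, ?_, ?_⟩⟩
  · intro t ht x y hy
    exact ((h.classical.diff_yy t ht x y trivial).mono (subset_univ _)).congr
      (fun η hη => e1 t ht x η hη) (e1 t ht x y hy)
  · exact (h.classical.cont_y.mono (hs _)).congr fun p hp => e1 _ hp.1 _ _ hp.2.2
  · exact (h.classical.cont_yy.mono (hs _)).congr fun p hp => e2 _ hp.1 _ _ hp.2.2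
  · obtain ⟨l, hl, A, hA⟩ := h.localized
    exact ⟨l, hl, A, fun y _ => hA y trivial⟩
  · intro t ht x y hy
    rw [e2 t ht x y hy]
    exact h.pde t ht x y trivial

lemma IsNeumannSolution.stripSol {f u f' u' : ℝ → ℝ} {κ v₀ H : ℝ} {T : ℝ → ℝ → ℝ → ℝ}
    (hH : 0 < H) (h : IsNeumannSolution f κ v₀ H u T) (cf : Continuous f') (cu : Continuous u')
    (ef : EqOn f' f (Icc 0 1)) (eu : EqOn u' u (Icc 0 H)) :
    StripSol f' u' κ (v₀ ^ 2 / (4 * κ)) H (unc T) (unc (dt T)) (unc (dx T)) (unc (dy (Icc 0 H) T))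
      (unc (dx (dx T))) (unc (dy (Icc 0 H) (dy (Icc 0 H) T))) :=
  h.solution.stripSol hH cf cu ef eu (Or.inl fun t ht x => ⟨h.bottom t ht x, h.top t ht x⟩)

lemma IsPeriodicSolution.stripSol {f u f' u' : ℝ → ℝ} {κ v₀ H : ℝ} {T : ℝ → ℝ → ℝ → ℝ}
    (hH : 0 < H) (h : IsPeriodicSolution f κ v₀ H u T) (cf : Continuous f') (cu : Continuous u')
    (ef : EqOn f' f (Icc 0 1)) (eu : EqOn u' u (Icc 0 H)) :
    StripSol f' u' κ (v₀ ^ 2 / (4 * κ)) H (unc T) (unc (dt T)) (unc (dx T)) (unc (dy (Icc 0 H) T))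
      (unc (dx (dx T))) (unc (dy (Icc 0 H) (dy (Icc 0 H) T))) := by
  obtain ⟨e1, hs⟩ := h.solution.of_univ hH
  refine hs.stripSol hH cf cu ef eu (Or.inr ⟨?_, fun t ht x => ⟨?_, ?_⟩⟩)
  · have := h.flow_periodic 0
    rw [zero_add] at this
    exact this.symm
  · have := h.periodic t ht.le x 0
    rw [zero_add] at this
    exact this.symm
  · rw [e1 t ht x 0 ⟨le_rfl, hH.le⟩, e1 t ht x H ⟨hH.le, le_rfl⟩]
    have h1 : (fun η => T t x (η + H)) = fun η => T t x η := funext fun η => h.periodic t ht.le x η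
    simp only [dy, derivWithin_univ]
    rw [← congrArg (fun g => deriv g 0) h1, deriv_comp_add_const, zero_add]

end BulkBurning

/-! ### Maximum principle and decay of the solution to the front. -/

namespace BulkBurning

open Filter Topology

lemma deriv_nonpos_of_le_right {g : ℝ → ℝ} {g' a b : ℝ} (hab : a < b)
    (hg : HasDerivWithinAt g g' (Icc a b) a) (hmax : ∀ y ∈ Icc a b, g y ≤ g a) : g' ≤ 0 := by
  have h := (hasDerivWithinAt_iff_tendsto_slope.1 hg)
  rw [Icc_sdiff_left] at h
  have : NeBot (𝓝[Ioc a b] a) := by rw [nhdsWithin_Ioc_eq_nhdsGT hab]; infer_instance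
  refine le_of_tendsto h ?_
  filter_upwards [self_mem_nhdsWithin] with y hy
  rw [slope_def_field]
  exact div_nonpos_of_nonpos_of_nonneg (by linarith [hmax y ⟨hy.1.le, hy.2⟩]) (by linarith [hy.1])

lemma deriv_nonneg_of_le_left {g : ℝ → ℝ} {g' a b : ℝ} (hab : a < b)
    (hg : HasDerivWithinAt g g' (Icc a b) b) (hmax : ∀ y ∈ Icc a b, g y ≤ g b) : 0 ≤ g' := by
  have h := (hasDerivWithinAt_iff_tendsto_slope.1 hg)
  rw [Icc_sdiff_right] at h
  have : NeBot (𝓝[Ico a b] b) := by rw [nhdsWithin_Ico_eq_nhdsLT hab]; infer_instance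
  refine ge_of_tendsto h ?_
  filter_upwards [self_mem_nhdsWithin] with y hy
  rw [slope_def_field]
  exact div_nonneg_of_nonpos (by linarith [hmax y ⟨hy.1, hy.2.le⟩]) (by linarith [hy.2])

/-- If `g2 > 0` then `g1`, which vanishes at `a`, is positive just to the right of `a`; the mean
value theorem on a short interval contradicts the maximum. Being one-sided, the test also applies on
the walls. -/
lemma deriv2_nonpos_right {g g1 : ℝ → ℝ} {g2 a b : ℝ} (hab : a < b)
    (hg : ∀ y ∈ Icc a b, HasDerivWithinAt g (g1 y) (Icc a b) y)
    (hg1 : HasDerivWithinAt g1 g2 (Icc a b) a) (h0 : g1 a = 0)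
    (hmax : ∀ y ∈ Icc a b, g y ≤ g a) : g2 ≤ 0 := by
  by_contra! hpos
  have h := (hasDerivWithinAt_iff_tendsto_slope.1 hg1)
  rw [Icc_sdiff_left, nhdsWithin_Ioc_eq_nhdsGT hab] at h
  have h' := h.eventually (lt_mem_nhds hpos)
  obtain ⟨δ, hδ, hsub⟩ := (mem_nhdsGT_iff_exists_Ioo_subset).1 h'
  obtain ⟨z, hz1, hz2⟩ := exists_between (lt_min hab hδ)
  have hzb : z < b := hz2.trans_le (min_le_left _ _)
  obtain ⟨ξ, hξ, he⟩ := exists_hasDerivAt_eq_slope g g1 hz1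
    (fun y hy => (hg y ⟨hy.1, hy.2.trans hzb.le⟩).continuousWithinAt.mono
      (Icc_subset_Icc_right hzb.le))
    (fun y hy => (hg y ⟨hy.1.le, (hy.2.trans hzb).le⟩).hasDerivAt
      (Icc_mem_nhds hy.1 (hy.2.trans hzb)))
  have h1 := hsub ⟨hξ.1, hξ.2.trans (hz2.trans_le (min_le_right _ _))⟩
  have h2 : 0 < slope g1 a ξ := h1
  rw [slope_def_field, h0, sub_zero] at h2
  have h3 : g1 ξ ≤ 0 := by
    rw [he]
    exact div_nonpos_of_nonpos_of_nonneg (by linarith [hmax z ⟨hz1.le, hzb.le⟩]) (by linarith)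
  exact absurd h2 (not_lt.2 (div_nonpos_of_nonpos_of_nonneg h3 (by linarith [hξ.1])))

lemma deriv2_nonpos_left {g g1 : ℝ → ℝ} {g2 a b : ℝ} (hab : a < b)
    (hg : ∀ y ∈ Icc a b, HasDerivWithinAt g (g1 y) (Icc a b) y)
    (hg1 : HasDerivWithinAt g1 g2 (Icc a b) b) (h0 : g1 b = 0)
    (hmax : ∀ y ∈ Icc a b, g y ≤ g b) : g2 ≤ 0 := by
  have hm : MapsTo (fun y : ℝ => -y) (Icc (-b) (-a)) (Icc a b) := fun y hy =>
    ⟨by linarith [hy.2], by linarith [hy.1]⟩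
  refine deriv2_nonpos_right (g := fun y => g (-y)) (g1 := fun y => -g1 (-y)) (a := -b) (b := -a)
    (by linarith) (fun y hy => ?_) ?_ (by simp [h0]) (fun y hy => by simpa using hmax _ (hm hy))
  · have := (hg (-y) (hm hy)).scomp y (hasDerivAt_neg y).hasDerivWithinAt hm
    simpa [Function.comp_def] using this
  · have := HasDerivWithinAt.scomp (-b) (h := fun y : ℝ => -y) (g₁ := g1) (by simpa using hg1)
      (hasDerivAt_neg (-b)).hasDerivWithinAt hm
    simpa [Function.comp_def] using this.fun_neg

variable {f u : ℝ → ℝ} {κ c H : ℝ} {T Tt Tx Ty Txx Tyy : ℝ × ℝ × ℝ → ℝ}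

/-- The symmetry exchanging the burned and unburned states, used to get decay as `x → -∞` from the
same barrier as decay as `x → +∞`. -/
lemma StripSol.one_sub (h : StripSol f u κ c H T Tt Tx Ty Txx Tyy) :
    StripSol (fun s => -f (1 - s)) u κ c H (fun p => 1 - T p) (fun p => -Tt p) (fun p => -Tx p)
      (fun p => -Ty p) (fun p => -Txx p) (fun p => -Tyy p) where
  cont_f := by have := h.cont_f; fun_prop
  cont_u := h.cont_u
  cont := continuousOn_const.sub h.cont
  has_t t ht x y hy := (h.has_t t ht x y hy).const_sub 1
  has_x t ht x y hy := (h.has_x t ht x y hy).const_sub 1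
  has_y t ht x y hy := (h.has_y t ht x y hy).const_sub 1
  has_xx t ht x y hy := (h.has_xx t ht x y hy).neg
  has_yy t ht x y hy := (h.has_yy t ht x y hy).neg
  cont_t := h.cont_t.neg
  cont_x := h.cont_x.neg
  cont_y := h.cont_y.neg
  cont_xx := h.cont_xx.neg
  cont_yy := h.cont_yy.neg
  range t ht x y hy := by
    have := h.range t ht x y hy
    exact ⟨by linarith [this.2], by linarith [this.1]⟩
  pde t ht x y hy := by
    have := h.pde t ht x y hy
    simp only [sub_sub_cancel]
    linarith
  bdry := by
    rcases h.bdry with hb | ⟨hu, hb⟩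
    · exact Or.inl fun t ht x => ⟨by simp [(hb t ht x).1], by simp [(hb t ht x).2]⟩
    · exact Or.inr ⟨hu, fun t ht x => ⟨by simp [(hb t ht x).1], by simp [(hb t ht x).2]⟩⟩

/-- First `T_y = 0` at the maximum: by Fermat in the interior, by the boundary condition on a
Neumann wall. At a periodic endpoint the opposite endpoint is a maximum too, and the two one-sided
tests give opposite signs for the common value of `T_y`. The one-sided second derivative test then
applies. -/
lemma StripSol.Tyy_nonpos_of_max (h : StripSol f u κ c H T Tt Tx Ty Txx Tyy) (hH : 0 < H)
    {t x y : ℝ} (ht : 0 < t) (hy : y ∈ Icc 0 H)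
    (hmax : ∀ z ∈ Icc 0 H, T (t, x, z) ≤ T (t, x, y)) : Tyy (t, x, y) ≤ 0 := by
  have h0 : Ty (t, x, y) = 0 := by
    rcases hy.1.eq_or_lt with hy0 | hy0
    · subst hy0
      rcases h.bdry with hb | ⟨-, hb⟩
      · exact (hb t ht x).1
      · obtain ⟨b1, b2⟩ := hb t ht x
        refine le_antisymm (deriv_nonpos_of_le_right hH (h.has_y t ht x 0 hy) hmax) ?_
        rw [b2]
        exact deriv_nonneg_of_le_left hH (h.has_y t ht x H ⟨hH.le, le_rfl⟩)
          (fun z hz => by rw [← b1]; exact hmax z hz)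
    rcases hy.2.eq_or_lt with hyH | hyH
    · subst hyH
      rcases h.bdry with hb | ⟨-, hb⟩
      · exact (hb t ht x).2
      · obtain ⟨b1, b2⟩ := hb t ht x
        refine le_antisymm ?_ (deriv_nonneg_of_le_left hH (h.has_y t ht x y hy) hmax)
        rw [← b2]
        exact deriv_nonpos_of_le_right hH (h.has_y t ht x 0 ⟨le_rfl, hH.le⟩)
          (fun z hz => by rw [b1]; exact hmax z hz)
    · have hn : Icc 0 H ∈ 𝓝 y := Icc_mem_nhds hy0 hyH
      refine IsLocalMax.hasDerivAt_eq_zero (f := fun s => T (t, x, s)) ?_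
        ((h.has_y t ht x y hy).hasDerivAt hn)
      filter_upwards [hn] with z hz using hmax z hz
  rcases hy.2.eq_or_lt with hyH | hyH
  · subst hyH
    exact deriv2_nonpos_left hH (h.has_y t ht x) (h.has_yy t ht x y hy) h0 hmax
  · have hs : Icc y H ⊆ Icc 0 H := Icc_subset_Icc_left hy.1
    exact deriv2_nonpos_right hyH (fun z hz => (h.has_y t ht x z (hs hz)).mono hs)
      ((h.has_yy t ht x y hy).mono hs) h0 (fun z hz => hmax z (hs hz))

/-- Whichever exponential grows dominates `min A ε * |σ x|`. As `T ≤ 1`, a point where `T` exceeds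
the barrier must lie in a compact set. -/
lemma exp_barrier_coercive {A ε σ : ℝ} (hA : 0 < A) (hε : 0 < ε) (hσ : σ ≠ 0) :
    ∃ R, ∀ x, R ≤ |x| → 1 ≤ A * Real.exp (-σ * x) + ε * Real.exp (σ * x) := by
  set m := min A ε
  have hm : 0 < m := lt_min hA hε
  refine ⟨1 / (m * |σ|), fun x hx => ?_⟩
  have hσ' := abs_pos.2 hσ
  have h1 : 1 ≤ m * (|σ| * |x|) := by
    rw [div_le_iff₀ (by positivity)] at hx
    linarith
  have h2 : m * (|σ| * |x|) ≤ m * Real.exp (|σ * x|) := by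
    rw [← abs_mul]
    have := Real.add_one_le_exp |σ * x|
    exact mul_le_mul_of_nonneg_left (by linarith) hm.le
  have h3 : m * Real.exp |σ * x| ≤ A * Real.exp (-σ * x) + ε * Real.exp (σ * x) := by
    have e1 := Real.exp_pos (-σ * x)
    have e2 := Real.exp_pos (σ * x)
    rcases abs_cases (σ * x) with ⟨ha, -⟩ | ⟨ha, -⟩ <;> rw [ha]
    · have : m * Real.exp (σ * x) ≤ ε * Real.exp (σ * x) :=
        mul_le_mul_of_nonneg_right (min_le_right _ _) e2.le
      nlinarith [mul_pos hA e1]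
    · rw [← neg_mul]
      have : m * Real.exp (-σ * x) ≤ A * Real.exp (-σ * x) :=
        mul_le_mul_of_nonneg_right (min_le_left _ _) e1.le
      nlinarith [mul_pos hε e2]
  linarith

/-- Exponential barrier for solutions with `f s ≤ s`. -/
lemma StripSol.exp_bound (h : StripSol f u κ c H T Tt Tx Ty Txx Tyy) (hH : 0 < H) (hκ : 0 < κ)
    (hc : 0 ≤ c) (hf : ∀ s ∈ Icc (0 : ℝ) 1, f s ≤ s) {M : ℝ} (hM : ∀ y ∈ Icc 0 H, |u y| ≤ M)
    {σ A : ℝ} (hσ : σ ≠ 0) (hA : 0 < A)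
    (hinit : ∀ x, ∀ y ∈ Icc 0 H, T (0, x, y) ≤ A * Real.exp (-σ * x))
    {t x y : ℝ} (ht : 0 ≤ t) (hy : y ∈ Icc 0 H) :
    T (t, x, y) ≤ A * Real.exp ((M * |σ| + κ * σ ^ 2 + c) * t) * Real.exp (-σ * x) := by
  set K := M * |σ| + κ * σ ^ 2 + c
  -- The term with `ε` makes the barrier coercive, so that a positive maximum of the difference is
  -- attained; it is removed by `ε → 0`. The rate `K` is the one at which `e^{Kt}` times the barrier
  -- is a supersolution, since the barrier satisfies `b'' = σ² b` and `|b'| ≤ |σ| b`.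
  suffices hmain : ∀ ε > 0, Real.exp (-K * t) * T (t, x, y) ≤
      A * Real.exp (-σ * x) + ε * Real.exp (σ * x) by
    have h1 : Real.exp (-K * t) * T (t, x, y) ≤ A * Real.exp (-σ * x) := by
      refine le_of_forall_pos_le_add fun δ hδ => ?_
      have := hmain (δ / Real.exp (σ * x)) (div_pos hδ (Real.exp_pos _))
      rwa [div_mul_cancel₀ _ (Real.exp_pos _).ne'] at this
    have h2 := mul_le_mul_of_nonneg_left h1 (Real.exp_pos (K * t)).le
    have h3 : Real.exp (K * t) * (Real.exp (-K * t) * T (t, x, y)) = T (t, x, y) := by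
      rw [← mul_assoc, ← Real.exp_add]; simp
    rw [h3] at h2
    linarith
  intro ε hε
  by_contra! hcon
  set b : ℝ → ℝ := fun x => A * Real.exp (-σ * x) + ε * Real.exp (σ * x) with hb
  obtain ⟨R, hR⟩ := exp_barrier_coercive hA hε hσ
  set Z : ℝ × ℝ × ℝ → ℝ := fun p => Real.exp (-K * p.1) * T p - b p.2.1 with hZ
  have hK : 0 ≤ K := by
    have : 0 ≤ M := (abs_nonneg _).trans (hM y hy)
    simp only [K]; positivity
  set Q : Set (ℝ × ℝ × ℝ) := Icc 0 t ×ˢ (Icc (-max R |x|) (max R |x|) ×ˢ Icc 0 H)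
  have hQc : IsCompact Q := isCompact_Icc.prod (isCompact_Icc.prod isCompact_Icc)
  have hpQ : (t, x, y) ∈ Q :=
    ⟨⟨ht, le_rfl⟩, abs_le.1 (le_max_right R |x|), hy⟩
  have hZc : ContinuousOn Z Q := by
    have hT : ContinuousOn T Q := h.cont.mono
      (prod_mono (fun s hs => hs.1) (prod_mono (subset_univ _) le_rfl))
    simp only [hZ, hb]
    fun_prop
  obtain ⟨⟨t0, x0, y0⟩, hp0, hmax⟩ := hQc.exists_isMaxOn ⟨_, hpQ⟩ hZc
  have ht0 : t0 ∈ Icc 0 t := hp0.1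
  have hy0 : y0 ∈ Icc 0 H := hp0.2.2
  have hZpos : 0 < Z (t0, x0, y0) := by
    refine lt_of_lt_of_le ?_ (hmax hpQ)
    simp only [hZ]; linarith
  have hglob : ∀ s ∈ Icc 0 t, ∀ x', ∀ z ∈ Icc 0 H, Z (s, x', z) ≤ Z (t0, x0, y0) := by
    intro s hs x' z hz
    by_cases hx' : |x'| ≤ max R |x|
    · exact hmax (show (s, x', z) ∈ Q from ⟨hs, abs_le.1 hx', hz⟩)
    · refine le_trans ?_ hZpos.le
      have h1 := hR x' ((le_max_left _ _).trans (not_le.1 hx').le)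
      have h2 := (h.range s hs.1 x' z hz)
      have h3 : Real.exp (-K * s) ≤ 1 := Real.exp_le_one_iff.2 (by nlinarith [hs.1])
      have h4 : Real.exp (-K * s) * T (s, x', z) ≤ 1 :=
        mul_le_one₀ h3 h2.1 h2.2
      simp only [hZ, hb]; linarith
  have ht0pos : 0 < t0 := by
    rcases ht0.1.eq_or_lt with h0 | h0
    · exfalso
      subst h0
      have := hinit x0 y0 hy0
      have h5 := Real.exp_pos (σ * x0)
      simp only [hZ, hb, mul_zero, Real.exp_zero, one_mul] at hZpos
      nlinarith
    · exact h0
  set E := Real.exp (-K * t0)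
  have hE : 0 < E := Real.exp_pos _
  -- derivative tests at the maximum point
  have d_t : 0 ≤ E * (Tt (t0, x0, y0) - K * T (t0, x0, y0)) := by
    have h1 : HasDerivAt (fun s => Z (s, x0, y0)) (E * (Tt (t0, x0, y0) - K * T (t0, x0, y0))) t0 := by
      have e1 : HasDerivAt (fun s : ℝ => Real.exp (-K * s)) (E * (-K)) t0 :=
        (((hasDerivAt_id t0).const_mul (-K)).exp).congr_deriv (by simp [E])
      exact ((e1.mul (h.has_t t0 ht0pos x0 y0 hy0)).sub_const (b x0)).congr_deriv (by ring)
    exact deriv_nonneg_of_le_left ht0pos h1.hasDerivWithinAt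
      (fun s hs => hglob s ⟨hs.1, hs.2.trans ht0.2⟩ x0 y0 hy0)
  set b1 : ℝ → ℝ := fun x => -σ * (A * Real.exp (-σ * x)) + σ * (ε * Real.exp (σ * x)) with hb1
  have e1 : ∀ x, HasDerivAt (fun x : ℝ => A * Real.exp (-σ * x)) (-σ * (A * Real.exp (-σ * x))) x :=
    fun x => ((((hasDerivAt_id x).const_mul (-σ)).exp).const_mul A).congr_deriv
      (by simp only [id]; ring)
  have e2 : ∀ x, HasDerivAt (fun x : ℝ => ε * Real.exp (σ * x)) (σ * (ε * Real.exp (σ * x))) x :=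
    fun x => ((((hasDerivAt_id x).const_mul σ).exp).const_mul ε).congr_deriv
      (by simp only [id]; ring)
  have db : ∀ x, HasDerivAt b (b1 x) x := fun x => (e1 x).add (e2 x)
  have db1 : ∀ x, HasDerivAt b1 (σ ^ 2 * b x) x := fun x =>
    (((e1 x).const_mul (-σ)).add ((e2 x).const_mul σ)).congr_deriv (by simp only [hb]; ring)
  have hx1 : ∀ x', HasDerivAt (fun s => Z (t0, s, y0)) (E * Tx (t0, x', y0) - b1 x') x' := fun x' =>
    ((h.has_x t0 ht0pos x' y0 hy0).const_mul E).sub (db x')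
  have hx2 : HasDerivAt (fun s => E * Tx (t0, s, y0) - b1 s)
      (E * Txx (t0, x0, y0) - σ ^ 2 * b x0) x0 :=
    ((h.has_xx t0 ht0pos x0 y0 hy0).const_mul E).sub (db1 x0)
  have d_x : E * Tx (t0, x0, y0) - b1 x0 = 0 :=
    IsLocalMax.hasDerivAt_eq_zero (f := fun s => Z (t0, s, y0))
      (Eventually.of_forall fun s => hglob t0 ht0 s y0 hy0) (hx1 x0)
  have d_xx : E * Txx (t0, x0, y0) - σ ^ 2 * b x0 ≤ 0 :=
    deriv2_nonpos_right (lt_add_one x0) (fun s _ => (hx1 s).hasDerivWithinAt)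
      hx2.hasDerivWithinAt d_x (fun s _ => hglob t0 ht0 s y0 hy0)
  have d_yy : Tyy (t0, x0, y0) ≤ 0 := by
    refine h.Tyy_nonpos_of_max hH ht0pos hy0 fun z hz => ?_
    have := hglob t0 ht0 x0 z hz
    simp only [hZ] at this
    exact le_of_mul_le_mul_left (by linarith) hE
  have hpde := h.pde t0 ht0pos x0 y0 hy0
  have hrange := h.range t0 ht0.1 x0 y0 hy0
  have hfT := hf _ hrange
  have hM0 := hM y0 hy0
  set S := T (t0, x0, y0)
  have hbS : b x0 < E * S := by simp only [hZ] at hZpos; linarith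
  have hbpos : 0 < b x0 := by simp only [hb]; positivity
  have hb1le : |b1 x0| ≤ |σ| * b x0 := by
    have p1 : 0 < A * Real.exp (-σ * x0) := by positivity
    have p2 : 0 < ε * Real.exp (σ * x0) := by positivity
    simp only [hb1, hb]
    calc _ ≤ |-σ * (A * Real.exp (-σ * x0))| + |σ * (ε * Real.exp (σ * x0))| := abs_add_le _ _
      _ = _ := by rw [abs_mul (-σ), abs_mul σ, abs_neg, abs_of_pos p1, abs_of_pos p2]; ring
  have hub : -(u y0 * b1 x0) ≤ M * |σ| * b x0 := by
    calc -(u y0 * b1 x0) ≤ |u y0 * b1 x0| := neg_le_abs _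
      _ = |u y0| * |b1 x0| := abs_mul _ _
      _ ≤ M * (|σ| * b x0) := mul_le_mul hM0 hb1le (abs_nonneg _) ((abs_nonneg _).trans hM0)
      _ = _ := by ring
  have hEt : E * Tt (t0, x0, y0) = -(u y0 * (E * Tx (t0, x0, y0))) +
      κ * (E * Txx (t0, x0, y0)) + κ * (E * Tyy (t0, x0, y0)) + c * (E * f S) := by
    linear_combination E * hpde
  have hTx : E * Tx (t0, x0, y0) = b1 x0 := by linarith
  rw [hTx] at hEt
  have i1 : κ * (E * Txx (t0, x0, y0)) ≤ κ * (σ ^ 2 * b x0) :=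
    mul_le_mul_of_nonneg_left (by linarith) hκ.le
  have i2 : κ * (E * Tyy (t0, x0, y0)) ≤ 0 :=
    mul_nonpos_of_nonneg_of_nonpos hκ.le (mul_nonpos_of_nonneg_of_nonpos hE.le d_yy)
  have i3 : c * (E * f S) ≤ c * (E * S) :=
    mul_le_mul_of_nonneg_left (mul_le_mul_of_nonneg_left hfT hE.le) hc
  have hMσ : 0 < M * |σ| + κ * σ ^ 2 := by
    have : 0 ≤ M := (abs_nonneg _).trans hM0
    positivity
  -- The contradiction needs one strict inequality. It comes from `b < E * S` at a positive maximum,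
  -- with a factor positive because `σ ≠ 0`; `c` may vanish.
  have i4 : (M * |σ| + κ * σ ^ 2) * b x0 < (M * |σ| + κ * σ ^ 2) * (E * S) :=
    mul_lt_mul_of_pos_left hbS hMσ
  have : E * (Tt (t0, x0, y0) - K * S) = E * Tt (t0, x0, y0) - (M * |σ| + κ * σ ^ 2 + c) * (E * S) := by
    simp only [K]; ring
  nlinarith

/-- The sixth Taylor term of the exponential suffices, `720 = 6!`, together with `(1 + x²)³ ≤ 4(1 +
x⁶)`. -/
lemma cube_le_exp {lam : ℝ} (hl : 0 < lam) {x : ℝ} (hx : 0 ≤ x) :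
    (1 + x ^ 2) ^ 3 ≤ 4 * (1 + 720 / lam ^ 6) * Real.exp (lam * x) := by
  have h1 := Real.pow_div_factorial_le_exp (x := lam * x) (by positivity) 6
  have h2 : 1 ≤ Real.exp (lam * x) := Real.one_le_exp (by positivity)
  have h3 : x ^ 6 ≤ 720 / lam ^ 6 * Real.exp (lam * x) := by
    have e : x ^ 6 = 720 / lam ^ 6 * ((lam * x) ^ 6 / (Nat.factorial 6 : ℕ)) := by
      simp only [Nat.factorial]; push_cast; field_simp
    rw [e]
    exact mul_le_mul_of_nonneg_left h1 (by positivity)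
  have h4 : (1 + x ^ 2) ^ 3 ≤ 4 * (1 + x ^ 6) := by
    nlinarith [mul_nonneg (sq_nonneg (x ^ 2 - 1)) (by positivity : 0 ≤ 1 + x ^ 2)]
  nlinarith

/-- Polynomial decay of the solution on bounded time intervals, uniformly in `y`. -/
lemma StripSol.decay (h : StripSol f u κ c H T Tt Tx Ty Txx Tyy) (hH : 0 < H) (hκ : 0 < κ)
    (hc : 0 ≤ c) (hf : ∀ s ∈ Icc (0 : ℝ) 1, f s ≤ s) (hf0 : ∀ s ∈ Icc (0 : ℝ) 1, 0 ≤ f s)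
    {M : ℝ} (hM : ∀ y ∈ Icc 0 H, |u y| ≤ M)
    (hloc : IsLocalized (Icc 0 H) (fun x y => T (0, x, y))) (τ : ℝ) :
    ∃ B > 0, ∀ t ∈ Icc 0 τ, ∀ x, ∀ y ∈ Icc 0 H,
      (0 ≤ x → T (t, x, y) ≤ B / (1 + x ^ 2) ^ 3) ∧
      (x ≤ 0 → 1 - T (t, x, y) ≤ B / (1 + x ^ 2) ^ 3) := by
  obtain ⟨lam, hl, A₀, hA₀⟩ := hloc
  -- With `A ≥ 1` each half-line bound holds on all of `ℝ`: on the other half-line the exponential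
  -- is at least 1.
  set A := max A₀ 1
  have hA : 0 < A := lt_of_lt_of_le one_pos (le_max_right _ _)
  have hM0 : 0 ≤ M := (abs_nonneg _).trans (hM 0 ⟨le_rfl, hH.le⟩)
  have init1 : ∀ x, ∀ y ∈ Icc 0 H, T (0, x, y) ≤ A * Real.exp (-lam * x) := by
    intro x y hy
    rcases lt_or_ge 0 x with hx | hx
    · refine (le_abs_self _).trans (((hA₀ y hy).2 x hx).trans ?_)
      exact mul_le_mul_of_nonneg_right (le_max_left _ _) (Real.exp_pos _).le
    · refine (h.range 0 le_rfl x y hy).2.trans ?_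
      have : 1 ≤ Real.exp (-lam * x) := Real.one_le_exp (by nlinarith)
      nlinarith [le_max_right A₀ 1]
  have init2 : ∀ x, ∀ y ∈ Icc 0 H, 1 - T (0, x, y) ≤ A * Real.exp (-(-lam) * x) := by
    intro x y hy
    rw [neg_neg]
    rcases lt_or_ge x 0 with hx | hx
    · refine (le_abs_self _).trans (((hA₀ y hy).1 x hx).trans ?_)
      exact mul_le_mul_of_nonneg_right (le_max_left _ _) (Real.exp_pos _).le
    · have h1 := (h.range 0 le_rfl x y hy).1
      have : 1 ≤ Real.exp (lam * x) := Real.one_le_exp (by nlinarith)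
      nlinarith [le_max_right A₀ 1]
  set K := M * |lam| + κ * lam ^ 2 + c
  have hK : 0 ≤ K := by simp only [K]; positivity
  set D := 4 * (1 + 720 / lam ^ 6)
  have hD : 0 < D := by simp only [D]; positivity
  have key : ∀ t ∈ Icc 0 τ, ∀ z, 0 ≤ z → A * Real.exp (K * t) * Real.exp (-lam * z) ≤
      A * Real.exp (K * τ) * D / (1 + z ^ 2) ^ 3 := by
    intro t ht z hz
    rw [le_div_iff₀ (by positivity)]
    have h1 : Real.exp (K * t) ≤ Real.exp (K * τ) :=
      Real.exp_le_exp.2 (mul_le_mul_of_nonneg_left ht.2 hK)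
    have h2 : Real.exp (-lam * z) * (1 + z ^ 2) ^ 3 ≤ D := by
      have := mul_le_mul_of_nonneg_left (cube_le_exp hl hz) (Real.exp_pos (-lam * z)).le
      refine this.trans (le_of_eq ?_)
      have e : Real.exp (-lam * z) * Real.exp (lam * z) = 1 := by rw [← Real.exp_add]; simp
      linear_combination D * e
    calc _ = A * Real.exp (K * t) * (Real.exp (-lam * z) * (1 + z ^ 2) ^ 3) := by ring
      _ ≤ A * Real.exp (K * τ) * D := by gcongr
  refine ⟨A * Real.exp (K * τ) * D, by positivity, fun t ht x y hy => ⟨fun hx => ?_, fun hx => ?_⟩⟩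
  · exact (h.exp_bound hH hκ hc hf hM hl.ne' hA init1 ht.1 hy).trans (key t ht x hx)
  -- The reaction for `1 - T` is `-f (1 - s) ≤ 0 ≤ s`, so the barrier applies with the rate `-lam`.
  · have h1 := h.one_sub.exp_bound hH hκ hc (fun s hs => ?_) hM (neg_ne_zero.2 hl.ne') hA init2
      ht.1 hy (x := x)
    · rw [abs_neg, neg_sq] at h1
      have := key t ht (-x) (by linarith)
      rw [neg_sq] at this
      refine h1.trans (le_trans (le_of_eq ?_) this)
      congr 2; ring
    · have := hf0 (1 - s) ⟨by linarith [hs.2], by linarith [hs.1]⟩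
      linarith [hs.1]

end BulkBurning

/-! ### Integration by parts on the strip, with compact support in `x`. -/

namespace BulkBurning

open Filter Topology

/-- The space-time slab `[a, b] × ℝ × [0, H]`. -/
def slab (a b H : ℝ) : Set (ℝ × ℝ × ℝ) := Icc a b ×ˢ strip H

lemma measurableSet_strip (H : ℝ) : MeasurableSet (strip H) :=
  MeasurableSet.univ.prod measurableSet_Icc

lemma measurableSet_slab (a b H : ℝ) : MeasurableSet (slab a b H) :=
  measurableSet_Icc.prod (measurableSet_strip H)

lemma restrict_strip (H : ℝ) : (volume.restrict (strip H) : Measure (ℝ × ℝ)) =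
    (volume : Measure ℝ).prod (volume.restrict (Icc 0 H)) := by
  have := Measure.prod_restrict (μ := (volume : Measure ℝ)) (ν := (volume : Measure ℝ)) univ (Icc 0 H)
  rw [Measure.restrict_univ] at this
  exact this.symm

lemma restrict_slab (a b H : ℝ) : (volume.restrict (slab a b H) : Measure (ℝ × ℝ × ℝ)) =
    (volume.restrict (Icc a b)).prod (volume.restrict (strip H)) :=
  (Measure.prod_restrict (μ := (volume : Measure ℝ)) (ν := (volume : Measure (ℝ × ℝ)))
    (Icc a b) (strip H)).symm

lemma integrableOn_strip_fst {N : ℝ → ℝ} (hN : Integrable N) (H : ℝ) :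
    IntegrableOn (fun p : ℝ × ℝ => N p.1) (strip H) := by
  rw [IntegrableOn, restrict_strip]
  exact hN.comp_fst _

lemma integrableOn_slab_fst {N : ℝ → ℝ} (hN : Integrable N) (a b H : ℝ) :
    IntegrableOn (fun p : ℝ × ℝ × ℝ => N p.2.1) (slab a b H) := by
  rw [IntegrableOn, restrict_slab]
  have : Integrable (fun p : ℝ × ℝ => N p.1) (volume.restrict (strip H)) :=
    integrableOn_strip_fst hN H
  exact this.comp_snd _

lemma integrableOn_strip_of_le {F : ℝ × ℝ → ℝ} {N : ℝ → ℝ} {H : ℝ} (hF : ContinuousOn F (strip H))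
    (hN : Integrable N) (h : ∀ p ∈ strip H, |F p| ≤ N p.1) : IntegrableOn F (strip H) :=
  Integrable.mono' (integrableOn_strip_fst hN H) (hF.aestronglyMeasurable (measurableSet_strip H))
    ((ae_restrict_iff' (measurableSet_strip H)).2 (Eventually.of_forall h))

lemma integrableOn_slab_of_le {F : ℝ × ℝ × ℝ → ℝ} {N : ℝ → ℝ} {a b H : ℝ}
    (hF : ContinuousOn F (slab a b H)) (hN : Integrable N)
    (h : ∀ p ∈ slab a b H, |F p| ≤ N p.2.1) : IntegrableOn F (slab a b H) :=
  Integrable.mono' (integrableOn_slab_fst hN a b H)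
    (hF.aestronglyMeasurable (measurableSet_slab a b H))
    ((ae_restrict_iff' (measurableSet_slab a b H)).2 (Eventually.of_forall h))

lemma integrableOn_strip_of_compact {F : ℝ × ℝ → ℝ} {H R : ℝ} (hF : ContinuousOn F (strip H))
    (h0 : ∀ p, R < |p.1| → F p = 0) : IntegrableOn F (strip H) := by
  have hs : Icc (-R) R ×ˢ Icc 0 H ⊆ strip H := prod_mono (subset_univ _) le_rfl
  have h1 : IntegrableOn F (Icc (-R) R ×ˢ Icc 0 H) :=
    (hF.mono hs).integrableOn_compact (isCompact_Icc.prod isCompact_Icc)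
  refine h1.of_forall_sdiff_eq_zero (measurableSet_strip H) fun p hp => h0 p ?_
  by_contra! hle
  exact hp.2 ⟨abs_le.1 hle, hp.1.2⟩

lemma integrableOn_slab_of_compact {F : ℝ × ℝ × ℝ → ℝ} {a b H R : ℝ}
    (hF : ContinuousOn F (slab a b H)) (h0 : ∀ p, R < |p.2.1| → F p = 0) :
    IntegrableOn F (slab a b H) := by
  have hs : Icc a b ×ˢ (Icc (-R) R ×ˢ Icc 0 H) ⊆ slab a b H :=
    prod_mono le_rfl (prod_mono (subset_univ _) le_rfl)
  have h1 : IntegrableOn F (Icc a b ×ˢ (Icc (-R) R ×ˢ Icc 0 H)) :=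
    (hF.mono hs).integrableOn_compact (isCompact_Icc.prod (isCompact_Icc.prod isCompact_Icc))
  refine h1.of_forall_sdiff_eq_zero (measurableSet_slab a b H) fun p hp => h0 p ?_
  by_contra! hle
  exact hp.2 ⟨hp.1.1, abs_le.1 hle, hp.1.2.2⟩

lemma setIntegral_slab {F : ℝ × ℝ × ℝ → ℝ} {a b H : ℝ} (hF : IntegrableOn F (slab a b H)) :
    ∫ p in slab a b H, F p = ∫ t in Icc a b, ∫ q in strip H, F (t, q) := by
  rw [IntegrableOn, restrict_slab] at hF
  rw [restrict_slab, integral_prod _ hF]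

lemma integral_dx_eq_zero {P Px : ℝ × ℝ → ℝ} {H R : ℝ}
    (hd : ∀ x, ∀ y ∈ Icc 0 H, HasDerivAt (fun s => P (s, y)) (Px (x, y)) x)
    (hc : ContinuousOn Px (strip H)) (h0 : ∀ p, R < |p.1| → P p = 0)
    (h1 : ∀ p, R < |p.1| → Px p = 0) : ∫ p in strip H, Px p = 0 := by
  have hi := integrableOn_strip_of_compact hc h1
  have hcs : ∀ g : ℝ → ℝ, (∀ x, R < |x| → g x = 0) → HasCompactSupport g := fun g hg =>
    HasCompactSupport.intro (isCompact_Icc (a := -R) (b := R)) fun x hx => hg x (by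
      by_contra! hle
      exact hx (abs_le.1 hle))
  rw [IntegrableOn, restrict_strip] at hi
  rw [restrict_strip, integral_prod_symm _ hi]
  have : ∀ y ∈ Icc 0 H, ∫ x, Px (x, y) = 0 := by
    intro y hy
    refine integral_eq_zero_of_hasDerivAt_of_integrable (f := fun x => P (x, y))
      (fun x => hd x y hy) ?_ ?_
    · refine Continuous.integrable_of_hasCompactSupport ?_ (hcs _ fun x hx => h1 _ hx)
      exact hc.comp_continuous (by fun_prop) (fun x => ⟨trivial, hy⟩)
    · refine Continuous.integrable_of_hasCompactSupport ?_ (hcs _ fun x hx => h0 _ hx)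
      exact continuous_iff_continuousAt.2 fun x => (hd x y hy).continuousAt
  rw [setIntegral_congr_fun measurableSet_Icc this]
  simp

lemma integral_dy_eq_zero {Q Qy : ℝ × ℝ → ℝ} {H R : ℝ} (hH : 0 ≤ H)
    (hQ : ∀ x, ContinuousOn (fun s => Q (x, s)) (Icc 0 H))
    (hd : ∀ x, ∀ y ∈ Ioo 0 H, HasDerivAt (fun s => Q (x, s)) (Qy (x, y)) y)
    (hc : ContinuousOn Qy (strip H)) (h1 : ∀ p, R < |p.1| → Qy p = 0)
    (hb : ∀ x, Q (x, 0) = Q (x, H)) : ∫ p in strip H, Qy p = 0 := by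
  have hi := integrableOn_strip_of_compact hc h1
  rw [IntegrableOn, restrict_strip] at hi
  rw [restrict_strip, integral_prod _ hi]
  have : ∀ x, ∫ y in Icc 0 H, Qy (x, y) = 0 := by
    intro x
    rw [integral_Icc_eq_integral_Ioc, ← intervalIntegral.integral_of_le hH,
      intervalIntegral.integral_eq_sub_of_hasDerivAt_of_le hH (hQ x) (hd x), hb, sub_self]
    refine ContinuousOn.intervalIntegrable ?_
    rw [uIcc_of_le hH]
    exact hc.comp (by fun_prop) (fun y hy => ⟨trivial, hy⟩)
  simp [this]

lemma integral_time_deriv {W Wt : ℝ × ℝ × ℝ → ℝ} {a b H R : ℝ} (hab : a ≤ b)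
    (hd : ∀ t ∈ Icc a b, ∀ p ∈ strip H, HasDerivAt (fun s => W (s, p)) (Wt (t, p)) t)
    (hc : ContinuousOn Wt (slab a b H)) (h1 : ∀ p, R < |p.2.1| → Wt p = 0)
    (ha : IntegrableOn (fun p => W (a, p)) (strip H))
    (hb : IntegrableOn (fun p => W (b, p)) (strip H)) :
    ∫ p in slab a b H, Wt p = (∫ p in strip H, W (b, p)) - ∫ p in strip H, W (a, p) := by
  have hi := integrableOn_slab_of_compact hc h1
  rw [IntegrableOn, restrict_slab] at hi
  rw [restrict_slab, integral_prod_symm _ hi, ← integral_sub hb ha]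
  refine setIntegral_congr_fun (measurableSet_strip H) fun p hp => ?_
  change ∫ t in Icc a b, Wt (t, p) = W (b, p) - W (a, p)
  rw [integral_Icc_eq_integral_Ioc, ← intervalIntegral.integral_of_le hab]
  refine intervalIntegral.integral_eq_sub_of_hasDerivAt (f := fun t => W (t, p)) ?_ ?_
  · rw [uIcc_of_le hab]; exact fun t ht => hd t ht p hp
  · refine ContinuousOn.intervalIntegrable ?_
    rw [uIcc_of_le hab]
    exact hc.comp (by fun_prop) (fun t ht => ⟨ht, hp⟩)

/-- A `C²` function supported in `[-R, R]`, with its two derivatives. -/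
structure IsTest (ψ ψ1 ψ2 : ℝ → ℝ) (R : ℝ) : Prop where
  has1 : ∀ x, HasDerivAt ψ (ψ1 x) x
  has2 : ∀ x, HasDerivAt ψ1 (ψ2 x) x
  cont2 : Continuous ψ2
  zero : ∀ x, R < |x| → ψ x = 0
  zero1 : ∀ x, R < |x| → ψ1 x = 0
  zero2 : ∀ x, R < |x| → ψ2 x = 0

lemma IsTest.cont {ψ ψ1 ψ2 : ℝ → ℝ} {R : ℝ} (h : IsTest ψ ψ1 ψ2 R) : Continuous ψ :=
  continuous_iff_continuousAt.2 fun x => (h.has1 x).continuousAt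

lemma IsTest.cont1 {ψ ψ1 ψ2 : ℝ → ℝ} {R : ℝ} (h : IsTest ψ ψ1 ψ2 R) : Continuous ψ1 :=
  continuous_iff_continuousAt.2 fun x => (h.has2 x).continuousAt

lemma IsTest.mul_left {ψ ψ1 ψ2 w w1 w2 : ℝ → ℝ} {R : ℝ} (h : IsTest ψ ψ1 ψ2 R)
    (hw1 : ∀ x, HasDerivAt w (w1 x) x) (hw2 : ∀ x, HasDerivAt w1 (w2 x) x) (hc : Continuous w2) :
    IsTest (fun x => w x * ψ x) (fun x => w1 x * ψ x + w x * ψ1 x)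
      (fun x => w2 x * ψ x + 2 * (w1 x * ψ1 x) + w x * ψ2 x) R where
  has1 x := (hw1 x).mul (h.has1 x)
  has2 x := (((hw2 x).mul (h.has1 x)).add ((hw1 x).mul (h.has2 x))).congr_deriv (by ring)
  cont2 := by
    have c0 : Continuous w := continuous_iff_continuousAt.2 fun x => (hw1 x).continuousAt
    have c1 : Continuous w1 := continuous_iff_continuousAt.2 fun x => (hw2 x).continuousAt
    have := h.cont
    have := h.cont1
    have := h.cont2
    fun_prop
  zero x hx := by simp [h.zero x hx]
  zero1 x hx := by simp [h.zero x hx, h.zero1 x hx]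
  zero2 x hx := by simp [h.zero x hx, h.zero1 x hx, h.zero2 x hx]

variable {f u : ℝ → ℝ} {κ c H : ℝ} {T Tt Tx Ty Txx Tyy : ℝ × ℝ × ℝ → ℝ}

lemma slab_subset {a b H : ℝ} (ha : 0 < a) : slab a b H ⊆ Ioi 0 ×ˢ strip H :=
  prod_mono (fun _ ht => lt_of_lt_of_le ha ht.1) le_rfl

lemma slab_subset_Ici {a b H : ℝ} (ha : 0 ≤ a) : slab a b H ⊆ Ici 0 ×ˢ strip H :=
  prod_mono (fun _ ht => ha.trans ht.1) le_rfl

lemma continuousOn_slice {F : ℝ × ℝ × ℝ → ℝ} {I : Set ℝ} {t : ℝ} (ht : t ∈ I)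
    (hF : ContinuousOn F (I ×ˢ strip H)) : ContinuousOn (fun p => F (t, p)) (strip H) :=
  hF.comp (by fun_prop) (fun _ hp => ⟨ht, hp⟩)

/-- A `C¹` weight on `[0, H]`, compatible with the boundary conditions. -/
structure IsWeight (u : ℝ → ℝ) (H : ℝ) (φ φ1 : ℝ → ℝ) : Prop where
  cont : Continuous φ
  cont1 : Continuous φ1
  has1 : ∀ y ∈ Ioo 0 H, HasDerivAt φ (φ1 y) y
  bdry : u 0 = u H → φ 0 = φ H

lemma isWeight_one (u : ℝ → ℝ) (H : ℝ) : IsWeight u H (fun _ => 1) (fun _ => 0) where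
  cont := continuous_const
  cont1 := continuous_const
  has1 y _ := hasDerivAt_const y 1
  bdry _ := rfl

variable {ψ ψ1 ψ2 φ φ1 G G1 G2 : ℝ → ℝ} {R : ℝ}

/-- The test function is `ψ(x) φ(y) G'(T)`. The two sides differ by exact derivatives: of a flux `P`
in `x`, compactly supported, and of a flux `Q` in `y`, which takes equal values on the two walls. No
second derivative of `T` survives. -/
lemma StripSol.weighted_identity_at (h : StripSol f u κ c H T Tt Tx Ty Txx Tyy) (hH : 0 < H)
    (hψ : IsTest ψ ψ1 ψ2 R)
    (hφ : IsWeight u H φ φ1) (hG1 : ∀ s, HasDerivAt G (G1 s) s)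
    (hG2 : ∀ s, HasDerivAt G1 (G2 s) s) (hGc : Continuous G2) {t : ℝ} (ht : 0 < t) :
    ∫ p in strip H, ψ p.1 * φ p.2 * (G1 (T (t, p)) * Tt (t, p)) =
      ∫ p in strip H, (ψ1 p.1 * (φ p.2 * u p.2 * G (T (t, p)))
        + κ * (ψ2 p.1 * (φ p.2 * G (T (t, p))))
        - κ * (ψ p.1 * (φ1 p.2 * (G1 (T (t, p)) * Ty (t, p))))
        - κ * (ψ p.1 * (φ p.2 * (G2 (T (t, p)) * (Tx (t, p) ^ 2 + Ty (t, p) ^ 2))))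
        + c * (ψ p.1 * (φ p.2 * (G1 (T (t, p)) * f (T (t, p)))))) := by
  have cG : Continuous G := continuous_iff_continuousAt.2 fun x => (hG1 x).continuousAt
  have cG1 : Continuous G1 := continuous_iff_continuousAt.2 fun x => (hG2 x).continuousAt
  have cψ := hψ.cont
  have cψ1 := hψ.cont1
  have cψ2 := hψ.cont2
  have cφ := hφ.cont
  have cφ1 := hφ.cont1
  have cu := h.cont_u
  have cf := h.cont_f
  have cT : ContinuousOn T (Ioi 0 ×ˢ strip H) := h.cont.mono (prod_mono Ioi_subset_Ici_self le_rfl)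
  have cTt := h.cont_t
  have cTx := h.cont_x
  have cTy := h.cont_y
  have cTxx := h.cont_xx
  have cTyy := h.cont_yy
  -- The last term of `P` is a second integration by parts, moving both `x`-derivatives of the
  -- diffusion onto `ψ`.
  set P : ℝ × ℝ × ℝ → ℝ := fun q => φ q.2.2 * (κ * (ψ q.2.1 * (G1 (T q) * Tx q))
    - u q.2.2 * (ψ q.2.1 * G (T q)) - κ * (ψ1 q.2.1 * G (T q))) with hP
  set Px : ℝ × ℝ × ℝ → ℝ := fun q => φ q.2.2 * (κ * (ψ1 q.2.1 * (G1 (T q) * Tx q) +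
      ψ q.2.1 * (G2 (T q) * Tx q * Tx q + G1 (T q) * Txx q))
    - u q.2.2 * (ψ1 q.2.1 * G (T q) + ψ q.2.1 * (G1 (T q) * Tx q))
    - κ * (ψ2 q.2.1 * G (T q) + ψ1 q.2.1 * (G1 (T q) * Tx q))) with hPx
  set Q : ℝ × ℝ × ℝ → ℝ := fun q => κ * ψ q.2.1 * (φ q.2.2 * (G1 (T q) * Ty q)) with hQ
  set Qy : ℝ × ℝ × ℝ → ℝ := fun q => κ * ψ q.2.1 * (φ1 q.2.2 * (G1 (T q) * Ty q) +
    φ q.2.2 * (G2 (T q) * Ty q * Ty q + G1 (T q) * Tyy q)) with hQy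
  set E : ℝ × ℝ × ℝ → ℝ := fun q => ψ1 q.2.1 * (φ q.2.2 * u q.2.2 * G (T q))
        + κ * (ψ2 q.2.1 * (φ q.2.2 * G (T q)))
        - κ * (ψ q.2.1 * (φ1 q.2.2 * (G1 (T q) * Ty q)))
        - κ * (ψ q.2.1 * (φ q.2.2 * (G2 (T q) * (Tx q ^ 2 + Ty q ^ 2))))
        + c * (ψ q.2.1 * (φ q.2.2 * (G1 (T q) * f (T q)))) with hE
  have cPx : ContinuousOn (fun p => Px (t, p)) (strip H) :=
    continuousOn_slice (I := Ioi 0) ht (by simp only [hPx]; fun_prop)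
  have cQy : ContinuousOn (fun p => Qy (t, p)) (strip H) :=
    continuousOn_slice (I := Ioi 0) ht (by simp only [hQy]; fun_prop)
  have cQ : ContinuousOn (fun p => Q (t, p)) (strip H) :=
    continuousOn_slice (I := Ioi 0) ht (by simp only [hQ]; fun_prop)
  have cE : ContinuousOn (fun p => E (t, p)) (strip H) :=
    continuousOn_slice (I := Ioi 0) ht (by simp only [hE]; fun_prop)
  have zPx : ∀ p : ℝ × ℝ, R < |p.1| → Px (t, p) = 0 := fun p hp => by
    simp [hPx, hψ.zero _ hp, hψ.zero1 _ hp, hψ.zero2 _ hp]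
  have zQy : ∀ p : ℝ × ℝ, R < |p.1| → Qy (t, p) = 0 := fun p hp => by
    simp [hQy, hψ.zero _ hp]
  have iPx : ∫ p in strip H, Px (t, p) = 0 := by
    refine integral_dx_eq_zero (P := fun p => P (t, p)) (R := R) (fun x y hy => ?_) cPx (fun p hp => by
      simp [hP, hψ.zero _ hp, hψ.zero1 _ hp]) zPx
    have dT := h.has_x t ht x y hy
    have dG : HasDerivAt (fun s => G (T (t, s, y))) (G1 (T (t, x, y)) * Tx (t, x, y)) x :=
      (hG1 (T (t, x, y))).comp x dT
    have dG1 : HasDerivAt (fun s => G1 (T (t, s, y))) (G2 (T (t, x, y)) * Tx (t, x, y)) x :=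
      (hG2 (T (t, x, y))).comp x dT
    exact ((((hψ.has1 x).mul (dG1.mul (h.has_xx t ht x y hy))).const_mul κ).sub
      (((hψ.has1 x).mul dG).const_mul (u y)) |>.sub
      (((hψ.has2 x).mul dG).const_mul κ)).const_mul (φ y)
  have iQy : ∫ p in strip H, Qy (t, p) = 0 := by
    refine integral_dy_eq_zero (Q := fun p => Q (t, p)) (R := R) hH.le (fun x => ?_) (fun x y hy => ?_) cQy zQy
      (fun x => ?_)
    · exact cQ.comp (by fun_prop) (fun y hy => ⟨trivial, hy⟩)
    · have hn : Icc 0 H ∈ 𝓝 y := Icc_mem_nhds hy.1 hy.2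
      have hy' : y ∈ Icc 0 H := ⟨hy.1.le, hy.2.le⟩
      have dT := (h.has_y t ht x y hy').hasDerivAt hn
      have dTy := (h.has_yy t ht x y hy').hasDerivAt hn
      have dG1 : HasDerivAt (fun s => G1 (T (t, x, s))) (G2 (T (t, x, y)) * Ty (t, x, y)) y :=
        (hG2 (T (t, x, y))).comp y dT
      exact ((hφ.has1 y hy).mul (dG1.mul dTy)).const_mul (κ * ψ x)
    · simp only [hQ]
      rcases h.bdry with hb | ⟨hu0, hb⟩
      · rw [(hb t ht x).1, (hb t ht x).2]; ring
      · rw [(hb t ht x).1, (hb t ht x).2, hφ.bdry hu0]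
  have nPx := integrableOn_strip_of_compact cPx zPx
  have nQy := integrableOn_strip_of_compact cQy zQy
  have nE : IntegrableOn (fun p => E (t, p)) (strip H) :=
    integrableOn_strip_of_compact (R := R) cE fun p hp => by
      simp [hE, hψ.zero _ hp, hψ.zero1 _ hp, hψ.zero2 _ hp]
  have e : ∫ p in strip H, (E (t, p) + (Px (t, p) + Qy (t, p))) = ∫ p in strip H, E (t, p) := by
    rw [integral_add nE (nPx.fun_add nQy), integral_add nPx nQy, iPx, iQy]; ring
  refine Eq.trans ?_ e
  refine setIntegral_congr_fun (measurableSet_strip H) fun p hp => ?_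
  have := h.pde t ht p.1 p.2 hp.2
  simp only [hE, hPx, hQy]
  linear_combination ψ p.1 * φ p.2 * G1 (T (t, p)) * this

lemma StripSol.weighted_identity (h : StripSol f u κ c H T Tt Tx Ty Txx Tyy) (hH : 0 < H)
    (hψ : IsTest ψ ψ1 ψ2 R)
    (hφ : IsWeight u H φ φ1) (hG1 : ∀ s, HasDerivAt G (G1 s) s)
    (hG2 : ∀ s, HasDerivAt G1 (G2 s) s) (hGc : Continuous G2) {a b : ℝ} (ha : 0 < a)
    (hab : a ≤ b) :
    (∫ p in strip H, ψ p.1 * (φ p.2 * G (T (b, p))))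
      - ∫ p in strip H, ψ p.1 * (φ p.2 * G (T (a, p))) =
      (∫ p in slab a b H, ψ1 p.2.1 * (φ p.2.2 * u p.2.2 * G (T p)))
        + κ * (∫ p in slab a b H, ψ2 p.2.1 * (φ p.2.2 * G (T p)))
        - κ * (∫ p in slab a b H, ψ p.2.1 * (φ1 p.2.2 * (G1 (T p) * Ty p)))
        - κ * (∫ p in slab a b H, ψ p.2.1 * (φ p.2.2 * (G2 (T p) * (Tx p ^ 2 + Ty p ^ 2))))
        + c * (∫ p in slab a b H, ψ p.2.1 * (φ p.2.2 * (G1 (T p) * f (T p)))) := by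
  have cG : Continuous G := continuous_iff_continuousAt.2 fun x => (hG1 x).continuousAt
  have cG1 : Continuous G1 := continuous_iff_continuousAt.2 fun x => (hG2 x).continuousAt
  have cψ := hψ.cont
  have cψ1 := hψ.cont1
  have cψ2 := hψ.cont2
  have cφ := hφ.cont
  have cφ1 := hφ.cont1
  have cu := h.cont_u
  have cf := h.cont_f
  have cT := h.cont.mono (slab_subset_Ici (b := b) ha.le)
  have cTt := h.cont_t.mono (slab_subset (b := b) ha)
  have cTx := h.cont_x.mono (slab_subset (b := b) ha)
  have cTy := h.cont_y.mono (slab_subset (b := b) ha)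
  have n1 : IntegrableOn (fun p : ℝ × ℝ × ℝ => ψ1 p.2.1 * (φ p.2.2 * u p.2.2 * G (T p)))
      (slab a b H) :=
    integrableOn_slab_of_compact (R := R) (by fun_prop) fun p hp => by simp [hψ.zero1 _ hp]
  have n2 : IntegrableOn (fun p : ℝ × ℝ × ℝ => κ * (ψ2 p.2.1 * (φ p.2.2 * G (T p))))
      (slab a b H) :=
    integrableOn_slab_of_compact (R := R) (by fun_prop) fun p hp => by simp [hψ.zero2 _ hp]
  have n3 : IntegrableOn (fun p : ℝ × ℝ × ℝ => κ * (ψ p.2.1 * (φ1 p.2.2 * (G1 (T p) * Ty p))))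
      (slab a b H) :=
    integrableOn_slab_of_compact (R := R) (by fun_prop) fun p hp => by simp [hψ.zero _ hp]
  have n4 : IntegrableOn (fun p : ℝ × ℝ × ℝ =>
      κ * (ψ p.2.1 * (φ p.2.2 * (G2 (T p) * (Tx p ^ 2 + Ty p ^ 2))))) (slab a b H) :=
    integrableOn_slab_of_compact (R := R) (by fun_prop) fun p hp => by simp [hψ.zero _ hp]
  have n5 : IntegrableOn (fun p : ℝ × ℝ × ℝ => c * (ψ p.2.1 * (φ p.2.2 * (G1 (T p) * f (T p)))))
      (slab a b H) :=
    integrableOn_slab_of_compact (R := R) (by fun_prop) fun p hp => by simp [hψ.zero _ hp]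
  have n12 := n1.fun_add n2
  have n123 := n12.sub' n3
  have n1234 := n123.sub' n4
  have cW : ∀ t, 0 < t → IntegrableOn (fun p => ψ p.1 * (φ p.2 * G (T (t, p)))) (strip H) := by
    intro t ht
    have cT' : ContinuousOn T (Ici 0 ×ˢ strip H) := h.cont
    refine integrableOn_strip_of_compact (R := R) ?_ fun p hp => by simp [hψ.zero _ hp]
    exact continuousOn_slice (I := Ici 0) (F := fun q => ψ q.2.1 * (φ q.2.2 * G (T q))) ht.le
      (by fun_prop)
  have cWt : ContinuousOn (fun p : ℝ × ℝ × ℝ => ψ p.2.1 * φ p.2.2 * (G1 (T p) * Tt p))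
      (slab a b H) := by fun_prop
  have zWt : ∀ p : ℝ × ℝ × ℝ, R < |p.2.1| → ψ p.2.1 * φ p.2.2 * (G1 (T p) * Tt p) = 0 :=
    fun p hp => by simp [hψ.zero _ hp]
  rw [← integral_time_deriv (R := R) (W := fun p => ψ p.2.1 * (φ p.2.2 * G (T p)))
    (Wt := fun p => ψ p.2.1 * φ p.2.2 * (G1 (T p) * Tt p)) hab (fun t ht p hp => ?_) cWt zWt
    (cW a ha) (cW b (ha.trans_le hab))]
  · rw [setIntegral_slab (integrableOn_slab_of_compact cWt zWt),
      ← integral_const_mul, ← integral_const_mul, ← integral_const_mul, ← integral_const_mul,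
      ← integral_add n1 n2, ← integral_sub n12 n3, ← integral_sub n123 n4,
      ← integral_add n1234 n5, setIntegral_slab (n1234.fun_add n5)]
    refine setIntegral_congr_fun measurableSet_Icc fun t ht => ?_
    exact h.weighted_identity_at hH hψ hφ hG1 hG2 hGc (ha.trans_le ht.1)
  · have := (hG1 (T (t, p))).comp t (h.has_t t (ha.trans_le ht.1) p.1 p.2 hp.2)
    exact ((this.const_mul (φ p.2)).const_mul (ψ p.1)).congr_deriv (by simp only [Prod.mk.eta]; ring)

end BulkBurning

/-! ### Cutoffs in `x` and the limits in which they are removed. -/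

namespace BulkBurning

open Filter Topology

/-- A fixed smooth bump, equal to `1` on `[-1, 1]` and supported in `[-2, 2]`. -/
noncomputable def bump : ContDiffBump (0 : ℝ) := ⟨1, 2, one_pos, one_lt_two⟩

/-- Cutoff at scale `n + 1`, and its derivatives. -/
noncomputable def cutoff (n : ℕ) (x : ℝ) : ℝ := bump (x / (n + 1))

/-- First derivative of `cutoff n`. -/
noncomputable def cutoff1 (n : ℕ) (x : ℝ) : ℝ := deriv bump (x / (n + 1)) / (n + 1)

/-- Second derivative of `cutoff n`. -/
noncomputable def cutoff2 (n : ℕ) (x : ℝ) : ℝ := deriv (deriv bump) (x / (n + 1)) / (n + 1) ^ 2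

lemma contDiff_deriv_bump : ContDiff ℝ 1 (deriv bump) :=
  (contDiff_succ_iff_deriv.1 (show ContDiff ℝ (1 + 1) bump from bump.contDiff)).2.2

lemma bump_zero_of_lt {x : ℝ} (hx : 2 < |x|) :
    bump x = 0 ∧ deriv bump x = 0 ∧ deriv (deriv bump) x = 0 := by
  have h0 : bump =ᶠ[𝓝 x] fun _ => (0 : ℝ) := by
    filter_upwards [(isOpen_lt continuous_const continuous_abs).mem_nhds hx] with z hz
    refine bump.zero_of_le_dist ?_
    rw [Real.dist_eq, sub_zero]
    exact le_of_lt hz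
  have h1 : deriv bump =ᶠ[𝓝 x] fun _ => (0 : ℝ) := by
    have := h0.deriv
    simpa using this
  exact ⟨h0.eq_of_nhds, h1.eq_of_nhds, by simpa using h1.deriv.eq_of_nhds⟩

lemma isTest_cutoff (n : ℕ) : IsTest (cutoff n) (cutoff1 n) (cutoff2 n) (2 * (n + 1)) := by
  have hn : (0 : ℝ) < n + 1 := by positivity
  have hz : ∀ x : ℝ, 2 * ((n : ℝ) + 1) < |x| → 2 < |x / (n + 1)| := by
    intro x hx
    rw [abs_div, abs_of_pos hn, lt_div_iff₀ hn]
    exact hx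
  have hd : ∀ x : ℝ, HasDerivAt (fun x : ℝ => x / ((n : ℝ) + 1)) (1 / ((n : ℝ) + 1)) x := fun x =>
    (hasDerivAt_id x).div_const _
  refine ⟨fun x => ?_, fun x => ?_, ?_, fun x hx => (bump_zero_of_lt (hz x hx)).1,
    fun x hx => ?_, fun x hx => ?_⟩
  · have h1 : HasDerivAt bump (deriv bump (x / (n + 1))) (x / (n + 1)) :=
      ((bump.contDiff (n := 1)).differentiable (by norm_num) _).hasDerivAt
    exact (h1.comp x (hd x)).congr_deriv (by rw [cutoff1]; ring)
  · have h1 : HasDerivAt (deriv bump) (deriv (deriv bump) (x / (n + 1))) (x / (n + 1)) :=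
      (contDiff_deriv_bump.differentiable (by norm_num) _).hasDerivAt
    refine ((h1.comp x (hd x)).div_const ((n : ℝ) + 1)).congr_deriv ?_
    simp only [cutoff2]
    field_simp
  · have := (contDiff_deriv_bump.continuous_deriv (by norm_num))
    unfold cutoff2
    fun_prop
  · simp [cutoff1, (bump_zero_of_lt (hz x hx)).2.1]
  · simp [cutoff2, (bump_zero_of_lt (hz x hx)).2.2]

lemma cutoff_nonneg (n : ℕ) (x : ℝ) : 0 ≤ cutoff n x := bump.nonneg

lemma cutoff_le_one (n : ℕ) (x : ℝ) : cutoff n x ≤ 1 := bump.le_one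

lemma tendsto_cutoff (x : ℝ) : Tendsto (fun n => cutoff n x) atTop (𝓝 1) := by
  obtain ⟨m, hm⟩ := exists_nat_ge |x|
  refine tendsto_const_nhds.congr' ?_
  filter_upwards [eventually_ge_atTop m] with n hn
  refine (bump.one_of_mem_closedBall ?_).symm
  have hn' : (m : ℝ) ≤ n := by exact_mod_cast hn
  rw [mem_closedBall_zero_iff, Real.norm_eq_abs, abs_div, abs_of_pos (by positivity : (0:ℝ) < n + 1)]
  change _ ≤ (1 : ℝ)
  rw [div_le_one (by positivity)]
  linarith

/-- The second derivative in fact gains `(n + 1)⁻²`; a common rate tending to 0 is all that is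
needed. -/
lemma exists_cutoff_bound : ∃ C > 0, ∀ n x, |cutoff1 n x| ≤ C / (n + 1) ∧
    |cutoff2 n x| ≤ C / (n + 1) := by
  have key : ∀ g : ℝ → ℝ, Continuous g → (∀ x, 2 < |x| → g x = 0) → ∃ C > 0, ∀ x, |g x| ≤ C := by
    intro g hg h0
    obtain ⟨C, hC⟩ := (isCompact_Icc (a := (-2 : ℝ)) (b := 2)).exists_bound_of_continuousOn
      hg.continuousOn
    refine ⟨|C| + 1, by positivity, fun x => ?_⟩
    by_cases hx : 2 < |x|
    · rw [h0 x hx, abs_zero]; positivity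
    · have := hC x (abs_le.1 (not_lt.1 hx))
      rw [Real.norm_eq_abs] at this
      linarith [le_abs_self C]
  obtain ⟨C1, hC1, h1⟩ := key (deriv bump) contDiff_deriv_bump.continuous
    fun x hx => (bump_zero_of_lt hx).2.1
  obtain ⟨C2, hC2, h2⟩ := key (deriv (deriv bump)) (contDiff_deriv_bump.continuous_deriv (by norm_num))
    fun x hx => (bump_zero_of_lt hx).2.2
  refine ⟨C1 + C2, by positivity, fun n x => ⟨?_, ?_⟩⟩
  · rw [cutoff1, abs_div, abs_of_pos (by positivity : (0:ℝ) < n + 1)]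
    gcongr
    linarith [h1 (x / (n + 1))]
  · rw [cutoff2, abs_div, abs_of_pos (by positivity : (0:ℝ) < (n + 1) ^ 2)]
    have hn : (1 : ℝ) ≤ n + 1 := by linarith [(Nat.cast_nonneg n : (0 : ℝ) ≤ n)]
    gcongr
    · linarith [h2 (x / (n + 1))]
    · nlinarith

/-- The step profile: `1` for `x < 0` and `0` for `x ≥ 0`. -/
noncomputable def step (x : ℝ) : ℝ := (Iio (0 : ℝ)).indicator 1 x

/-- Computes the flux of an ideal front: applied to a cutoff the value is 1, applied to its
derivative it is 0, because the cutoff is constant near the origin. -/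
lemma integral_mul_step_of_hasDerivAt {g g' : ℝ → ℝ} {R : ℝ} (hd : ∀ x, HasDerivAt g (g' x) x)
    (hc : Continuous g') (h0 : ∀ x, R < |x| → g x = 0) (h1 : ∀ x, R < |x| → g' x = 0) :
    Integrable (fun x => g' x * step x) ∧ ∫ x, g' x * step x = g 0 := by
  have hi : Integrable g' := hc.integrable_of_hasCompactSupport
    (HasCompactSupport.intro (isCompact_Icc (a := -R) (b := R)) fun x hx => h1 x (by
      by_contra! hle
      exact hx (abs_le.1 hle)))
  have e : (fun x => g' x * step x) = (Iio (0 : ℝ)).indicator g' := by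
    ext x
    by_cases hx : x ∈ Iio (0 : ℝ) <;> simp [step, hx]
  rw [e]
  refine ⟨hi.indicator measurableSet_Iio, ?_⟩
  rw [integral_indicator measurableSet_Iio, ← integral_Iic_eq_integral_Iio,
    integral_Iic_of_hasDerivAt_of_tendsto' (m := 0) (fun x _ => hd x) hi.integrableOn, sub_zero]
  refine tendsto_const_nhds.congr' ?_
  filter_upwards [eventually_lt_atBot (-|R|)] with x hx
  refine (h0 x ?_).symm
  rw [abs_of_neg (by linarith [abs_nonneg R])]
  linarith [le_abs_self R]

lemma cutoff1_step (n : ℕ) : Integrable (fun x => cutoff1 n x * step x) ∧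
    ∫ x, cutoff1 n x * step x = 1 := by
  have h := isTest_cutoff n
  have := integral_mul_step_of_hasDerivAt h.has1 h.cont1 h.zero h.zero1
  refine ⟨this.1, this.2.trans ?_⟩
  rw [cutoff, zero_div]
  exact bump.one_of_mem_closedBall (by simp [bump.rIn_pos.le])

lemma cutoff2_step (n : ℕ) : Integrable (fun x => cutoff2 n x * step x) ∧
    ∫ x, cutoff2 n x * step x = 0 := by
  have h := isTest_cutoff n
  have := integral_mul_step_of_hasDerivAt h.has2 h.cont2 h.zero1 h.zero2
  refine ⟨this.1, this.2.trans ?_⟩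
  rw [cutoff1, zero_div, bump.eventuallyEq_one.deriv_eq]
  simp

/-- `B` itself is not integrable, so it is split into the step, whose contribution is `L` for every
`n`, and an integrable remainder, which is killed by the factor `1 / (n + 1)` through dominated
convergence. -/
lemma tendsto_integral_cutoff_mul {γ : Type*} [MeasurableSpace γ] {m : Measure γ} {X w B : γ → ℝ}
    {N : ℝ → ℝ} {k : ℕ → ℝ → ℝ} {M W L : ℝ} (hX : Measurable X) (hk : ∀ n, Continuous (k n))
    (hM : 0 ≤ M) (hkM : ∀ n x, |k n x| ≤ M / (n + 1)) (hw : AEStronglyMeasurable w m)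
    (hwW : ∀ᵐ p ∂m, |w p| ≤ W) (hB : AEStronglyMeasurable B m)
    (hBN : ∀ᵐ p ∂m, |B p - step (X p)| ≤ N (X p)) (hN : Integrable (fun p => N (X p)) m)
    (hi : ∀ n, Integrable (fun p => k n (X p) * step (X p) * w p) m)
    (hL : ∀ n, ∫ p, k n (X p) * step (X p) * w p ∂m = L) :
    Tendsto (fun n => ∫ p, k n (X p) * (w p * B p) ∂m) atTop (𝓝 L) := by
  have hst : AEStronglyMeasurable (fun p => step (X p)) m :=
    ((measurable_const.indicator measurableSet_Iio).comp hX).aestronglyMeasurable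
  have hkn : ∀ n, AEStronglyMeasurable (fun p => k n (X p)) m := fun n =>
    ((hk n).measurable.comp hX).aestronglyMeasurable
  set D : ℕ → γ → ℝ := fun n p => k n (X p) * (w p * (B p - step (X p)))
  have hDm : ∀ n, AEStronglyMeasurable (D n) m := fun n => (hkn n).mul (hw.mul (hB.sub hst))
  have hbd : ∀ n, ∀ᵐ p ∂m, ‖D n p‖ ≤ M * (W * N (X p)) := by
    intro n
    filter_upwards [hwW, hBN] with p h1 h2
    rw [Real.norm_eq_abs, abs_mul, abs_mul]
    have h3 : |k n (X p)| ≤ M := (hkM n _).trans (div_le_self hM (by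
      linarith [(Nat.cast_nonneg n : (0 : ℝ) ≤ n)]))
    have := (abs_nonneg _).trans h1
    gcongr
  have hbi : Integrable (fun p => M * (W * N (X p))) m := (hN.const_mul W).const_mul M
  have hk0 : ∀ x, Tendsto (fun n => k n x) atTop (𝓝 0) := by
    intro x
    refine squeeze_zero_norm (fun n => hkM n x) ?_
    have := (tendsto_const_div_atTop_nhds_zero_nat M).comp (tendsto_add_atTop_nat 1)
    simpa [Function.comp_def] using this
  have ht : Tendsto (fun n => ∫ p, D n p ∂m) atTop (𝓝 (∫ p, (0 : ℝ) ∂m)) := by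
    refine tendsto_integral_of_dominated_convergence _ hDm hbi hbd (Eventually.of_forall fun p => ?_)
    simpa using (hk0 (X p)).mul_const (w p * (B p - step (X p)))
  have e : ∀ n, ∫ p, k n (X p) * (w p * B p) ∂m = L + ∫ p, D n p ∂m := by
    intro n
    rw [← hL n, ← integral_add (hi n) (Integrable.mono' hbi (hDm n) (hbd n))]
    refine integral_congr_ae (Eventually.of_forall fun p => ?_)
    simp only [D]; ring
  simp_rw [e]
  simpa using ht.const_add L

/-- Fatou's lemma, in the form that removes a cutoff from a nonnegative quantity not yet known to be
integrable. -/
lemma integrable_of_tendsto_nonneg {γ : Type*} [MeasurableSpace γ] {m : Measure γ} {h : γ → ℝ}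
    {g : ℕ → γ → ℝ} {Bn : ℕ → ℝ} {B : ℝ} (hm : AEStronglyMeasurable h m)
    (hg : ∀ n, Integrable (g n) m) (hg0 : ∀ n, ∀ᵐ p ∂m, 0 ≤ g n p)
    (hgh : ∀ᵐ p ∂m, Tendsto (fun n => g n p) atTop (𝓝 (h p)))
    (hB : ∀ n, ∫ p, g n p ∂m ≤ Bn n) (hBn : Tendsto Bn atTop (𝓝 B)) :
    Integrable h m ∧ ∫ p, h p ∂m ≤ B := by
  have h0 : ∀ᵐ p ∂m, 0 ≤ h p := by
    filter_upwards [hgh, ae_all_iff.2 hg0] with p hp hp0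
    exact ge_of_tendsto' hp hp0
  have hB0 : 0 ≤ B := ge_of_tendsto' hBn fun n => (integral_nonneg_of_ae (hg0 n)).trans (hB n)
  have key : ∫⁻ p, ENNReal.ofReal (h p) ∂m ≤ ENNReal.ofReal B := by
    calc ∫⁻ p, ENNReal.ofReal (h p) ∂m
        = ∫⁻ p, liminf (fun n => ENNReal.ofReal (g n p)) atTop ∂m := by
          refine lintegral_congr_ae ?_
          filter_upwards [hgh] with p hp
          exact ((ENNReal.continuous_ofReal.tendsto _).comp hp).liminf_eq.symm
      _ ≤ liminf (fun n => ∫⁻ p, ENNReal.ofReal (g n p) ∂m) atTop :=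
          lintegral_liminf_le' fun n => (hg n).aestronglyMeasurable.aemeasurable.ennreal_ofReal
      _ ≤ liminf (fun n => ENNReal.ofReal (Bn n)) atTop := by
          refine liminf_le_liminf (Eventually.of_forall fun n => ?_)
          rw [← ofReal_integral_eq_lintegral_ofReal (hg n) (hg0 n)]
          exact ENNReal.ofReal_le_ofReal (hB n)
      _ = ENNReal.ofReal B := ((ENNReal.continuous_ofReal.tendsto _).comp hBn).liminf_eq
  have hi : Integrable h m :=
    (lintegral_ofReal_ne_top_iff_integrable hm h0).1 (key.trans_lt ENNReal.ofReal_lt_top).ne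
  refine ⟨hi, ?_⟩
  rw [← ofReal_integral_eq_lintegral_ofReal hi h0] at key
  exact (ENNReal.ofReal_le_ofReal_iff hB0).1 key

end BulkBurning

/-! ### Fronts: pointwise decay and gradient energy estimates. -/

namespace BulkBurning

open Filter Topology

/-- A solution in the strip that decays at a polynomial rate to a front, on the time interval
`[0, τ]`, with a nonnegative reaction term. -/
structure Front (f u : ℝ → ℝ) (κ c H : ℝ) (T Tt Tx Ty Txx Tyy : ℝ × ℝ × ℝ → ℝ)
    (τ B K M : ℝ) : Prop where
  sol : StripSol f u κ c H T Tt Tx Ty Txx Tyy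
  hH : 0 < H
  hκ : 0 < κ
  hc : 0 < c
  hB : 0 < B
  hK : 0 < K
  u_le : ∀ y ∈ Icc 0 H, |u y| ≤ M
  f_nonneg : ∀ s ∈ Icc (0 : ℝ) 1, 0 ≤ f s
  f_le : ∀ s ∈ Icc (0 : ℝ) 1, f s ≤ s
  f_le' : ∀ s ∈ Icc (0 : ℝ) 1, f s ≤ K * (1 - s)
  decay : ∀ t ∈ Icc 0 τ, ∀ x, ∀ y ∈ Icc 0 H, (0 ≤ x → T (t, x, y) ≤ B / (1 + x ^ 2) ^ 3) ∧
    (x ≤ 0 → 1 - T (t, x, y) ≤ B / (1 + x ^ 2) ^ 3)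

lemma integrable_decay (B : ℝ) : Integrable (fun x : ℝ => B / (1 + x ^ 2)) := by
  simpa [div_eq_mul_inv] using (integrable_inv_one_add_sq).const_mul B

lemma div_cube_le {B : ℝ} (hB : 0 ≤ B) (x : ℝ) : B / (1 + x ^ 2) ^ 3 ≤ B / (1 + x ^ 2) := by
  have h1 : 1 ≤ 1 + x ^ 2 := by nlinarith [sq_nonneg x]
  gcongr
  exact le_self_pow₀ h1 (by norm_num)

lemma abs_setIntegral_slab_le {F : ℝ × ℝ × ℝ → ℝ} {N : ℝ → ℝ} {a b H : ℝ} (hN : Integrable N)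
    (h : ∀ p ∈ slab a b H, |F p| ≤ N p.2.1) :
    |∫ p in slab a b H, F p| ≤ ∫ p in slab a b H, N p.2.1 := by
  rw [← Real.norm_eq_abs]
  exact norm_integral_le_of_norm_le (integrableOn_slab_fst hN a b H)
    ((ae_restrict_iff' (measurableSet_slab a b H)).2 (Eventually.of_forall h))

lemma abs_setIntegral_strip_le {F : ℝ × ℝ → ℝ} {N : ℝ → ℝ} {H : ℝ} (hN : Integrable N)
    (h : ∀ p ∈ strip H, |F p| ≤ N p.1) :
    |∫ p in strip H, F p| ≤ ∫ p in strip H, N p.1 := by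
  rw [← Real.norm_eq_abs]
  exact norm_integral_le_of_norm_le (integrableOn_strip_fst hN H)
    ((ae_restrict_iff' (measurableSet_strip H)).2 (Eventually.of_forall h))

variable {f u : ℝ → ℝ} {κ c H : ℝ} {T Tt Tx Ty Txx Tyy : ℝ × ℝ × ℝ → ℝ} {τ B K M : ℝ}

namespace Front

lemma M_nonneg (h : Front f u κ c H T Tt Tx Ty Txx Tyy τ B K M) : 0 ≤ M :=
  (abs_nonneg _).trans (h.u_le 0 ⟨le_rfl, h.hH.le⟩)

lemma mem_unit (h : Front f u κ c H T Tt Tx Ty Txx Tyy τ B K M) {p : ℝ × ℝ × ℝ}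
    (hp : p ∈ slab 0 τ H) : T p ∈ Icc (0 : ℝ) 1 :=
  h.sol.range p.1 hp.1.1 p.2.1 p.2.2 hp.2.2

lemma mul_one_sub_mem (h : Front f u κ c H T Tt Tx Ty Txx Tyy τ B K M) {p : ℝ × ℝ × ℝ}
    (hp : p ∈ slab 0 τ H) : T p * (1 - T p) ∈ Icc 0 (B / (1 + p.2.1 ^ 2) ^ 3) := by
  have h1 := h.mem_unit hp
  have h2 := h.decay p.1 hp.1 p.2.1 p.2.2 hp.2.2
  refine ⟨mul_nonneg h1.1 (by linarith [h1.2]), ?_⟩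
  rcases le_total 0 p.2.1 with hx | hx
  · exact le_trans (by nlinarith [h1.1, h1.2]) (h2.1 hx)
  · exact le_trans (by change _ ≤ 1 - T p; nlinarith [h1.1, h1.2]) (h2.2 hx)

lemma f_mem (h : Front f u κ c H T Tt Tx Ty Txx Tyy τ B K M) {p : ℝ × ℝ × ℝ}
    (hp : p ∈ slab 0 τ H) : f (T p) ∈ Icc 0 ((1 + K) * (B / (1 + p.2.1 ^ 2) ^ 3)) := by
  have h1 := h.mem_unit hp
  have h2 := h.decay p.1 hp.1 p.2.1 p.2.2 hp.2.2
  have hN : 0 < B / (1 + p.2.1 ^ 2) ^ 3 := div_pos h.hB (by positivity)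
  have hK := h.hK
  refine ⟨h.f_nonneg _ h1, ?_⟩
  rcases le_total 0 p.2.1 with hx | hx
  · have h3 := h.f_le _ h1
    have h4 : T p ≤ _ := h2.1 hx
    nlinarith
  · have h3 := h.f_le' _ h1
    have h4 : 1 - T p ≤ _ := h2.2 hx
    nlinarith

lemma sub_step_le (h : Front f u κ c H T Tt Tx Ty Txx Tyy τ B K M) {p : ℝ × ℝ × ℝ}
    (hp : p ∈ slab 0 τ H) : |T p - step p.2.1| ≤ B / (1 + p.2.1 ^ 2) ^ 3 := by
  have h1 := h.mem_unit hp
  have h2 := h.decay p.1 hp.1 p.2.1 p.2.2 hp.2.2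
  rcases lt_or_ge p.2.1 0 with hx | hx
  · have h4 : 1 - T p ≤ _ := h2.2 hx.le
    rw [show step p.2.1 = 1 by simp [step, hx], abs_of_nonpos (by linarith [h1.2])]
    linarith
  · have h4 : T p ≤ _ := h2.1 hx
    rw [show step p.2.1 = 0 by simp [step, hx], abs_of_nonneg (by linarith [h1.1])]
    linarith

lemma slab_sub {a b : ℝ} (ha : 0 < a) (hb : b ≤ τ) : slab a b H ⊆ slab 0 τ H :=
  prod_mono (Icc_subset_Icc ha.le hb) le_rfl

/-- The choice `G(s) = s(1-s)` has `G'' = -2`, which produces `|∇T|²` with a definite sign, and `G`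
vanishes at both ends of the front, so every term on the right decays. -/
lemma grad_identity (h : Front f u κ c H T Tt Tx Ty Txx Tyy τ B K M) {ψ ψ1 ψ2 : ℝ → ℝ} {R : ℝ}
    (hψ : IsTest ψ ψ1 ψ2 R) {a b : ℝ} (ha : 0 < a) (hab : a ≤ b) :
    2 * κ * (∫ p in slab a b H, ψ p.2.1 * (Tx p ^ 2 + Ty p ^ 2)) =
      (∫ p in strip H, ψ p.1 * (T (b, p) * (1 - T (b, p))))
      - (∫ p in strip H, ψ p.1 * (T (a, p) * (1 - T (a, p))))
      - (∫ p in slab a b H, ψ1 p.2.1 * (u p.2.2 * (T p * (1 - T p))))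
      - κ * (∫ p in slab a b H, ψ2 p.2.1 * (T p * (1 - T p)))
      - c * (∫ p in slab a b H, ψ p.2.1 * ((1 - 2 * T p) * f (T p))) := by
  have := h.sol.weighted_identity h.hH hψ (isWeight_one u H) (G := fun s => s * (1 - s))
    (G1 := fun s => 1 - 2 * s) (G2 := fun _ => -2)
    (fun s => ((hasDerivAt_id s).mul ((hasDerivAt_id s).const_sub 1)).congr_deriv
      (by simp only [id]; ring))
    (fun s => (((hasDerivAt_id s).const_mul 2).const_sub 1).congr_deriv (by ring))
    continuous_const ha hab
  simp only [one_mul, zero_mul, mul_zero, integral_zero, sub_zero] at this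
  have e : ∫ p in slab a b H, ψ p.2.1 * (-2 * (Tx p ^ 2 + Ty p ^ 2)) =
      -2 * ∫ p in slab a b H, ψ p.2.1 * (Tx p ^ 2 + Ty p ^ 2) := by
    rw [← integral_const_mul]
    congr 1
    ext p
    ring
  rw [e] at this
  linarith

lemma cont_grad (h : Front f u κ c H T Tt Tx Ty Txx Tyy τ B K M) {a b : ℝ} (ha : 0 < a) :
    ContinuousOn (fun p => Tx p ^ 2 + Ty p ^ 2) (slab a b H) := by
  have c1 := h.sol.cont_x.mono (slab_subset (b := b) ha)
  have c2 := h.sol.cont_y.mono (slab_subset (b := b) ha)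
  fun_prop

/-- The weight `(1+x²)²` and its derivatives are of size at most `(1+x²)²`, while `T(1-T)` and
`f(T)` decay like `(1+x²)⁻³`. The products are dominated by the integrable `(1+x²)⁻¹`, so the
cut-off energies are bounded uniformly in `n`. -/
lemma weighted_grad_integrable (h : Front f u κ c H T Tt Tx Ty Txx Tyy τ B K M) {a b : ℝ}
    (ha : 0 < a) (hab : a ≤ b) (hb : b ≤ τ) :
    IntegrableOn (fun p => (1 + p.2.1 ^ 2) ^ 2 * (Tx p ^ 2 + Ty p ^ 2)) (slab a b H) := by
  obtain ⟨C, hC, hCb⟩ := exists_cutoff_bound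
  set w : ℝ → ℝ := fun x => (1 + x ^ 2) ^ 2 with hw
  have hT : ∀ n, IsTest _ _ _ _ := fun n => (isTest_cutoff n).mul_left (w := w)
    (w1 := fun x => 4 * x * (1 + x ^ 2)) (w2 := fun x => 4 + 12 * x ^ 2)
    (fun x => by
      have h1 : HasDerivAt (fun x : ℝ => 1 + x ^ 2) (2 * x) x := by
        simpa using (hasDerivAt_pow 2 x).const_add 1
      exact (h1.pow 2).congr_deriv (by push_cast; ring))
    (fun x => by
      have h1 : HasDerivAt (fun x : ℝ => 1 + x ^ 2) (2 * x) x := by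
        simpa using (hasDerivAt_pow 2 x).const_add 1
      exact (((hasDerivAt_id x).const_mul 4).mul h1).congr_deriv (by simp only [id]; ring))
    (by fun_prop)
  have hCn : ∀ (n : ℕ) x, |cutoff1 n x| ≤ C ∧ |cutoff2 n x| ≤ C := fun n x => by
    have : C / ((n : ℝ) + 1) ≤ C := div_le_self hC.le (by linarith [(Nat.cast_nonneg n : (0:ℝ) ≤ n)])
    exact ⟨(hCb n x).1.trans this, (hCb n x).2.trans this⟩
  -- The worst case is the second derivative of weight times cutoff: `12` from the weight, `2 * 2 *
  -- C` from the mixed term, `C` from the cutoff.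
  set C0 := 12 + 5 * C
  have b0 : ∀ (n : ℕ) x, |w x * cutoff n x| ≤ C0 * (1 + x ^ 2) ^ 2 := fun n x => by
    rw [abs_mul, abs_of_nonneg (cutoff_nonneg n x), abs_of_nonneg (by simp only [hw]; positivity)]
    have := cutoff_le_one n x
    have h2 : 0 < (1 + x ^ 2) ^ 2 := by positivity
    simp only [hw, C0]; nlinarith [cutoff_nonneg n x]
  have hx1 : ∀ x : ℝ, |4 * x * (1 + x ^ 2)| ≤ 2 * (1 + x ^ 2) ^ 2 := fun x => by
    rw [abs_le]; constructor <;>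
    nlinarith [mul_nonneg (sq_nonneg (x + 1)) (by positivity : 0 ≤ 1 + x ^ 2),
      mul_nonneg (sq_nonneg (x - 1)) (by positivity : 0 ≤ 1 + x ^ 2)]
  have hx2 : ∀ x : ℝ, |4 + 12 * x ^ 2| ≤ 12 * (1 + x ^ 2) ^ 2 := fun x => by
    rw [abs_of_nonneg (by positivity)]; nlinarith [sq_nonneg x, sq_nonneg (x ^ 2)]
  have hcut : ∀ (n : ℕ) x, |cutoff n x| ≤ 1 := fun n x => by
    rw [abs_of_nonneg (cutoff_nonneg n x)]; exact cutoff_le_one n x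
  have hwa : ∀ x, |w x| = (1 + x ^ 2) ^ 2 := fun x =>
    abs_of_nonneg (by simp only [hw]; positivity)
  have b1 : ∀ (n : ℕ) x, |4 * x * (1 + x ^ 2) * cutoff n x + w x * cutoff1 n x| ≤
      C0 * (1 + x ^ 2) ^ 2 := fun n x => by
    refine (abs_add_le _ _).trans ?_
    rw [abs_mul _ (cutoff n x), abs_mul (w x), hwa]
    have h3 := mul_le_mul (hx1 x) (hcut n x) (abs_nonneg _) (by positivity)
    have h4 : (1 + x ^ 2) ^ 2 * |cutoff1 n x| ≤ (1 + x ^ 2) ^ 2 * C :=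
      mul_le_mul_of_nonneg_left (hCn n x).1 (by positivity)
    have h5 : 0 < (1 + x ^ 2) ^ 2 * C := by positivity
    have h6 : 0 < (1 + x ^ 2) ^ 2 := by positivity
    simp only [C0]; nlinarith
  have b2 : ∀ (n : ℕ) x, |(4 + 12 * x ^ 2) * cutoff n x + 2 * (4 * x * (1 + x ^ 2) * cutoff1 n x) +
      w x * cutoff2 n x| ≤ C0 * (1 + x ^ 2) ^ 2 := fun n x => by
    refine (abs_add_three _ _ _).trans ?_
    rw [abs_mul _ (cutoff n x), abs_mul (w x), hwa, abs_mul 2, abs_mul _ (cutoff1 n x),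
      abs_of_pos (two_pos : (0:ℝ) < 2)]
    have h2 := mul_le_mul (hx2 x) (hcut n x) (abs_nonneg _) (by positivity)
    have h3 := mul_le_mul (hx1 x) (hCn n x).1 (abs_nonneg _) (by positivity)
    have h4 : (1 + x ^ 2) ^ 2 * |cutoff2 n x| ≤ (1 + x ^ 2) ^ 2 * C :=
      mul_le_mul_of_nonneg_left (hCn n x).2 (by positivity)
    simp only [C0]; nlinarith
  have hM := h.M_nonneg
  have hB := h.hB
  have hK := h.hK
  have hC0 : 0 < C0 := by positivity
  have hG : ∀ p ∈ slab a b H, |T p * (1 - T p)| ≤ B / (1 + p.2.1 ^ 2) ^ 3 := fun p hp => by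
    have := h.mul_one_sub_mem (slab_sub ha hb hp)
    rw [abs_of_nonneg this.1]; exact this.2
  have hGs : ∀ t ∈ Icc a b, ∀ p ∈ strip H, |T (t, p) * (1 - T (t, p))| ≤ B / (1 + p.1 ^ 2) ^ 3 :=
    fun t ht p hp => hG (t, p) ⟨ht, hp⟩
  have hF : ∀ p ∈ slab a b H, |(1 - 2 * T p) * f (T p)| ≤ (1 + K) * (B / (1 + p.2.1 ^ 2) ^ 3) :=
    fun p hp => by
      have h1 := h.f_mem (slab_sub ha hb hp)
      have h2 := h.mem_unit (slab_sub ha hb hp)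
      rw [abs_mul, abs_of_nonneg h1.1]
      have h3 : |1 - 2 * T p| ≤ 1 := abs_le.2 ⟨by linarith [h2.2], by linarith [h2.1]⟩
      calc _ ≤ 1 * f (T p) := mul_le_mul_of_nonneg_right h3 h1.1
        _ ≤ _ := by rw [one_mul]; exact h1.2
  have hp2 : ∀ x D : ℝ, C0 * (1 + x ^ 2) ^ 2 * (D * (B / (1 + x ^ 2) ^ 3)) =
      C0 * D * B / (1 + x ^ 2) := fun x D => by field_simp
  set Is : ℝ := ∫ p in strip H, C0 * 1 * B / (1 + p.1 ^ 2)
  set J : ℝ → ℝ := fun D => ∫ p in slab a b H, C0 * D * B / (1 + p.2.1 ^ 2)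
  set Z := Is + Is + J M + κ * J 1 + c * J (1 + K)
  have bound : ∀ n : ℕ, ∫ p in slab a b H, w p.2.1 * cutoff n p.2.1 * (Tx p ^ 2 + Ty p ^ 2) ≤
      Z / (2 * κ) := by
    intro n
    rw [le_div_iff₀ (by linarith [h.hκ])]
    have e := h.grad_identity (hT n) ha hab
    have s1 : ∀ t ∈ Icc a b, |∫ p in strip H, w p.1 * cutoff n p.1 * (T (t, p) * (1 - T (t, p)))| ≤ Is :=
      fun t ht => abs_setIntegral_strip_le (N := fun x => C0 * 1 * B / (1 + x ^ 2)) (integrable_decay _)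
        fun p hp => by
        rw [abs_mul, ← hp2 p.1 1, one_mul]
        exact mul_le_mul (b0 n _) (hGs t ht p hp) (abs_nonneg _) (by positivity)
    have s2 : |∫ p in slab a b H, (4 * p.2.1 * (1 + p.2.1 ^ 2) * cutoff n p.2.1 +
        w p.2.1 * cutoff1 n p.2.1) * (u p.2.2 * (T p * (1 - T p)))| ≤ J M :=
      abs_setIntegral_slab_le (N := fun x => C0 * M * B / (1 + x ^ 2)) (integrable_decay _)
        fun p hp => by
        rw [abs_mul, ← hp2 p.2.1 M, abs_mul (u _)]
        exact mul_le_mul (b1 n _) (mul_le_mul (h.u_le _ hp.2.2) (hG p hp) (abs_nonneg _) hM)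
          (by positivity) (by positivity)
    have s3 : |∫ p in slab a b H, ((4 + 12 * p.2.1 ^ 2) * cutoff n p.2.1 +
        2 * (4 * p.2.1 * (1 + p.2.1 ^ 2) * cutoff1 n p.2.1) + w p.2.1 * cutoff2 n p.2.1) *
        (T p * (1 - T p))| ≤ J 1 :=
      abs_setIntegral_slab_le (N := fun x => C0 * 1 * B / (1 + x ^ 2)) (integrable_decay _)
        fun p hp => by
        rw [abs_mul, ← hp2 p.2.1 1, one_mul]
        exact mul_le_mul (b2 n _) (hG p hp) (abs_nonneg _) (by positivity)
    have s4 : |∫ p in slab a b H, w p.2.1 * cutoff n p.2.1 * ((1 - 2 * T p) * f (T p))| ≤ J (1 + K) :=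
      abs_setIntegral_slab_le (N := fun x => C0 * (1 + K) * B / (1 + x ^ 2)) (integrable_decay _)
        fun p hp => by
        rw [abs_mul, ← hp2 p.2.1 (1 + K)]
        exact mul_le_mul (b0 n _) (hF p hp) (abs_nonneg _) (by positivity)
    have s5 := s1 a ⟨le_rfl, hab⟩
    have s6 := s1 b ⟨hab, le_rfl⟩
    have s3' := mul_le_mul_of_nonneg_left s3 h.hκ.le
    have s4' := mul_le_mul_of_nonneg_left s4 h.hc.le
    rw [← abs_of_pos h.hκ, ← abs_mul, abs_of_pos h.hκ] at s3'
    rw [← abs_of_pos h.hc, ← abs_mul, abs_of_pos h.hc] at s4'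
    rw [mul_comm, e]
    simp only [Z]
    linarith [(abs_le.1 s2).1, (abs_le.1 s3').1, (abs_le.1 s4').1, (abs_le.1 s5).1,
      (abs_le.1 s6).2]
  have cg := h.cont_grad (b := b) ha
  refine (integrable_of_tendsto_nonneg (g := fun n p => w p.2.1 * cutoff n p.2.1 *
    (Tx p ^ 2 + Ty p ^ 2)) (Bn := fun _ => Z / (2 * κ)) (B := Z / (2 * κ)) ?_ (fun n => ?_)
    (fun n => ?_) ?_ bound tendsto_const_nhds).1
  · exact (ContinuousOn.mul (by fun_prop) cg).aestronglyMeasurable (measurableSet_slab a b H)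
  · have ct := (hT n).cont
    refine integrableOn_slab_of_compact (R := 2 * (n + 1)) ?_ fun p hp => by
      simp [(isTest_cutoff n).zero _ hp]
    exact ContinuousOn.mul (ct.comp_continuousOn (f := fun p : ℝ × ℝ × ℝ => p.2.1) (by fun_prop)) cg
  · refine Eventually.of_forall fun p => ?_
    have := cutoff_nonneg n p.2.1
    simp only [hw]; positivity
  · refine Eventually.of_forall fun p => ?_
    have := ((tendsto_cutoff p.2.1).const_mul (w p.2.1)).mul_const (Tx p ^ 2 + Ty p ^ 2)
    simpa [hw] using this

/-- Here the constants matter, so the cutoff carries no weight and its derivatives contribute an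
error `O(1/n)`. The term at time `a` is dropped by its sign, and `|1 - 2T| ≤ 1` in the reaction. -/
lemma grad_energy (h : Front f u κ c H T Tt Tx Ty Txx Tyy τ B K M) {a b : ℝ}
    (ha : 0 < a) (hab : a ≤ b) (hb : b ≤ τ) :
    IntegrableOn (fun p => Tx p ^ 2 + Ty p ^ 2) (slab a b H) ∧
    2 * κ * (∫ p in slab a b H, (Tx p ^ 2 + Ty p ^ 2)) ≤
      (∫ p in strip H, T (b, p) * (1 - T (b, p))) + c * ∫ p in slab a b H, f (T p) := by
  obtain ⟨C, hC, hCb⟩ := exists_cutoff_bound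
  have hM := h.M_nonneg
  have hB := h.hB
  have hκ := h.hκ
  have hG : ∀ p ∈ slab a b H, T p * (1 - T p) ∈ Icc 0 (B / (1 + p.2.1 ^ 2)) := fun p hp => by
    have := h.mul_one_sub_mem (slab_sub ha hb hp)
    exact ⟨this.1, this.2.trans (div_cube_le hB.le _)⟩
  have cT := h.sol.cont.mono (slab_subset_Ici (b := b) ha.le)
  have cf := h.sol.cont_f
  have nf : IntegrableOn (fun p => f (T p)) (slab a b H) :=
    integrableOn_slab_of_le (N := fun x => ((1 + K) * B) / (1 + x ^ 2)) (by fun_prop)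
      (integrable_decay _) fun p hp => by
        have := h.f_mem (slab_sub ha hb hp)
        rw [abs_of_nonneg this.1, mul_div_assoc]
        refine this.2.trans (mul_le_mul_of_nonneg_left (div_cube_le hB.le _) (by linarith [h.hK]))
  have nG : IntegrableOn (fun p => T (b, p) * (1 - T (b, p))) (strip H) := by
    refine integrableOn_strip_of_le (N := fun x => B / (1 + x ^ 2)) ?_ (integrable_decay _) fun p hp => ?_
    · exact continuousOn_slice (I := Icc a b) (F := fun q => T q * (1 - T q)) ⟨hab, le_rfl⟩
        (by change ContinuousOn _ (slab a b H); fun_prop)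
    · have := hG (b, p) ⟨⟨hab, le_rfl⟩, hp⟩
      rw [abs_of_nonneg this.1]; exact this.2
  set J := ∫ p in slab a b H, (M + κ) * B / (1 + p.2.1 ^ 2)
  set Y := (∫ p in strip H, T (b, p) * (1 - T (b, p))) + c * ∫ p in slab a b H, f (T p)
  have bound : ∀ n : ℕ, ∫ p in slab a b H, cutoff n p.2.1 * (Tx p ^ 2 + Ty p ^ 2) ≤
      (Y + C / (n + 1) * J) / (2 * κ) := by
    intro n
    have ht := isTest_cutoff n
    have c0 := ht.cont
    have c1 := ht.cont1
    have c2 := ht.cont2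
    have cu := h.sol.cont_u
    rw [le_div_iff₀ (by linarith), mul_comm, h.grad_identity ht ha hab]
    have s1 : 0 ≤ ∫ p in strip H, cutoff n p.1 * (T (a, p) * (1 - T (a, p))) :=
      setIntegral_nonneg (measurableSet_strip H) fun p hp =>
        mul_nonneg (cutoff_nonneg _ _) (hG (a, p) ⟨⟨le_rfl, hab⟩, hp⟩).1
    have s2 : ∫ p in strip H, cutoff n p.1 * (T (b, p) * (1 - T (b, p))) ≤
        ∫ p in strip H, T (b, p) * (1 - T (b, p)) := by
      refine setIntegral_mono_on ?_ nG (measurableSet_strip H) fun p hp => ?_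
      · refine nG.bdd_mul (c := 1) (c0.measurable.comp measurable_fst).aestronglyMeasurable
          (Eventually.of_forall fun p => ?_)
        rw [Real.norm_eq_abs, abs_of_nonneg (cutoff_nonneg _ _)]
        exact cutoff_le_one _ _
      · exact mul_le_of_le_one_left (hG (b, p) ⟨⟨hab, le_rfl⟩, hp⟩).1 (cutoff_le_one _ _)
    have s3 : -(∫ p in slab a b H, f (T p)) ≤
        ∫ p in slab a b H, cutoff n p.2.1 * ((1 - 2 * T p) * f (T p)) := by
      rw [← integral_neg]
      refine setIntegral_mono_on nf.neg ?_ (measurableSet_slab a b H) fun p hp => ?_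
      · refine integrableOn_slab_of_compact (R := 2 * (n + 1)) (by fun_prop) fun p hp => by
          simp [ht.zero _ hp]
      · have h1 := (h.f_mem (slab_sub ha hb hp)).1
        have h2 := h.mem_unit (slab_sub ha hb hp)
        have h3 := cutoff_nonneg n p.2.1
        have h4 := cutoff_le_one n p.2.1
        have h5 : -1 ≤ cutoff n p.2.1 * (1 - 2 * T p) := by nlinarith [h2.1, h2.2]
        nlinarith
    have s4 : |(∫ p in slab a b H, cutoff1 n p.2.1 * (u p.2.2 * (T p * (1 - T p)))) +
        κ * ∫ p in slab a b H, cutoff2 n p.2.1 * (T p * (1 - T p))| ≤ C / (n + 1) * J := by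
      rw [← integral_const_mul, ← integral_add
        (integrableOn_slab_of_compact (R := 2 * (n + 1)) (by fun_prop) fun p hp => by
          simp [ht.zero1 _ hp])
        (integrableOn_slab_of_compact (R := 2 * (n + 1)) (by fun_prop) fun p hp => by
          simp [ht.zero2 _ hp]), ← integral_const_mul]
      refine abs_setIntegral_slab_le (N := fun x => C / (n + 1) * ((M + κ) * B / (1 + x ^ 2)))
        ((integrable_decay _).const_mul _) fun p hp => ?_
      have g := hG p hp
      have k1 := (hCb n p.2.1).1
      have k2 := (hCb n p.2.1).2
      have hn : 0 ≤ C / ((n : ℝ) + 1) := by positivity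
      calc _ ≤ |cutoff1 n p.2.1 * (u p.2.2 * (T p * (1 - T p)))| +
            |κ * (cutoff2 n p.2.1 * (T p * (1 - T p)))| := abs_add_le _ _
        _ = |cutoff1 n p.2.1| * (|u p.2.2| * (T p * (1 - T p))) +
            κ * (|cutoff2 n p.2.1| * (T p * (1 - T p))) := by
          rw [abs_mul, abs_mul (u _), abs_mul κ, abs_mul (cutoff2 _ _), abs_of_nonneg g.1,
            abs_of_pos hκ]
        _ ≤ C / (n + 1) * (M * (B / (1 + p.2.1 ^ 2))) +
            κ * (C / (n + 1) * (B / (1 + p.2.1 ^ 2))) := by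
          have k3 := h.u_le _ hp.2.2
          have g1 := g.1
          have g2 := g.2
          gcongr
        _ = _ := by ring
    have s3' := mul_le_mul_of_nonneg_left s3 h.hc.le
    simp only [Y]
    linarith [(abs_le.1 s4).1]
  have lim : Tendsto (fun n : ℕ => (Y + C / ((n : ℝ) + 1) * J) / (2 * κ)) atTop
      (𝓝 (Y / (2 * κ))) := by
    have h1 := (tendsto_const_div_atTop_nhds_zero_nat C).comp (tendsto_add_atTop_nat 1)
    have h2 : Tendsto (fun n : ℕ => C / ((n : ℝ) + 1)) atTop (𝓝 0) := by
      simpa [Function.comp_def] using h1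
    simpa using ((h2.mul_const J).const_add Y).div_const (2 * κ)
  have cg := h.cont_grad (b := b) ha
  have := integrable_of_tendsto_nonneg (m := volume.restrict (slab a b H))
    (h := fun p => Tx p ^ 2 + Ty p ^ 2) (g := fun n p => cutoff n p.2.1 *
    (Tx p ^ 2 + Ty p ^ 2)) (cg.aestronglyMeasurable (measurableSet_slab a b H)) (fun n => ?_)
    (fun n => ?_) ?_ bound lim
  · refine ⟨this.1, ?_⟩
    have h2 := this.2
    rw [le_div_iff₀ (by linarith)] at h2
    linarith
  · have c0 := (isTest_cutoff n).cont
    exact integrableOn_slab_of_compact (R := 2 * (n + 1)) (by fun_prop) fun p hp => by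
      simp [(isTest_cutoff n).zero _ hp]
  · refine Eventually.of_forall fun p => ?_
    have := cutoff_nonneg n p.2.1
    positivity
  · refine Eventually.of_forall fun p => ?_
    simpa using (tendsto_cutoff p.2.1).mul_const (Tx p ^ 2 + Ty p ^ 2)

end Front

end BulkBurning

/-! ### The energy identity for `T_t`, without mixed derivatives. -/

namespace BulkBurning

open Filter Topology

/-- A `C¹` function supported in `[-R, R]`, with its derivative. -/
structure IsTest₁ (η η1 : ℝ → ℝ) (R : ℝ) : Prop where
  has1 : ∀ x, HasDerivAt η (η1 x) x
  cont1 : Continuous η1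
  zero : ∀ x, R < |x| → η x = 0
  zero1 : ∀ x, R < |x| → η1 x = 0

lemma IsTest₁.cont {η η1 : ℝ → ℝ} {R : ℝ} (h : IsTest₁ η η1 R) : Continuous η :=
  continuous_iff_continuousAt.2 fun x => (h.has1 x).continuousAt

lemma integrable_of_zero {g : ℝ → ℝ} {R : ℝ} (hg : Continuous g) (h : ∀ x, R < |x| → g x = 0) :
    Integrable g :=
  hg.integrable_of_hasCompactSupport
    (HasCompactSupport.intro (isCompact_Icc (a := -R) (b := R)) fun x hx => h x (by
      by_contra! hle
      exact hx (abs_le.1 hle)))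

lemma green_strip {η η1 : ℝ → ℝ} {R H : ℝ} (hη : IsTest₁ η η1 R) (hH : 0 < H)
    {A Ax Ay Px Py Pxx Pyy : ℝ × ℝ → ℝ} (cA : ContinuousOn A (strip H))
    (cAx : ContinuousOn Ax (strip H)) (cAy : ContinuousOn Ay (strip H))
    (cPx : ContinuousOn Px (strip H)) (cPy : ContinuousOn Py (strip H))
    (cPxx : ContinuousOn Pxx (strip H)) (cPyy : ContinuousOn Pyy (strip H))
    (dAx : ∀ x, ∀ y ∈ Icc 0 H, HasDerivAt (fun s => A (s, y)) (Ax (x, y)) x)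
    (dPx : ∀ x, ∀ y ∈ Icc 0 H, HasDerivAt (fun s => Px (s, y)) (Pxx (x, y)) x)
    (dAy : ∀ x, ∀ y ∈ Ioo 0 H, HasDerivAt (fun s => A (x, s)) (Ay (x, y)) y)
    (dPy : ∀ x, ∀ y ∈ Ioo 0 H, HasDerivAt (fun s => Py (x, s)) (Pyy (x, y)) y)
    (hb : ∀ x, A (x, 0) * Py (x, 0) = A (x, H) * Py (x, H)) :
    ∫ p in strip H, η p.1 * (A p * (Pxx p + Pyy p)) =
      -(∫ p in strip H, η p.1 * (Ax p * Px p + Ay p * Py p))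
      - ∫ p in strip H, η1 p.1 * (A p * Px p) := by
  have cη := hη.cont
  have cη1 := hη.cont1
  have i1 : ∫ p in strip H, (η1 p.1 * (A p * Px p) + η p.1 * (Ax p * Px p + A p * Pxx p)) = 0 :=
    integral_dx_eq_zero (P := fun p => η p.1 * (A p * Px p)) (R := R)
      (fun x y hy => (hη.has1 x).mul ((dAx x y hy).mul (dPx x y hy))) (by fun_prop)
      (fun p hp => by simp [hη.zero _ hp]) (fun p hp => by simp [hη.zero _ hp, hη.zero1 _ hp])
  have i2 : ∫ p in strip H, (η p.1 * (Ay p * Py p + A p * Pyy p)) = 0 :=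
    integral_dy_eq_zero (Q := fun p => η p.1 * (A p * Py p)) (R := R) hH.le
      (fun x => by
        have : ContinuousOn (fun p : ℝ × ℝ => η p.1 * (A p * Py p)) (strip H) := by fun_prop
        exact this.comp (f := fun s => (x, s)) (by fun_prop) (fun y hy => ⟨trivial, hy⟩))
      (fun x y hy => ((dAy x y hy).mul (dPy x y hy)).const_mul (η x)) (by fun_prop)
      (fun p hp => by simp [hη.zero _ hp]) (fun x => by simp only; rw [hb x])
  have n0 : IntegrableOn (fun p => η p.1 * (Ax p * Px p + Ay p * Py p)) (strip H) :=
    integrableOn_strip_of_compact (R := R) (by fun_prop) fun p hp => by simp [hη.zero _ hp]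
  have n1 : IntegrableOn (fun p => η1 p.1 * (A p * Px p)) (strip H) :=
    integrableOn_strip_of_compact (R := R) (by fun_prop) fun p hp => by simp [hη.zero1 _ hp]
  have n2 : IntegrableOn (fun p => η1 p.1 * (A p * Px p) + η p.1 * (Ax p * Px p + A p * Pxx p))
      (strip H) :=
    integrableOn_strip_of_compact (R := R) (by fun_prop) fun p hp => by
      simp [hη.zero1 _ hp, hη.zero _ hp]
  have n3 : IntegrableOn (fun p => η p.1 * (Ay p * Py p + A p * Pyy p)) (strip H) :=
    integrableOn_strip_of_compact (R := R) (by fun_prop) fun p hp => by simp [hη.zero _ hp]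
  have e : ∫ p in strip H, η p.1 * (A p * (Pxx p + Pyy p)) =
      ∫ p in strip H, ((η1 p.1 * (A p * Px p) + η p.1 * (Ax p * Px p + A p * Pxx p)) +
        η p.1 * (Ay p * Py p + A p * Pyy p) - η p.1 * (Ax p * Px p + Ay p * Py p)
        - η1 p.1 * (A p * Px p)) := by
    congr 1; ext p; ring
  rw [e, integral_sub ((n2.fun_add n3).sub' n0) n1, integral_sub (n2.fun_add n3) n0,
    integral_add n2 n3, i1, i2]
  ring

lemma exists_bound_slab {F : ℝ × ℝ × ℝ → ℝ} {a b H : ℝ} (R : ℝ)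
    (hF : ContinuousOn F (slab a b H)) : ∃ C ≥ 0, ∀ p ∈ slab a b H, |p.2.1| ≤ R → |F p| ≤ C := by
  have hs : Icc a b ×ˢ (Icc (-R) R ×ˢ Icc 0 H) ⊆ slab a b H :=
    prod_mono le_rfl (prod_mono (subset_univ _) le_rfl)
  obtain ⟨C, hC⟩ := (isCompact_Icc.prod (isCompact_Icc.prod isCompact_Icc)).exists_bound_of_continuousOn
    (hF.mono hs)
  refine ⟨|C|, abs_nonneg _, fun p hp hx => ?_⟩
  exact (hC p ⟨hp.1, abs_le.1 hx, hp.2.2⟩).trans (le_abs_self C)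

lemma continuousOn_integral_strip {g : ℝ × ℝ × ℝ → ℝ} {η : ℝ → ℝ} {R a b H : ℝ}
    (hg : ContinuousOn g (slab a b H)) (hη : Continuous η) (h0 : ∀ x, R < |x| → η x = 0) :
    ContinuousOn (fun t => ∫ p in strip H, η p.1 * g (t, p)) (Icc a b) := by
  obtain ⟨C, hC, hb⟩ := exists_bound_slab R hg
  have hint : Integrable (fun x => |η x| * C) := by
    refine (integrable_of_zero (R := R) (by fun_prop) fun x hx => by simp [h0 x hx])
  refine continuousOn_of_dominated (bound := fun p : ℝ × ℝ => |η p.1| * C) (fun t ht => ?_) (fun t ht => ?_)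
    (integrableOn_strip_fst hint H) ?_
  · refine ContinuousOn.aestronglyMeasurable ?_ (measurableSet_strip H)
    exact continuousOn_slice (I := Icc a b) (F := fun q => η q.2.1 * g q) ht
      (by change ContinuousOn _ (slab a b H); fun_prop)
  · refine (ae_restrict_iff' (measurableSet_strip H)).2 (Eventually.of_forall fun p hp => ?_)
    rw [Real.norm_eq_abs, abs_mul]
    by_cases hx : |p.1| ≤ R
    · exact mul_le_mul_of_nonneg_left (hb (t, p) ⟨ht, hp⟩ hx) (abs_nonneg _)
    · rw [h0 _ (not_le.1 hx)]; simp
  · refine (ae_restrict_iff' (measurableSet_strip H)).2 (Eventually.of_forall fun p hp => ?_)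
    exact continuousOn_const.mul (hg.comp (by fun_prop) fun t ht => ⟨ht, hp⟩)

lemma tendsto_integral_slab_of_bound {g : ℕ → ℝ × ℝ × ℝ → ℝ} {l : ℝ × ℝ × ℝ → ℝ} {η : ℝ → ℝ}
    {R C a b H : ℝ} (hη : Continuous η) (h0 : ∀ x, R < |x| → η x = 0)
    (hg : ∀ n, ContinuousOn (g n) (slab a b H))
    (hb : ∀ n, ∀ p ∈ slab a b H, |p.2.1| ≤ R → |g n p| ≤ C)
    (hl : ∀ p ∈ slab a b H, Tendsto (fun n => g n p) atTop (𝓝 (l p))) :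
    Tendsto (fun n => ∫ p in slab a b H, η p.2.1 * g n p) atTop
      (𝓝 (∫ p in slab a b H, η p.2.1 * l p)) := by
  have hint : Integrable (fun x => |η x| * C) := by
    refine (integrable_of_zero (R := R) (by fun_prop) fun x hx => by simp [h0 x hx])
  refine tendsto_integral_of_dominated_convergence (fun p => |η p.2.1| * C) (fun n => ?_)
    (integrableOn_slab_fst hint a b H) (fun n => ?_) ?_
  · have := hg n
    exact ContinuousOn.aestronglyMeasurable (by fun_prop) (measurableSet_slab a b H)
  · refine (ae_restrict_iff' (measurableSet_slab a b H)).2 (Eventually.of_forall fun p hp => ?_)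
    rw [Real.norm_eq_abs, abs_mul]
    by_cases hx : |p.2.1| ≤ R
    · exact mul_le_mul_of_nonneg_left (hb n p hp hx) (abs_nonneg _)
    · rw [h0 _ (not_le.1 hx)]; simp
  · refine (ae_restrict_iff' (measurableSet_slab a b H)).2 (Eventually.of_forall fun p hp => ?_)
    exact (hl p hp).const_mul _

/-- The integral telescopes to the difference of two short integrals of `E` near `b` and near `a`;
hence continuity of `E` is enough and no derivative is needed. -/
lemma tendsto_shift_quotient {E : ℝ → ℝ} {a b : ℝ} (ha : 0 < a) (hab : a ≤ b)
    (hE : ContinuousOn E (Ioi 0)) {s : ℕ → ℝ} (hs : Tendsto s atTop (𝓝[≠] 0))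
    (hs0 : ∀ n, 0 < s n) :
    Tendsto (fun n => (s n)⁻¹ * ∫ t in Icc a b, (E (t + s n) - E t)) atTop (𝓝 (E b - E a)) := by
  set Φ : ℝ → ℝ := fun x => ∫ t in a..x, E t
  have hii : ∀ x y, 0 < x → 0 < y → IntervalIntegrable E volume x y := fun x y hx hy =>
    (hE.mono fun z hz => lt_of_lt_of_le (lt_min hx hy) hz.1).intervalIntegrable
  have hΦ : ∀ x, 0 < x → HasDerivAt Φ (E x) x := fun x hx =>
    intervalIntegral.integral_hasDerivAt_right (hii a x ha hx)
      (hE.stronglyMeasurableAtFilter isOpen_Ioi x hx) (hE.continuousAt (Ioi_mem_nhds hx))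
  have hb : 0 < b := ha.trans_le hab
  have h1 := ((hΦ b hb).tendsto_slope_zero.comp hs).sub ((hΦ a ha).tendsto_slope_zero.comp hs)
  refine h1.congr fun n => ?_
  have hsn := hs0 n
  have e1 : ∫ t in Icc a b, (E (t + s n) - E t) = ∫ t in a..b, (E (t + s n) - E t) := by
    rw [integral_Icc_eq_integral_Ioc, intervalIntegral.integral_of_le hab]
  have i1 : IntervalIntegrable (fun t => E (t + s n)) volume a b := by
    have := (hii (a + s n) (b + s n) (by linarith) (by linarith)).comp_add_right (s n)
    simpa using this
  have e2 : ∫ t in a..b, (E (t + s n) - E t) = (Φ (b + s n) - Φ (a + s n)) - Φ b := by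
    rw [intervalIntegral.integral_sub i1 (hii a b ha hb),
      intervalIntegral.integral_comp_add_right (fun t => E t)]
    simp only [Φ]
    rw [intervalIntegral.integral_interval_sub_left (hii _ _ ha (by linarith))
      (hii _ _ ha (by linarith))]
  have e3 : Φ a = 0 := by simp [Φ]
  rw [e1, e2]
  simp only [Function.comp, smul_eq_mul, e3]
  ring

variable {f u : ℝ → ℝ} {κ c H : ℝ} {T Tt Tx Ty Txx Tyy : ℝ × ℝ × ℝ → ℝ}

lemma shift_continuousOn {F : ℝ × ℝ × ℝ → ℝ} (hF : ContinuousOn F (Ioi 0 ×ˢ strip H)) {s a b : ℝ}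
    (ha : 0 < a) (hs : 0 ≤ s) : ContinuousOn (fun p : ℝ × ℝ × ℝ => F (p.1 + s, p.2)) (slab a b H) :=
  hF.comp (by fun_prop) fun p hp => ⟨show 0 < p.1 + s by linarith [hp.1.1], hp.2⟩

/-- Pairing the difference of two time slices with the Laplacian of their sum works because `∇(A -
B) · ∇(A + B) = |∇A|² - |∇B|²`: only first space derivatives at fixed times appear. -/
lemma StripSol.shift_green (h : StripSol f u κ c H T Tt Tx Ty Txx Tyy) (hH : 0 < H)
    {η η1 : ℝ → ℝ} {R : ℝ} (hη : IsTest₁ η η1 R) {t s : ℝ} (ht : 0 < t) (hs : 0 ≤ s) :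
    ∫ p in strip H, η p.1 * ((T (t + s, p) - T (t, p)) *
        ((Txx (t + s, p) + Txx (t, p)) + (Tyy (t + s, p) + Tyy (t, p)))) =
      -(∫ p in strip H, η p.1 * ((Tx (t + s, p) ^ 2 + Ty (t + s, p) ^ 2) -
        (Tx (t, p) ^ 2 + Ty (t, p) ^ 2)))
      - ∫ p in strip H, η1 p.1 * ((T (t + s, p) - T (t, p)) * (Tx (t + s, p) + Tx (t, p))) := by
  have hts : 0 < t + s := by linarith
  have cs : ∀ {F : ℝ × ℝ × ℝ → ℝ}, ContinuousOn F (Ioi 0 ×ˢ strip H) →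
      ∀ r, 0 < r → ContinuousOn (fun p => F (r, p)) (strip H) := fun hF r hr =>
    continuousOn_slice (I := Ioi 0) hr hF
  have cT : ContinuousOn T (Ioi 0 ×ˢ strip H) := h.cont.mono (prod_mono Ioi_subset_Ici_self le_rfl)
  have hn : ∀ y ∈ Ioo 0 H, Icc 0 H ∈ 𝓝 y := fun y hy => Icc_mem_nhds hy.1 hy.2
  have := green_strip hη hH (A := fun p => T (t + s, p) - T (t, p))
    (Ax := fun p => Tx (t + s, p) - Tx (t, p)) (Ay := fun p => Ty (t + s, p) - Ty (t, p))
    (Px := fun p => Tx (t + s, p) + Tx (t, p)) (Py := fun p => Ty (t + s, p) + Ty (t, p))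
    (Pxx := fun p => Txx (t + s, p) + Txx (t, p)) (Pyy := fun p => Tyy (t + s, p) + Tyy (t, p))
    ((cs cT _ hts).sub (cs cT _ ht)) ((cs h.cont_x _ hts).sub (cs h.cont_x _ ht))
    ((cs h.cont_y _ hts).sub (cs h.cont_y _ ht)) ((cs h.cont_x _ hts).add (cs h.cont_x _ ht))
    ((cs h.cont_y _ hts).add (cs h.cont_y _ ht)) ((cs h.cont_xx _ hts).add (cs h.cont_xx _ ht))
    ((cs h.cont_yy _ hts).add (cs h.cont_yy _ ht))
    (fun x y hy => (h.has_x _ hts x y hy).sub (h.has_x _ ht x y hy))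
    (fun x y hy => (h.has_xx _ hts x y hy).add (h.has_xx _ ht x y hy))
    (fun x y hy => ((h.has_y _ hts x y (Ioo_subset_Icc_self hy)).hasDerivAt (hn y hy)).sub
      ((h.has_y _ ht x y (Ioo_subset_Icc_self hy)).hasDerivAt (hn y hy)))
    (fun x y hy => ((h.has_yy _ hts x y (Ioo_subset_Icc_self hy)).hasDerivAt (hn y hy)).add
      ((h.has_yy _ ht x y (Ioo_subset_Icc_self hy)).hasDerivAt (hn y hy)))
    (fun x => by
      rcases h.bdry with hb | ⟨-, hb⟩
      · simp only [(hb t ht x).1, (hb t ht x).2, (hb _ hts x).1, (hb _ hts x).2, add_zero, mul_zero]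
      · simp only [(hb t ht x).1, (hb t ht x).2, (hb _ hts x).1, (hb _ hts x).2])
  rw [this]
  congr 3
  ext p
  ring

/-- Formally, `∫∫ η T_t ΔT = -½ [∫ η |∇T|²] - ∫∫ η' T_t T_x`; the mixed derivatives of `T` need
not exist. -/
lemma StripSol.time_energy (h : StripSol f u κ c H T Tt Tx Ty Txx Tyy) (hH : 0 < H)
    {η η1 : ℝ → ℝ} {R : ℝ} (hη : IsTest₁ η η1 R) {a b : ℝ} (ha : 0 < a) (hab : a ≤ b) :
    2 * ∫ p in slab a b H, η p.2.1 * (Tt p * (Txx p + Tyy p)) =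
      -((∫ p in strip H, η p.1 * (Tx (b, p) ^ 2 + Ty (b, p) ^ 2))
        - ∫ p in strip H, η p.1 * (Tx (a, p) ^ 2 + Ty (a, p) ^ 2))
      - 2 * ∫ p in slab a b H, η1 p.2.1 * (Tt p * Tx p) := by
  set s : ℕ → ℝ := fun n => 1 / ((n : ℝ) + 1)
  have hs0 : ∀ n, 0 < s n := fun n => by simp only [s]; positivity
  have hs1 : ∀ n, s n ≤ 1 := fun n => by
    simp only [s]
    rw [div_le_one (by positivity)]
    linarith [(Nat.cast_nonneg n : (0 : ℝ) ≤ n)]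
  have hst : Tendsto s atTop (𝓝 0) := tendsto_one_div_add_atTop_nhds_zero_nat
  have hst' : Tendsto s atTop (𝓝[≠] 0) :=
    tendsto_nhdsWithin_iff.2 ⟨hst, Eventually.of_forall fun n => (hs0 n).ne'⟩
  have cT : ContinuousOn T (Ioi 0 ×ˢ strip H) := h.cont.mono (prod_mono Ioi_subset_Ici_self le_rfl)
  have cη := hη.cont
  have cη1 := hη.cont1
  set Q : ℕ → ℝ × ℝ × ℝ → ℝ := fun n p => (s n)⁻¹ * (T (p.1 + s n, p.2) - T p)
  set L : ℕ → ℝ × ℝ × ℝ → ℝ := fun n p =>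
    (Txx (p.1 + s n, p.2) + Txx p) + (Tyy (p.1 + s n, p.2) + Tyy p)
  set X : ℕ → ℝ × ℝ × ℝ → ℝ := fun n p => Tx (p.1 + s n, p.2) + Tx p
  have sub : slab a b H ⊆ Ioi 0 ×ˢ strip H := slab_subset ha
  have cQ : ∀ n, ContinuousOn (Q n) (slab a b H) := fun n =>
    continuousOn_const.mul ((shift_continuousOn cT ha (hs0 n).le).sub (cT.mono sub))
  have cL : ∀ n, ContinuousOn (L n) (slab a b H) := fun n =>
    ((shift_continuousOn h.cont_xx ha (hs0 n).le).add (h.cont_xx.mono sub)).add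
      ((shift_continuousOn h.cont_yy ha (hs0 n).le).add (h.cont_yy.mono sub))
  have cX : ∀ n, ContinuousOn (X n) (slab a b H) := fun n =>
    (shift_continuousOn h.cont_x ha (hs0 n).le).add (h.cont_x.mono sub)
  have mem : ∀ n, ∀ p ∈ slab a b H, (p.1 + s n, p.2) ∈ slab a (b + 1) H := fun n p hp =>
    ⟨⟨by linarith [hp.1.1, hs0 n], by linarith [hp.1.2, hs1 n]⟩, hp.2⟩
  have mem' : ∀ p ∈ slab a b H, p ∈ slab a (b + 1) H := fun p hp =>
    ⟨⟨hp.1.1, by linarith [hp.1.2]⟩, hp.2⟩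
  -- Since `s n ≤ 1`, the shifted times stay in `[a, b + 1]`; bounds there, over the support of `η`,
  -- dominate the quotients and sums for all `n`.
  obtain ⟨Ct, hCt, bt⟩ := exists_bound_slab R (h.cont_t.mono (slab_subset (b := b + 1) ha))
  obtain ⟨Cx, hCx, bx⟩ := exists_bound_slab R (h.cont_x.mono (slab_subset (b := b + 1) ha))
  obtain ⟨Cxx, hCxx, bxx⟩ := exists_bound_slab R (h.cont_xx.mono (slab_subset (b := b + 1) ha))
  obtain ⟨Cyy, hCyy, byy⟩ := exists_bound_slab R (h.cont_yy.mono (slab_subset (b := b + 1) ha))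
  have bQ : ∀ n, ∀ p ∈ slab a b H, |p.2.1| ≤ R → |Q n p| ≤ Ct := by
    intro n p hp hx
    have key := (convex_Icc a (b + 1)).norm_image_sub_le_of_norm_hasDerivWithin_le
      (f := fun r => T (r, p.2)) (f' := fun r => Tt (r, p.2)) (C := Ct)
      (fun r hr => (h.has_t r (ha.trans_le hr.1) p.2.1 p.2.2 hp.2.2).hasDerivWithinAt)
      (fun r hr => bt (r, p.2) ⟨hr, hp.2⟩ hx) (mem' p hp).1 (mem n p hp).1
    simp only [Q]
    rw [Real.norm_eq_abs, Real.norm_eq_abs, add_sub_cancel_left, abs_of_pos (hs0 n)] at key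
    rw [abs_mul, abs_of_pos (inv_pos.2 (hs0 n)), inv_mul_le_iff₀ (hs0 n)]
    linarith
  have bL : ∀ n, ∀ p ∈ slab a b H, |p.2.1| ≤ R → |L n p| ≤ (Cxx + Cxx) + (Cyy + Cyy) := by
    intro n p hp hx
    refine (abs_add_le _ _).trans (add_le_add ((abs_add_le _ _).trans (add_le_add ?_ ?_))
      ((abs_add_le _ _).trans (add_le_add ?_ ?_)))
    exacts [bxx _ (mem n p hp) hx, bxx _ (mem' p hp) hx, byy _ (mem n p hp) hx, byy _ (mem' p hp) hx]
  have bX : ∀ n, ∀ p ∈ slab a b H, |p.2.1| ≤ R → |X n p| ≤ Cx + Cx := by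
    intro n p hp hx
    exact (abs_add_le _ _).trans (add_le_add (bx _ (mem n p hp) hx) (bx _ (mem' p hp) hx))
  have tsh : ∀ {F : ℝ × ℝ × ℝ → ℝ}, ContinuousOn F (Ioi 0 ×ˢ strip H) → ∀ p ∈ slab a b H,
      Tendsto (fun n => F (p.1 + s n, p.2)) atTop (𝓝 (F p)) := by
    intro F hF p hp
    have h1 : ContinuousWithinAt F (Ioi 0 ×ˢ strip H) p := hF p (sub hp)
    refine h1.tendsto.comp (tendsto_nhdsWithin_iff.2 ⟨?_, Eventually.of_forall fun n => ?_⟩)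
    · have : Tendsto (fun n => (p.1 + s n, p.2)) atTop (𝓝 (p.1 + 0, p.2)) :=
        (hst.const_add p.1).prodMk_nhds tendsto_const_nhds
      simpa using this
    · exact ⟨show 0 < p.1 + s n by linarith [hp.1.1, hs0 n], hp.2⟩
  have tQ : ∀ p ∈ slab a b H, Tendsto (fun n => Q n p) atTop (𝓝 (Tt p)) := fun p hp =>
    (h.has_t p.1 (ha.trans_le hp.1.1) p.2.1 p.2.2 hp.2.2).tendsto_slope_zero.comp hst'
  have tL : ∀ p ∈ slab a b H, Tendsto (fun n => L n p) atTop (𝓝 ((Txx p + Txx p) + (Tyy p + Tyy p))) :=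
    fun p hp => ((tsh h.cont_xx p hp).add_const _).add ((tsh h.cont_yy p hp).add_const _)
  have tX : ∀ p ∈ slab a b H, Tendsto (fun n => X n p) atTop (𝓝 (Tx p + Tx p)) :=
    fun p hp => (tsh h.cont_x p hp).add_const _
  have lim1 := tendsto_integral_slab_of_bound (g := fun n p => Q n p * L n p)
    (l := fun p => Tt p * ((Txx p + Txx p) + (Tyy p + Tyy p))) cη hη.zero
    (fun n => (cQ n).mul (cL n)) (C := Ct * ((Cxx + Cxx) + (Cyy + Cyy))) (fun n p hp hx => by
      rw [abs_mul]
      exact mul_le_mul (bQ n p hp hx) (bL n p hp hx) (abs_nonneg _) hCt)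
    (fun p hp => (tQ p hp).mul (tL p hp))
  have lim2 := tendsto_integral_slab_of_bound (g := fun n p => Q n p * X n p)
    (l := fun p => Tt p * (Tx p + Tx p)) cη1 hη.zero1
    (fun n => (cQ n).mul (cX n)) (C := Ct * (Cx + Cx)) (fun n p hp hx => by
      rw [abs_mul]
      exact mul_le_mul (bQ n p hp hx) (bX n p hp hx) (abs_nonneg _) hCt)
    (fun p hp => (tQ p hp).mul (tX p hp))
  set E : ℝ → ℝ := fun t => ∫ p in strip H, η p.1 * (Tx (t, p) ^ 2 + Ty (t, p) ^ 2)
  have cg : ContinuousOn (fun p => Tx p ^ 2 + Ty p ^ 2) (Ioi 0 ×ˢ strip H) := by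
    have c1 := h.cont_x
    have c2 := h.cont_y
    fun_prop
  have cE : ContinuousOn E (Ioi 0) := by
    intro t ht
    have ht' : 0 < t := ht
    have := continuousOn_integral_strip (a := t / 2) (b := t + 1)
      (cg.mono (slab_subset (by linarith))) cη hη.zero
    exact (this.continuousAt (Icc_mem_nhds (by linarith) (by linarith))).continuousWithinAt
  have lim3 := tendsto_shift_quotient ha hab cE hst' hs0
  have ng : ∀ t, 0 < t → IntegrableOn (fun p => η p.1 * (Tx (t, p) ^ 2 + Ty (t, p) ^ 2)) (strip H) :=
    fun t ht => integrableOn_strip_of_compact (R := R)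
      (continuousOn_slice (I := Ioi 0) (F := fun q => η q.2.1 * (Tx q ^ 2 + Ty q ^ 2)) ht
        (by fun_prop)) fun p hp => by simp [hη.zero _ hp]
  have eq : ∀ n, ∫ p in slab a b H, η p.2.1 * (Q n p * L n p) =
      -((s n)⁻¹ * ∫ t in Icc a b, (E (t + s n) - E t)) -
        ∫ p in slab a b H, η1 p.2.1 * (Q n p * X n p) := by
    intro n
    have cQn := cQ n
    have cLn := cL n
    have cXn := cX n
    have hsn := hs0 n
    have cEs : ContinuousOn (fun t => E (t + s n) - E t) (Icc a b) :=
      (cE.comp (by fun_prop) fun t ht => show 0 < t + s n by linarith [ht.1]).sub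
        (cE.mono fun t ht => ha.trans_le ht.1)
    have n1 : IntegrableOn (fun p => η p.2.1 * (Q n p * L n p)) (slab a b H) :=
      integrableOn_slab_of_compact (R := R) (by fun_prop) fun p hp => by simp [hη.zero _ hp]
    have n2 : IntegrableOn (fun p => η1 p.2.1 * (Q n p * X n p)) (slab a b H) :=
      integrableOn_slab_of_compact (R := R) (by fun_prop) fun p hp => by simp [hη.zero1 _ hp]
    have n2' : IntegrableOn (fun t => ∫ p in strip H, η1 p.1 * (Q n (t, p) * X n (t, p)))
        (Icc a b) := by
      have := n2
      rw [IntegrableOn, restrict_slab] at this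
      exact this.integral_prod_left
    have n3 : IntegrableOn (fun t => -((s n)⁻¹ * (E (t + s n) - E t))) (Icc a b) :=
      ((cEs.integrableOn_compact isCompact_Icc).const_mul _).neg
    rw [setIntegral_slab n1, setIntegral_slab n2, ← integral_const_mul, ← integral_neg,
      ← integral_sub n3 n2']
    refine setIntegral_congr_fun measurableSet_Icc fun t ht => ?_
    have ht0 : 0 < t := ha.trans_le ht.1
    have g := h.shift_green hH hη ht0 hsn.le
    have e1 : ∫ p in strip H, η p.1 * (Q n (t, p) * L n (t, p)) = (s n)⁻¹ *
        ∫ p in strip H, η p.1 * ((T (t + s n, p) - T (t, p)) *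
        ((Txx (t + s n, p) + Txx (t, p)) + (Tyy (t + s n, p) + Tyy (t, p)))) := by
      rw [← integral_const_mul]
      congr 1; ext p; simp only [Q, L]; ring
    have e2 : ∫ p in strip H, η1 p.1 * (Q n (t, p) * X n (t, p)) = (s n)⁻¹ *
        ∫ p in strip H, η1 p.1 * ((T (t + s n, p) - T (t, p)) * (Tx (t + s n, p) + Tx (t, p))) := by
      rw [← integral_const_mul]
      congr 1; ext p; simp only [Q, X]; ring
    have e3 : ∫ p in strip H, η p.1 * ((Tx (t + s n, p) ^ 2 + Ty (t + s n, p) ^ 2) -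
        (Tx (t, p) ^ 2 + Ty (t, p) ^ 2)) = E (t + s n) - E t := by
      simp only [E]
      rw [← integral_sub (ng _ (by linarith)) (ng t ht0)]
      congr 1; ext p; ring
    simp only
    rw [e1, e2, g, e3]
    ring
  have lim4 := lim3.neg.sub lim2
  have := tendsto_nhds_unique lim1 (lim4.congr fun n => (eq n).symm)
  have f1 : ∫ p in slab a b H, η p.2.1 * (Tt p * ((Txx p + Txx p) + (Tyy p + Tyy p))) =
      2 * ∫ p in slab a b H, η p.2.1 * (Tt p * (Txx p + Tyy p)) := by
    rw [← integral_const_mul]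
    congr 1; ext p; ring
  have f2 : ∫ p in slab a b H, η1 p.2.1 * (Tt p * (Tx p + Tx p)) =
      2 * ∫ p in slab a b H, η1 p.2.1 * (Tt p * Tx p) := by
    rw [← integral_const_mul]
    congr 1; ext p; ring
  rw [← f1, ← f2, this]

end BulkBurning

/-! ### Integrability of `T_t`, and the burning rate as total reaction. -/

namespace BulkBurning

open Filter Topology

variable {f u : ℝ → ℝ} {κ c H : ℝ} {T Tt Tx Ty Txx Tyy : ℝ × ℝ × ℝ → ℝ} {τ B K M : ℝ}

/-- Young's inequality for three products, taking shares 1/4, 1/8, 1/8 of `z² D²`; the total 1/2 can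
be absorbed on the left of the estimate for `T_t`. -/
lemma time_young {z z1 v k e D S F : ℝ} : -(k * (2 * z * z1 * (D * S))) - z ^ 2 * v * (D * S) +
      e * (z ^ 2 * (D * F)) ≤
    1 / 2 * (z ^ 2 * D ^ 2) + (4 * k ^ 2 * z1 ^ 2 * S ^ 2 + 2 * v ^ 2 * z ^ 2 * S ^ 2
      + 2 * e ^ 2 * z ^ 2 * F ^ 2) := by
  nlinarith [sq_nonneg (1 / 2 * z * D + 2 * k * z1 * S), sq_nonneg (z * D / 2 + 2 * v * z * S),
    sq_nonneg (z * D / 2 - 2 * e * z * F)]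

namespace Front

/-- Test with `z² T_t`, where `z = (1+x²)` times a cutoff. The Laplacian yields the gradient energy
at time `b`, which has a good sign, and at time `a`, which `hA` bounds. Since `z` is squared, the
derivative `2 z z'` of the weight keeps a factor `z`, as Young's inequality requires. -/
lemma weighted_time_integrable (h : Front f u κ c H T Tt Tx Ty Txx Tyy τ B K M) {a b : ℝ}
    (ha : 0 < a) (hab : a ≤ b) (hb : b ≤ τ)
    (hA : IntegrableOn (fun p => (1 + p.1 ^ 2) ^ 2 * (Tx (a, p) ^ 2 + Ty (a, p) ^ 2)) (strip H)) :
    IntegrableOn (fun p => (1 + p.2.1 ^ 2) ^ 2 * Tt p ^ 2) (slab a b H) := by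
  obtain ⟨C, hC, hCb⟩ := exists_cutoff_bound
  have hM := h.M_nonneg
  have hB := h.hB
  have hκ := h.hκ
  have hK := h.hK
  set z : ℕ → ℝ → ℝ := fun n x => (1 + x ^ 2) * cutoff n x with hz
  set z1 : ℕ → ℝ → ℝ := fun n x => 2 * x * cutoff n x + (1 + x ^ 2) * cutoff1 n x with hz1
  have test : ∀ n : ℕ, IsTest₁ (fun x => z n x ^ 2) (fun x => 2 * z n x * z1 n x) (2 * (n + 1)) := by
    intro n
    have ht := isTest_cutoff n
    have c0 := ht.cont
    have c1 := ht.cont1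
    refine ⟨fun x => ?_, by simp only [hz, hz1]; fun_prop, fun x hx => ?_, fun x hx => ?_⟩
    · have h1 : HasDerivAt (fun x : ℝ => 1 + x ^ 2) (2 * x) x := by
        simpa using (hasDerivAt_pow 2 x).const_add 1
      exact ((h1.mul (ht.has1 x)).pow 2).congr_deriv (by simp [hz, hz1])
    · simp [hz, ht.zero x hx]
    · simp [hz, ht.zero x hx]
  have bz : ∀ n x, z n x ^ 2 ≤ (1 + x ^ 2) ^ 2 := fun n x => by
    simp only [hz, mul_pow]
    have h1 := cutoff_nonneg n x
    have h2 := cutoff_le_one n x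
    exact mul_le_of_le_one_right (by positivity) (pow_le_one₀ h1 h2)
  have bz1 : ∀ n x, z1 n x ^ 2 ≤ (1 + C) ^ 2 * (1 + x ^ 2) ^ 2 := fun n x => by
    rw [← mul_pow, sq_le_sq, abs_of_pos (by positivity : 0 < (1 + C) * (1 + x ^ 2))]
    have h1 := cutoff_nonneg n x
    have h2 := cutoff_le_one n x
    have h3 : |cutoff1 n x| ≤ C := (hCb n x).1.trans
      (div_le_self hC.le (by linarith [(Nat.cast_nonneg n : (0:ℝ) ≤ n)]))
    calc |z1 n x| ≤ |2 * x * cutoff n x| + |(1 + x ^ 2) * cutoff1 n x| := abs_add_le _ _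
      _ = |2 * x| * cutoff n x + (1 + x ^ 2) * |cutoff1 n x| := by
        rw [abs_mul, abs_of_nonneg h1, abs_mul (1 + x ^ 2), abs_of_pos (by positivity : 0 < 1 + x ^ 2)]
      _ ≤ (1 + x ^ 2) * 1 + (1 + x ^ 2) * C := by
        gcongr
        rw [abs_le]; constructor <;> nlinarith [sq_nonneg (x + 1), sq_nonneg (x - 1)]
      _ = _ := by ring
  have cT := h.sol.cont.mono (slab_subset_Ici (b := b) ha.le)
  have cf := h.sol.cont_f
  have cu := h.sol.cont_u
  have cTt := h.sol.cont_t.mono (slab_subset (b := b) ha)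
  have cTx := h.sol.cont_x.mono (slab_subset (b := b) ha)
  have cTy := h.sol.cont_y.mono (slab_subset (b := b) ha)
  have cTxx := h.sol.cont_xx.mono (slab_subset (b := b) ha)
  have cTyy := h.sol.cont_yy.mono (slab_subset (b := b) ha)
  have ng := h.weighted_grad_integrable ha hab hb
  have nf : IntegrableOn (fun p => (1 + p.2.1 ^ 2) ^ 2 * f (T p) ^ 2) (slab a b H) := by
    refine integrableOn_slab_of_le (N := fun x => ((1 + K) * B) / (1 + x ^ 2)) (by fun_prop)
      (integrable_decay _) fun p hp => ?_
    have h1 := h.f_mem (slab_sub ha hb hp)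
    have h2 := h.mem_unit (slab_sub ha hb hp)
    have h3 := (h.f_le _ h2).trans h2.2
    rw [abs_of_nonneg (by positivity)]
    calc (1 + p.2.1 ^ 2) ^ 2 * f (T p) ^ 2 ≤ (1 + p.2.1 ^ 2) ^ 2 *
          ((1 + K) * (B / (1 + p.2.1 ^ 2) ^ 3)) := by
          refine mul_le_mul_of_nonneg_left (le_trans ?_ h1.2) (by positivity)
          nlinarith [h1.1]
      _ = _ := by field_simp
  set W : ℝ × ℝ × ℝ → ℝ := fun p => (4 * κ ^ 2 * (1 + C) ^ 2 + 2 * M ^ 2) *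
      ((1 + p.2.1 ^ 2) ^ 2 * (Tx p ^ 2 + Ty p ^ 2)) +
      2 * c ^ 2 * ((1 + p.2.1 ^ 2) ^ 2 * f (T p) ^ 2) with hW
  have nW : IntegrableOn W (slab a b H) := (ng.const_mul _).fun_add (nf.const_mul _)
  set Z := κ * (∫ p in strip H, (1 + p.1 ^ 2) ^ 2 * (Tx (a, p) ^ 2 + Ty (a, p) ^ 2)) +
    2 * ∫ p in slab a b H, W p with hZ
  have bound : ∀ n, ∫ p in slab a b H, z n p.2.1 ^ 2 * Tt p ^ 2 ≤ Z := by
    intro n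
    have tn := test n
    have c0 : Continuous (z n) := by
      have := (isTest_cutoff n).cont
      simp only [hz]; fun_prop
    have c1 : Continuous (z1 n) := by
      have := (isTest_cutoff n).cont
      have := (isTest_cutoff n).cont1
      simp only [hz1]; fun_prop
    have z0 : ∀ x : ℝ, 2 * ((n : ℝ) + 1) < |x| → z n x = 0 := fun x hx => by
      simp [hz, (isTest_cutoff n).zero x hx]
    have te := h.sol.time_energy h.hH tn ha hab
    have n0 : IntegrableOn (fun p => z n p.2.1 ^ 2 * Tt p ^ 2) (slab a b H) :=
      integrableOn_slab_of_compact (R := 2 * (n + 1)) (by fun_prop) fun p hp => by simp [z0 _ hp]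
    have n1 : IntegrableOn (fun p => z n p.2.1 ^ 2 * (Tt p * (Txx p + Tyy p))) (slab a b H) :=
      integrableOn_slab_of_compact (R := 2 * (n + 1)) (by fun_prop) fun p hp => by simp [z0 _ hp]
    have n2 : IntegrableOn (fun p => 2 * z n p.2.1 * z1 n p.2.1 * (Tt p * Tx p)) (slab a b H) :=
      integrableOn_slab_of_compact (R := 2 * (n + 1)) (by fun_prop) fun p hp => by simp [z0 _ hp]
    have n3 : IntegrableOn (fun p => -(z n p.2.1 ^ 2 * u p.2.2 * (Tt p * Tx p)) +
        c * (z n p.2.1 ^ 2 * (Tt p * f (T p)))) (slab a b H) :=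
      integrableOn_slab_of_compact (R := 2 * (n + 1)) (by fun_prop) fun p hp => by simp [z0 _ hp]
    have e1 : ∫ p in slab a b H, z n p.2.1 ^ 2 * Tt p ^ 2 =
        κ * (∫ p in slab a b H, z n p.2.1 ^ 2 * (Tt p * (Txx p + Tyy p))) +
        ∫ p in slab a b H, (-(z n p.2.1 ^ 2 * u p.2.2 * (Tt p * Tx p)) +
        c * (z n p.2.1 ^ 2 * (Tt p * f (T p)))) := by
      rw [← integral_const_mul, ← integral_add (n1.const_mul κ) n3]
      refine setIntegral_congr_fun (measurableSet_slab a b H) fun p hp => ?_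
      have := h.sol.pde p.1 (ha.trans_le hp.1.1) p.2.1 p.2.2 hp.2.2
      linear_combination z n p.2.1 ^ 2 * Tt p * this
    have e2 : (∫ p in slab a b H, (-(z n p.2.1 ^ 2 * u p.2.2 * (Tt p * Tx p)) +
        c * (z n p.2.1 ^ 2 * (Tt p * f (T p))))) -
        κ * (∫ p in slab a b H, 2 * z n p.2.1 * z1 n p.2.1 * (Tt p * Tx p)) ≤
        1 / 2 * (∫ p in slab a b H, z n p.2.1 ^ 2 * Tt p ^ 2) + ∫ p in slab a b H, W p := by
      rw [← integral_const_mul, ← integral_const_mul, ← integral_sub n3 (n2.const_mul κ),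
        ← integral_add (n0.const_mul _) nW]
      refine setIntegral_mono_on (n3.sub' (n2.const_mul κ)) ((n0.const_mul _).fun_add nW)
        (measurableSet_slab a b H) fun p hp => ?_
      have y := time_young (z := z n p.2.1) (z1 := z1 n p.2.1) (v := u p.2.2) (k := κ) (e := c)
        (D := Tt p) (S := Tx p) (F := f (T p))
      have y1 : 4 * κ ^ 2 * z1 n p.2.1 ^ 2 * Tx p ^ 2 ≤
          4 * κ ^ 2 * ((1 + C) ^ 2 * (1 + p.2.1 ^ 2) ^ 2) * (Tx p ^ 2 + Ty p ^ 2) := by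
        have := bz1 n p.2.1
        gcongr
        linarith [sq_nonneg (Ty p)]
      have y2 : 2 * u p.2.2 ^ 2 * z n p.2.1 ^ 2 * Tx p ^ 2 ≤
          2 * M ^ 2 * (1 + p.2.1 ^ 2) ^ 2 * (Tx p ^ 2 + Ty p ^ 2) := by
        have := bz n p.2.1
        have h2 : u p.2.2 ^ 2 ≤ M ^ 2 := by
          rw [← sq_abs]
          exact pow_le_pow_left₀ (abs_nonneg _) (h.u_le _ hp.2.2) 2
        gcongr
        linarith [sq_nonneg (Ty p)]
      have y3 : 2 * c ^ 2 * z n p.2.1 ^ 2 * f (T p) ^ 2 ≤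
          2 * c ^ 2 * (1 + p.2.1 ^ 2) ^ 2 * f (T p) ^ 2 := by
        have := bz n p.2.1
        gcongr
      simp only [hW]
      linarith
    have e3 : 0 ≤ ∫ p in strip H, z n p.1 ^ 2 * (Tx (b, p) ^ 2 + Ty (b, p) ^ 2) :=
      integral_nonneg fun p => by positivity
    have e4 : ∫ p in strip H, z n p.1 ^ 2 * (Tx (a, p) ^ 2 + Ty (a, p) ^ 2) ≤
        ∫ p in strip H, (1 + p.1 ^ 2) ^ 2 * (Tx (a, p) ^ 2 + Ty (a, p) ^ 2) := by
      refine integral_mono ?_ hA fun p => ?_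
      · refine integrableOn_strip_of_compact (R := 2 * (n + 1)) ?_ fun p hp => by simp [z0 _ hp]
        exact continuousOn_slice (I := Icc a b) (F := fun q => z n q.2.1 ^ 2 * (Tx q ^ 2 + Ty q ^ 2))
          ⟨le_rfl, hab⟩ (by change ContinuousOn _ (slab a b H); fun_prop)
      · have := bz n p.1
        simp only
        gcongr
    have e5 := mul_le_mul_of_nonneg_left e4 hκ.le
    have e6 := mul_nonneg hκ.le e3
    have e7 : κ * (2 * ∫ p in slab a b H, z n p.2.1 ^ 2 * (Tt p * (Txx p + Tyy p))) = _ :=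
      congrArg (κ * ·) te
    simp only [hZ]
    linarith
  refine (integrable_of_tendsto_nonneg (g := fun n p => z n p.2.1 ^ 2 * Tt p ^ 2)
    (Bn := fun _ => Z) (B := Z) ?_ (fun n => ?_) (fun n => ?_) ?_ bound tendsto_const_nhds).1
  · exact ContinuousOn.aestronglyMeasurable (by fun_prop) (measurableSet_slab a b H)
  · have c0 := (test n).cont
    refine integrableOn_slab_of_compact (R := 2 * (n + 1)) ?_ fun p hp => by
      simp [hz, (isTest_cutoff n).zero _ hp]
    exact ContinuousOn.mul (c0.comp_continuousOn (f := fun p : ℝ × ℝ × ℝ => p.2.1) (by fun_prop))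
      (cTt.pow 2)
  · exact Eventually.of_forall fun p => by positivity
  · refine Eventually.of_forall fun p => ?_
    have := (((tendsto_cutoff p.2.1).const_mul (1 + p.2.1 ^ 2)).pow 2).mul_const (Tt p ^ 2)
    simpa [hz] using this

/-- By Fubini some starting time in `[a/2, a]` has finite weighted gradient energy. From the
weighted square of `T_t`, integrability follows by `|T_t| ≤ q T_t² + 1/q` with `q = 1 + x²`. -/
lemma time_integrable (h : Front f u κ c H T Tt Tx Ty Txx Tyy τ B K M) {a : ℝ}
    (ha : 0 < a) (haτ : a ≤ τ) : IntegrableOn Tt (slab a τ H) := by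
  have ng := h.weighted_grad_integrable (a := a / 2) (by linarith) (by linarith) haτ
  rw [IntegrableOn, restrict_slab] at ng
  have hae := ng.prod_right_ae
  have : NeBot (ae (volume.restrict (Icc (a / 2) a))) := by
    rw [ae_neBot]
    intro h0
    have := congrArg (fun m => m univ) h0
    simp at this
    linarith
  obtain ⟨s, hs, hsm⟩ := (hae.and (ae_restrict_mem measurableSet_Icc)).exists
  have nt := h.weighted_time_integrable (a := s) (b := τ) (by linarith [hsm.1])
    (hsm.2.trans haτ) le_rfl hs
  have nt' := nt.mono_set (show slab a τ H ⊆ slab s τ H from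
    prod_mono (Icc_subset_Icc_left hsm.2) le_rfl)
  have nd := integrableOn_slab_fst (integrable_decay 1) a τ H
  have cTt := h.sol.cont_t.mono (slab_subset (b := τ) ha)
  refine Integrable.mono' (nt'.fun_add nd) (cTt.aestronglyMeasurable (measurableSet_slab a τ H))
    (Eventually.of_forall fun p => ?_)
  rw [Real.norm_eq_abs]
  have hp : 1 ≤ 1 + p.2.1 ^ 2 := by nlinarith [sq_nonneg p.2.1]
  set q := 1 + p.2.1 ^ 2
  have hq : 0 < q := by linarith
  have h1 : |Tt p| ≤ q * Tt p ^ 2 + 1 / q := by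
    rw [← sq_abs]
    have : q * |Tt p| ^ 2 + 1 / q - |Tt p| = ((q * |Tt p| - 1 / 2) ^ 2 + 3 / 4) / q := by
      field_simp; ring
    have h3 : 0 ≤ ((q * |Tt p| - 1 / 2) ^ 2 + 3 / 4) / q := by positivity
    linarith
  have h2 : q * Tt p ^ 2 ≤ q ^ 2 * Tt p ^ 2 :=
    mul_le_mul_of_nonneg_right (by nlinarith) (sq_nonneg _)
  linarith

lemma ae_time_integrable (h : Front f u κ c H T Tt Tx Ty Txx Tyy τ B K M) (hτ : 0 < τ) :
    ∀ᵐ t ∂(volume.restrict (Ioc 0 τ)), IntegrableOn (fun p => Tt (t, p)) (strip H) := by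
  have key : ∀ n : ℕ, ∀ᵐ t ∂(volume : Measure ℝ), t ∈ Icc (τ / (n + 1)) τ →
      IntegrableOn (fun p => Tt (t, p)) (strip H) := by
    intro n
    have hn : (0 : ℝ) < n + 1 := by positivity
    have ng := h.time_integrable (a := τ / (n + 1)) (by positivity)
      (div_le_self hτ.le (by linarith [(Nat.cast_nonneg n : (0:ℝ) ≤ n)]))
    rw [IntegrableOn, restrict_slab] at ng
    exact (ae_restrict_iff' measurableSet_Icc).1 ng.prod_right_ae
  rw [ae_restrict_iff' measurableSet_Ioc]
  filter_upwards [ae_all_iff.2 key] with t ht hmem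
  obtain ⟨n, hn⟩ := exists_nat_gt (τ / t)
  refine ht n ⟨?_, hmem.2⟩
  rw [div_lt_iff₀ hmem.1] at hn
  rw [div_le_iff₀ (by positivity)]
  nlinarith [hmem.1]

lemma integrable_f_slice (h : Front f u κ c H T Tt Tx Ty Txx Tyy τ B K M) {t : ℝ}
    (ht : t ∈ Icc 0 τ) : IntegrableOn (fun p => f (T (t, p))) (strip H) := by
  have cf := h.sol.cont_f
  have cT := h.sol.cont
  refine integrableOn_strip_of_le (N := fun x => ((1 + K) * B) / (1 + x ^ 2)) ?_
    (integrable_decay _) fun p hp => ?_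
  · exact continuousOn_slice (I := Ici 0) (F := fun q => f (T q)) ht.1 (by fun_prop)
  · have := h.f_mem (p := (t, p)) ⟨ht, hp⟩
    rw [abs_of_nonneg this.1, mul_div_assoc]
    exact this.2.trans (mul_le_mul_of_nonneg_left (div_cube_le h.hB.le _) (by linarith [h.hK]))

lemma integral_strip_mul_step {k : ℝ → ℝ} {w : ℝ → ℝ} {I H : ℝ}
    (hk : Integrable (fun x => k x * step x) ∧ ∫ x, k x * step x = I) (hw : Continuous w) :
    IntegrableOn (fun p : ℝ × ℝ => k p.1 * step p.1 * w p.2) (strip H) ∧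
    ∫ p in strip H, k p.1 * step p.1 * w p.2 = I * ∫ y in Icc 0 H, w y := by
  have hw' : IntegrableOn w (Icc 0 H) := hw.continuousOn.integrableOn_compact isCompact_Icc
  rw [IntegrableOn, restrict_strip]
  refine ⟨hk.1.mul_prod hw', ?_⟩
  rw [integral_prod_mul (fun x => k x * step x) w, hk.2]

/-- The burning rate is the total reaction rate. -/
lemma integral_time_eq (h : Front f u κ c H T Tt Tx Ty Txx Tyy τ B K M)
    (hu0 : ∫ y in Icc 0 H, u y = 0) {t : ℝ} (ht : t ∈ Ioc 0 τ)
    (hi : IntegrableOn (fun p => Tt (t, p)) (strip H)) :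
    ∫ p in strip H, Tt (t, p) = c * ∫ p in strip H, f (T (t, p)) := by
  obtain ⟨C, hC, hCb⟩ := exists_cutoff_bound
  have htI : t ∈ Icc 0 τ := ⟨ht.1.le, ht.2⟩
  have cT : ContinuousOn (fun p => T (t, p)) (strip H) :=
    continuousOn_slice (I := Ici 0) (F := T) htI.1 h.sol.cont
  have mT := cT.aestronglyMeasurable (measurableSet_strip H) (μ := volume)
  have nf := h.integrable_f_slice htI
  have cu := h.sol.cont_u
  have cf := h.sol.cont_f
  have dom : ∀ {g : ℝ × ℝ → ℝ}, IntegrableOn g (strip H) →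
      Tendsto (fun n => ∫ p in strip H, cutoff n p.1 * g p) atTop (𝓝 (∫ p in strip H, g p)) := by
    intro g hg
    refine tendsto_integral_of_dominated_convergence (fun p => |g p|) (fun n => ?_) hg.abs
      (fun n => Eventually.of_forall fun p => ?_) (Eventually.of_forall fun p => ?_)
    · exact ((isTest_cutoff n).cont.measurable.comp measurable_fst).aestronglyMeasurable.mul
        hg.aestronglyMeasurable
    · rw [Real.norm_eq_abs, abs_mul, abs_of_nonneg (cutoff_nonneg _ _)]
      exact mul_le_of_le_one_left (abs_nonneg _) (cutoff_le_one _ _)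
    · simpa using (tendsto_cutoff p.1).mul_const (g p)
  have hBN : ∀ᵐ p ∂(volume.restrict (strip H)), |T (t, p) - step p.1| ≤ B / (1 + p.1 ^ 2) :=
    (ae_restrict_iff' (measurableSet_strip H)).2 (Eventually.of_forall fun p hp =>
      (h.sub_step_le (p := (t, p)) ⟨htI, hp⟩).trans (div_cube_le h.hB.le _))
  have nB := integrableOn_strip_fst (integrable_decay B) H
  -- The limit of the advective flux is `∫ u`, zero by the mean-zero condition; the diffusive flux
  -- in `l2` vanishes for every shape of front.
  have l1 : Tendsto (fun n => ∫ p in strip H, cutoff1 n p.1 * (u p.2 * T (t, p))) atTop (𝓝 0) := by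
    refine tendsto_integral_cutoff_mul (X := fun p : ℝ × ℝ => p.1) (w := fun p => u p.2) (W := M)
      (N := fun x => B / (1 + x ^ 2)) measurable_fst
      (fun n => (isTest_cutoff n).cont1) hC.le (fun n x => (hCb n x).1)
      (cu.measurable.comp measurable_snd).aestronglyMeasurable ?_ mT hBN nB
      (fun n => (integral_strip_mul_step (cutoff1_step n) cu).1)
      (fun n => by rw [(integral_strip_mul_step (cutoff1_step n) cu).2, hu0, mul_zero])
    exact (ae_restrict_iff' (measurableSet_strip H)).2 (Eventually.of_forall fun p hp =>
      h.u_le _ hp.2)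
  have l2 : Tendsto (fun n => ∫ p in strip H, cutoff2 n p.1 * (1 * T (t, p))) atTop (𝓝 0) := by
    refine tendsto_integral_cutoff_mul (X := fun p : ℝ × ℝ => p.1) (w := fun p => 1) (W := 1)
      (N := fun x => B / (1 + x ^ 2)) measurable_fst
      (fun n => (isTest_cutoff n).cont2) hC.le (fun n x => (hCb n x).2)
      aestronglyMeasurable_const (Eventually.of_forall fun p => by simp) mT hBN nB
      (fun n => (integral_strip_mul_step (w := fun _ => 1) (cutoff2_step n) continuous_const).1)
      (fun n => by
        rw [(integral_strip_mul_step (w := fun _ => 1) (cutoff2_step n) continuous_const).2,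
          zero_mul])
  have id : ∀ n, ∫ p in strip H, cutoff n p.1 * Tt (t, p) =
      (∫ p in strip H, cutoff1 n p.1 * (u p.2 * T (t, p))) +
      κ * (∫ p in strip H, cutoff2 n p.1 * (1 * T (t, p))) +
      c * ∫ p in strip H, cutoff n p.1 * f (T (t, p)) := by
    intro n
    have hn := isTest_cutoff n
    have := h.sol.weighted_identity_at h.hH hn (isWeight_one u H) (G := fun s => s)
      (G1 := fun _ => 1) (G2 := fun _ => 0) (fun s => hasDerivAt_id s) (fun s => hasDerivAt_const s 1)
      continuous_const ht.1
    simp only [one_mul, zero_mul, mul_zero, mul_one, sub_zero] at this ⊢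
    have cT' := h.sol.cont
    have i1 : IntegrableOn (fun p : ℝ × ℝ => cutoff1 n p.1 * (u p.2 * T (t, p))) (strip H) := by
      have := hn.cont1
      refine integrableOn_strip_of_compact (R := 2 * (n + 1)) ?_ fun p hp => by simp [hn.zero1 _ hp]
      exact continuousOn_slice (I := Ici 0) (F := fun q => cutoff1 n q.2.1 * (u q.2.2 * T q)) htI.1
        (by fun_prop)
    have i2 : IntegrableOn (fun p : ℝ × ℝ => cutoff2 n p.1 * T (t, p)) (strip H) := by
      have := hn.cont2
      refine integrableOn_strip_of_compact (R := 2 * (n + 1)) ?_ fun p hp => by simp [hn.zero2 _ hp]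
      exact continuousOn_slice (I := Ici 0) (F := fun q => cutoff2 n q.2.1 * T q) htI.1
        (by fun_prop)
    have i3 : IntegrableOn (fun p : ℝ × ℝ => cutoff n p.1 * f (T (t, p))) (strip H) := by
      have := hn.cont
      refine integrableOn_strip_of_compact (R := 2 * (n + 1)) ?_ fun p hp => by simp [hn.zero _ hp]
      exact continuousOn_slice (I := Ici 0) (F := fun q => cutoff n q.2.1 * f (T q)) htI.1
        (by fun_prop)
    rw [this, integral_add (i1.fun_add (i2.const_mul κ)) (i3.const_mul c),
      integral_add i1 (i2.const_mul κ), integral_const_mul, integral_const_mul]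
  have lim := ((l1.add (l2.const_mul κ)).add ((dom nf).const_mul c))
  have := tendsto_nhds_unique (dom hi) (lim.congr fun n => (id n).symm)
  rw [this]
  ring

end Front

end BulkBurning

/-! ### The flow estimate: the energy of `u` against dissipation and reaction. -/

namespace BulkBurning

open Filter Topology

variable {f u : ℝ → ℝ} {κ c H : ℝ} {T Tt Tx Ty Txx Tyy : ℝ × ℝ × ℝ → ℝ} {τ B K M : ℝ}

/-- Mean zero allows `g` to be replaced by `g - g 0`, which is at most the integral of `|g'|`. -/
lemma abs_integral_mul_le_of_mean_zero {w g g1 d : ℝ → ℝ} {H M : ℝ} (hH : 0 < H)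
    (hw : Continuous w) (hw0 : ∫ y in Icc 0 H, w y = 0) (hwM : ∀ y ∈ Icc 0 H, |w y| ≤ M)
    (hg : ContinuousOn g (Icc 0 H)) (hd : ∀ y ∈ Ioo 0 H, HasDerivAt g (g1 y) y)
    (hg1 : ContinuousOn g1 (Icc 0 H)) (hgd : ∀ y ∈ Icc 0 H, |g1 y| ≤ d y)
    (hdc : ContinuousOn d (Icc 0 H)) :
    |∫ y in Icc 0 H, w y * g y| ≤ M * H * ∫ y in Icc 0 H, d y := by
  have nd : IntegrableOn d (Icc 0 H) := hdc.integrableOn_compact isCompact_Icc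
  have nw : IntegrableOn w (Icc 0 H) := hw.continuousOn.integrableOn_compact isCompact_Icc
  have nwg : IntegrableOn (fun y => w y * g y) (Icc 0 H) :=
    (hw.continuousOn.mul hg).integrableOn_compact isCompact_Icc
  have hM : 0 ≤ M := (abs_nonneg _).trans (hwM 0 ⟨le_rfl, hH.le⟩)
  have hosc : ∀ y ∈ Icc 0 H, |g y - g 0| ≤ ∫ y in Icc 0 H, d y := by
    intro y hy
    have hs : Icc 0 y ⊆ Icc 0 H := Icc_subset_Icc_right hy.2
    have e : ∫ z in (0:ℝ)..y, g1 z = g y - g 0 := by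
      refine intervalIntegral.integral_eq_sub_of_hasDerivAt_of_le hy.1 (hg.mono hs)
        (fun z hz => hd z ⟨hz.1, hz.2.trans_le hy.2⟩) ?_
      refine ContinuousOn.intervalIntegrable ?_
      rw [uIcc_of_le hy.1]
      exact hg1.mono hs
    rw [← e, intervalIntegral.integral_of_le hy.1, ← integral_Icc_eq_integral_Ioc]
    calc |∫ z in Icc 0 y, g1 z| ≤ ∫ z in Icc 0 y, d z := by
          rw [← Real.norm_eq_abs]
          exact norm_integral_le_of_norm_le (nd.mono_set hs)
            ((ae_restrict_iff' measurableSet_Icc).2 (Eventually.of_forall fun z hz => hgd z (hs hz)))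
      _ ≤ _ := setIntegral_mono_set nd ((ae_restrict_iff' measurableSet_Icc).2
          (Eventually.of_forall fun z hz => (abs_nonneg _).trans (hgd z hz)))
          (Eventually.of_forall hs)
  have e : ∫ y in Icc 0 H, w y * g y = ∫ y in Icc 0 H, w y * (g y - g 0) := by
    have : ∀ y, w y * (g y - g 0) = w y * g y - w y * g 0 := fun y => by ring
    simp_rw [this]
    rw [integral_sub nwg (nw.mul_const _), integral_mul_const, hw0]; simp
  rw [e, ← Real.norm_eq_abs]
  have := norm_setIntegral_le_of_norm_le_const (μ := volume) (s := Icc 0 H)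
    (f := fun y => w y * (g y - g 0)) (C := M * ∫ y in Icc 0 H, d y)
    (by simp) (fun y hy => by
      rw [Real.norm_eq_abs, abs_mul]
      exact mul_le_mul (hwM y hy) (hosc y hy) (abs_nonneg _) hM)
  refine this.trans (le_of_eq ?_)
  rw [Measure.real, Real.volume_Icc, ENNReal.toReal_ofReal (by linarith)]
  ring

lemma integral_slab_mul_step {k : ℝ → ℝ} {w : ℝ → ℝ} {I H a b : ℝ} (hab : a ≤ b)
    (hk : Integrable (fun x => k x * step x) ∧ ∫ x, k x * step x = I) (hw : Continuous w) :
    IntegrableOn (fun p : ℝ × ℝ × ℝ => k p.2.1 * step p.2.1 * w p.2.2) (slab a b H) ∧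
    ∫ p in slab a b H, k p.2.1 * step p.2.1 * w p.2.2 = (b - a) * (I * ∫ y in Icc 0 H, w y) := by
  obtain ⟨h1, h2⟩ := Front.integral_strip_mul_step (H := H) hk hw
  have hi : IntegrableOn (fun p : ℝ × ℝ × ℝ => k p.2.1 * step p.2.1 * w p.2.2) (slab a b H) := by
    rw [IntegrableOn, restrict_slab]
    exact Integrable.comp_snd (f := fun p : ℝ × ℝ => k p.1 * step p.1 * w p.2) h1 _
  refine ⟨hi, ?_⟩
  rw [setIntegral_slab hi]
  simp only
  rw [h2, setIntegral_const, Measure.real, Real.volume_Icc, ENNReal.toReal_ofReal (by linarith),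
    smul_eq_mul]

/-- An integrable function is somewhere at most its average, even off a null set; `P` will be
integrability of a time slice. -/
lemma exists_good_time {g : ℝ → ℝ} {a b : ℝ} {P : ℝ → Prop} (hab : a < b)
    (hg : IntegrableOn g (Icc a b)) (hP : ∀ᵐ t ∂(volume.restrict (Icc a b)), P t) :
    ∃ t ∈ Icc a b, P t ∧ (b - a) * g t ≤ ∫ s in Icc a b, g s := by
  have hne : volume.restrict (Icc a b) ≠ 0 := by
    intro h0
    have := congrArg (fun m => m univ) h0
    simp at this
    linarith
  have hfin : IsFiniteMeasure (volume.restrict (Icc a b)) := ⟨by simp⟩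
  obtain ⟨t, ht, hle⟩ := exists_notMem_null_le_average hne hg
    (N := {t | ¬ (P t ∧ t ∈ Icc a b)}) (ae_iff.1 (hP.and (ae_restrict_mem measurableSet_Icc)))
  have ht' : P t ∧ t ∈ Icc a b := by
    by_contra hc
    exact ht hc
  refine ⟨t, ht'.2, ht'.1, ?_⟩
  rw [setAverage_eq, Measure.real, Real.volume_Icc, ENNReal.toReal_ofReal (by linarith),
    smul_eq_mul] at hle
  have h1 : 0 < b - a := by linarith
  calc (b - a) * g t ≤ (b - a) * ((b - a)⁻¹ * ∫ s in Icc a b, g s) :=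
        mul_le_mul_of_nonneg_left hle h1.le
    _ = _ := by field_simp

/-- Pointwise dissipation density. -/
noncomputable def dissip (κ c : ℝ) (T Tx Ty : ℝ × ℝ × ℝ → ℝ) (p : ℝ × ℝ × ℝ) : ℝ :=
  κ * (Tx p ^ 2 + Ty p ^ 2) + 4 * c * (T p * (1 - T p))

namespace Front

/-- With `X = T(1-T)` the left side is `6 X |T_y|`, and `2 v X |T_y| ≤ κ T_y² + (v²/κ) X²` with `X²
≤ X`. The factor `4c` in `dissip` is this `v²/κ`. -/
lemma flux_le (h : Front f u κ c H T Tt Tx Ty Txx Tyy τ B K M) {v : ℝ} (hv : 0 < v)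
    (hcv : c = v ^ 2 / (4 * κ)) {p : ℝ × ℝ × ℝ} (hp : p ∈ slab 0 τ H) :
    |(6 * T p - 6 * T p ^ 2) * Ty p| ≤ 3 / v * dissip κ c T Tx Ty p := by
  have hT := h.mem_unit hp
  have hκ := h.hκ
  set X := T p * (1 - T p)
  have hX0 : 0 ≤ X := mul_nonneg hT.1 (by linarith [hT.2])
  have hX1 : X ^ 2 ≤ X := by
    have : X ≤ 1 := by simp only [X]; nlinarith [hT.1, hT.2]
    nlinarith
  have e : (6 * T p - 6 * T p ^ 2) * Ty p = 6 * X * Ty p := by simp only [X]; ring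
  rw [e, abs_mul, abs_of_nonneg (by positivity : 0 ≤ 6 * X), dissip, hcv, div_mul_eq_mul_div,
    le_div_iff₀ hv]
  have h4 : 4 * (v ^ 2 / (4 * κ)) = v ^ 2 / κ := by field_simp
  rw [h4]
  have h5 : 2 * (X * |Ty p| * v) ≤ κ * Ty p ^ 2 + v ^ 2 / κ * X ^ 2 := by
    rw [← sq_abs (Ty p)]
    have : κ * |Ty p| ^ 2 + v ^ 2 / κ * X ^ 2 - 2 * (X * |Ty p| * v) =
        (κ * |Ty p| - v * X) ^ 2 / κ := by field_simp; ring
    have h6 : 0 ≤ (κ * |Ty p| - v * X) ^ 2 / κ := by positivity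
    linarith
  have h6 : v ^ 2 / κ * X ^ 2 ≤ v ^ 2 / κ * X := mul_le_mul_of_nonneg_left hX1 (by positivity)
  have h7 : 0 ≤ κ * Tx p ^ 2 := by positivity
  linarith

lemma cont_dissip (h : Front f u κ c H T Tt Tx Ty Txx Tyy τ B K M) :
    ContinuousOn (dissip κ c T Tx Ty) (Ioi 0 ×ˢ strip H) := by
  have cT : ContinuousOn T (Ioi 0 ×ˢ strip H) :=
    h.sol.cont.mono (prod_mono Ioi_subset_Ici_self le_rfl)
  have cTx := h.sol.cont_x
  have cTy := h.sol.cont_y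
  unfold dissip
  fun_prop

lemma dissip_nonneg (h : Front f u κ c H T Tt Tx Ty Txx Tyy τ B K M) {p : ℝ × ℝ × ℝ}
    (hp : p ∈ slab 0 τ H) : 0 ≤ dissip κ c T Tx Ty p := by
  have h1 := (h.mul_one_sub_mem hp).1
  have := h.hκ
  have := h.hc
  unfold dissip
  positivity

/-- The mean-zero bound on each cross-section `x = const`, integrated in `x`. It is uniform in `n`,
although without the cutoff `u F(T)` need not be integrable on the strip. -/
lemma slice_le (h : Front f u κ c H T Tt Tx Ty Txx Tyy τ B K M) {v : ℝ} (hv : 0 < v)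
    (hcv : c = v ^ 2 / (4 * κ)) (hu0 : ∫ y in Icc 0 H, u y = 0) {t : ℝ} (ht : t ∈ Ioc 0 τ)
    (hd : IntegrableOn (fun p => dissip κ c T Tx Ty (t, p)) (strip H)) (n : ℕ) :
    |∫ p in strip H, cutoff n p.1 * (u p.2 * (3 * T (t, p) ^ 2 - 2 * T (t, p) ^ 3))| ≤
      M * H * (3 / v) * ∫ p in strip H, dissip κ c T Tx Ty (t, p) := by
  have hn := isTest_cutoff n
  have cn := hn.cont
  have cu := h.sol.cont_u
  have cT : ContinuousOn T (Ioi 0 ×ˢ strip H) :=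
    h.sol.cont.mono (prod_mono Ioi_subset_Ici_self le_rfl)
  have cTy := h.sol.cont_y
  have cd := h.cont_dissip
  have hM := h.M_nonneg
  have hi : IntegrableOn (fun p => cutoff n p.1 * (u p.2 * (3 * T (t, p) ^ 2 - 2 * T (t, p) ^ 3)))
      (strip H) := by
    refine integrableOn_strip_of_compact (R := 2 * (n + 1)) ?_ fun p hp => by simp [hn.zero _ hp]
    exact continuousOn_slice (I := Ioi 0)
      (F := fun q => cutoff n q.2.1 * (u q.2.2 * (3 * T q ^ 2 - 2 * T q ^ 3))) ht.1 (by fun_prop)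
  have line : ∀ {F : ℝ × ℝ × ℝ → ℝ}, ContinuousOn F (Ioi 0 ×ˢ strip H) → ∀ x,
      ContinuousOn (fun y => F (t, x, y)) (Icc 0 H) := fun hF x =>
    hF.comp (by fun_prop) fun y hy => ⟨ht.1, trivial, hy⟩
  rw [IntegrableOn, restrict_strip] at hi hd
  rw [restrict_strip, integral_prod _ hi, integral_prod _ hd, ← integral_const_mul,
    ← Real.norm_eq_abs]
  refine norm_integral_le_of_norm_le (hd.integral_prod_left.const_mul _)
    (Eventually.of_forall fun x => ?_)
  dsimp only
  rw [integral_const_mul, Real.norm_eq_abs, abs_mul, abs_of_nonneg (cutoff_nonneg _ _)]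
  refine (mul_le_of_le_one_left (abs_nonneg _) (cutoff_le_one _ _)).trans ?_
  have := abs_integral_mul_le_of_mean_zero (w := u) (M := M)
    (g := fun y => 3 * T (t, x, y) ^ 2 - 2 * T (t, x, y) ^ 3)
    (g1 := fun y => (6 * T (t, x, y) - 6 * T (t, x, y) ^ 2) * Ty (t, x, y))
    (d := fun y => 3 / v * dissip κ c T Tx Ty (t, x, y)) h.hH cu hu0 h.u_le
    (line (F := fun q => 3 * T q ^ 2 - 2 * T q ^ 3) (by fun_prop) x) (fun y hy => ?_)
    (line (F := fun q => (6 * T q - 6 * T q ^ 2) * Ty q) (by fun_prop) x)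
    (fun y hy => h.flux_le hv hcv ⟨⟨ht.1.le, ht.2⟩, trivial, hy⟩)
    (continuousOn_const.mul (line cd x))
  · rw [integral_const_mul] at this
    linarith
  · have dT := (h.sol.has_y t ht.1 x y (Ioo_subset_Icc_self hy)).hasDerivAt (Icc_mem_nhds hy.1 hy.2)
    refine (((dT.pow 2).const_mul 3).sub ((dT.pow 3).const_mul 2)).congr_deriv ?_
    push_cast; ring

lemma integrable_slab_dissip (h : Front f u κ c H T Tt Tx Ty Txx Tyy τ B K M) {a b : ℝ}
    (ha : 0 < a) (hab : a ≤ b) (hb : b ≤ τ) :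
    IntegrableOn (fun p => T p * (1 - T p)) (slab a b H) ∧ IntegrableOn (fun p => f (T p)) (slab a b H)
      ∧ IntegrableOn (dissip κ c T Tx Ty) (slab a b H) := by
  have cT := h.sol.cont.mono (slab_subset_Ici (b := b) ha.le)
  have cf := h.sol.cont_f
  have n1 : IntegrableOn (fun p => T p * (1 - T p)) (slab a b H) :=
    integrableOn_slab_of_le (N := fun x => B / (1 + x ^ 2)) (by fun_prop)
      (integrable_decay _) fun p hp => by
        have := h.mul_one_sub_mem (slab_sub ha hb hp)
        rw [abs_of_nonneg this.1]
        exact this.2.trans (div_cube_le h.hB.le _)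
  refine ⟨n1, ?_, ?_⟩
  · exact integrableOn_slab_of_le (N := fun x => ((1 + K) * B) / (1 + x ^ 2)) (by fun_prop)
      (integrable_decay _) fun p hp => by
        have := h.f_mem (slab_sub ha hb hp)
        rw [abs_of_nonneg this.1, mul_div_assoc]
        exact this.2.trans (mul_le_mul_of_nonneg_left (div_cube_le h.hB.le _) (by linarith [h.hK]))
  · exact ((h.grad_energy ha hab hb).1.const_mul κ).fun_add (n1.const_mul (4 * c))

/-- The weighted identity with `φ = u` and `F(s) = 3s² - 2s³`. The jump `F(1) - F(0) = 1` turns the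
advective flux into `∫ u²`, and `F'(s) = 6s(1-s)` lets `flux_le` control the term with `u'`. The
constants 6 and 3/2 bound `|F''|` and `|F'|` on `[0, 1]`. -/
lemma flow_energy_le (h : Front f u κ c H T Tt Tx Ty Txx Tyy τ B K M) {v : ℝ} (hv : 0 < v)
    (hcv : c = v ^ 2 / (4 * κ)) (hu0 : ∫ y in Icc 0 H, u y = 0) {u1 : ℝ → ℝ} {M1 : ℝ}
    (hu1 : IsWeight u H u u1) (hM1 : ∀ y ∈ Icc 0 H, |u1 y| ≤ M1) {a b : ℝ} (ha : 0 < a) (hab : a ≤ b)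
    (hb : b ≤ τ) (da : IntegrableOn (fun p => dissip κ c T Tx Ty (a, p)) (strip H))
    (db : IntegrableOn (fun p => dissip κ c T Tx Ty (b, p)) (strip H)) :
    (b - a) * ∫ y in Icc 0 H, u y * u y ≤
      M * H * (3 / v) * (∫ p in strip H, dissip κ c T Tx Ty (a, p)) +
      M * H * (3 / v) * (∫ p in strip H, dissip κ c T Tx Ty (b, p)) +
      (κ * M1 * (3 / v) + 6 * M) * (∫ p in slab a b H, dissip κ c T Tx Ty p) +
      c * (3 / 2 * M) * ∫ p in slab a b H, f (T p) := by
  obtain ⟨C, hC, hCb⟩ := exists_cutoff_bound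
  have hM := h.M_nonneg
  have hκ := h.hκ
  have hc := h.hc
  have hM1' : 0 ≤ M1 := (abs_nonneg _).trans (hM1 0 ⟨le_rfl, h.hH.le⟩)
  have cu := h.sol.cont_u
  have cT := h.sol.cont.mono (slab_subset_Ici (b := b) ha.le)
  obtain ⟨nG, nf, nd⟩ := h.integrable_slab_dissip ha hab hb
  set F : ℝ → ℝ := fun s => 3 * s ^ 2 - 2 * s ^ 3 with hF
  have mF : AEStronglyMeasurable (fun p => F (T p)) (volume.restrict (slab a b H)) :=
    ContinuousOn.aestronglyMeasurable (by simp only [hF]; fun_prop) (measurableSet_slab a b H)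
  have hBN : ∀ᵐ p ∂(volume.restrict (slab a b H)),
      |F (T p) - step p.2.1| ≤ (3 * B) / (1 + p.2.1 ^ 2) := by
    refine (ae_restrict_iff' (measurableSet_slab a b H)).2 (Eventually.of_forall fun p hp => ?_)
    have h1 := h.mem_unit (slab_sub ha hb hp)
    have h2 := (h.sub_step_le (slab_sub ha hb hp)).trans (div_cube_le h.hB.le _)
    rw [mul_div_assoc]
    refine le_trans ?_ (mul_le_mul_of_nonneg_left h2 (by norm_num))
    obtain ⟨h1a, h1b⟩ := h1
    rcases lt_or_ge p.2.1 0 with hx | hx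
    -- `F` is 3-Lipschitz towards each end state, by the factorizations `1 - F = (1-s)²(1+2s)` and
    -- `F = s²(3-2s)`.
    · rw [show step p.2.1 = 1 by simp [step, hx], abs_of_nonpos (by linarith : T p - 1 ≤ 0)]
      have e : F (T p) - 1 = -((1 - T p) ^ 2 * (1 + 2 * T p)) := by simp only [hF]; ring
      rw [e, abs_neg, abs_of_nonneg (by positivity)]
      have : 0 ≤ 1 - T p := by linarith
      nlinarith [mul_nonneg this h1a, mul_nonneg (mul_nonneg this h1a) h1a]
    · rw [show step p.2.1 = 0 by simp [step, hx], sub_zero, sub_zero, abs_of_nonneg h1a]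
      have e : F (T p) = T p ^ 2 * (3 - 2 * T p) := by simp only [hF]; ring
      have h3 : 0 ≤ 3 - 2 * T p := by linarith
      rw [e, abs_of_nonneg (by positivity)]
      nlinarith [mul_nonneg h1a (by linarith : 0 ≤ 1 - T p),
        mul_nonneg (mul_nonneg h1a h1a) (by linarith : 0 ≤ 1 - T p)]
  have nB := integrableOn_slab_fst (integrable_decay (3 * B)) a b H
  have hX : Measurable (fun p : ℝ × ℝ × ℝ => p.2.1) := by fun_prop
  have l1 : Tendsto (fun n => ∫ p in slab a b H, cutoff1 n p.2.1 * (u p.2.2 * u p.2.2 * F (T p)))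
      atTop (𝓝 ((b - a) * (1 * ∫ y in Icc 0 H, u y * u y))) := by
    refine tendsto_integral_cutoff_mul (X := fun p : ℝ × ℝ × ℝ => p.2.1)
      (w := fun p => u p.2.2 * u p.2.2) (W := M * M)
      (N := fun x => (3 * B) / (1 + x ^ 2)) hX
      (fun n => (isTest_cutoff n).cont1) hC.le (fun n x => (hCb n x).1)
      (by fun_prop : Continuous fun p : ℝ × ℝ × ℝ => u p.2.2 * u p.2.2).aestronglyMeasurable ?_ mF
      hBN nB
      (fun n => (integral_slab_mul_step (w := fun y => u y * u y) hab (cutoff1_step n) (by fun_prop)).1)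
      (fun n => (integral_slab_mul_step (w := fun y => u y * u y) hab (cutoff1_step n)
        (by fun_prop)).2)
    refine (ae_restrict_iff' (measurableSet_slab a b H)).2 (Eventually.of_forall fun p hp => ?_)
    rw [abs_mul]
    exact mul_le_mul (h.u_le _ hp.2.2) (h.u_le _ hp.2.2) (abs_nonneg _) hM
  have l2 : Tendsto (fun n => ∫ p in slab a b H, cutoff2 n p.2.1 * (u p.2.2 * F (T p)))
      atTop (𝓝 ((b - a) * (0 * ∫ y in Icc 0 H, u y))) := by
    refine tendsto_integral_cutoff_mul (X := fun p : ℝ × ℝ × ℝ => p.2.1)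
      (w := fun p => u p.2.2) (W := M)
      (N := fun x => (3 * B) / (1 + x ^ 2)) hX
      (fun n => (isTest_cutoff n).cont2) hC.le (fun n x => (hCb n x).2)
      (by fun_prop : Continuous fun p : ℝ × ℝ × ℝ => u p.2.2).aestronglyMeasurable ?_ mF
      hBN nB
      (fun n => (integral_slab_mul_step hab (cutoff2_step n) cu).1)
      (fun n => (integral_slab_mul_step hab (cutoff2_step n) cu).2)
    exact (ae_restrict_iff' (measurableSet_slab a b H)).2 (Eventually.of_forall fun p hp =>
      h.u_le _ hp.2.2)
  set S := M * H * (3 / v) * (∫ p in strip H, dissip κ c T Tx Ty (a, p)) +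
      M * H * (3 / v) * (∫ p in strip H, dissip κ c T Tx Ty (b, p)) +
      (κ * M1 * (3 / v) + 6 * M) * (∫ p in slab a b H, dissip κ c T Tx Ty p) +
      c * (3 / 2 * M) * ∫ p in slab a b H, f (T p) with hS
  -- Only the two terms with derivatives of the cutoff depend on the front at infinity; the others
  -- are bounded independently of `n` before the limit.
  have key : ∀ n, (∫ p in slab a b H, cutoff1 n p.2.1 * (u p.2.2 * u p.2.2 * F (T p))) +
      κ * (∫ p in slab a b H, cutoff2 n p.2.1 * (u p.2.2 * F (T p))) ≤ S := by
    intro n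
    have id := h.sol.weighted_identity h.hH (isTest_cutoff n) hu1 (G := F)
      (G1 := fun s => 6 * s - 6 * s ^ 2) (G2 := fun s => 6 - 12 * s)
      (fun s => ((((hasDerivAt_id s).pow 2).const_mul 3).sub
        (((hasDerivAt_id s).pow 3).const_mul 2)).congr_deriv (by simp; ring))
      (fun s => (((hasDerivAt_id s).const_mul 6).sub
        (((hasDerivAt_id s).pow 2).const_mul 6)).congr_deriv (by simp; ring))
      (by fun_prop) ha hab
    have b1 := h.slice_le hv hcv hu0 (t := a) ⟨ha, hab.trans hb⟩ da n
    have b2 := h.slice_le hv hcv hu0 (t := b) ⟨ha.trans_le hab, hb⟩ db n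
    have dom : ∀ {g e : ℝ × ℝ × ℝ → ℝ}, IntegrableOn e (slab a b H) →
        (∀ p ∈ slab a b H, |g p| ≤ e p) →
        |∫ p in slab a b H, cutoff n p.2.1 * g p| ≤ ∫ p in slab a b H, e p := by
      intro g e he hge
      rw [← Real.norm_eq_abs]
      refine norm_integral_le_of_norm_le he ((ae_restrict_iff' (measurableSet_slab a b H)).2
        (Eventually.of_forall fun p hp => ?_))
      rw [Real.norm_eq_abs, abs_mul, abs_of_nonneg (cutoff_nonneg _ _)]
      exact (mul_le_of_le_one_left (abs_nonneg _) (cutoff_le_one _ _)).trans (hge p hp)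
    have b3 := dom (g := fun p => u1 p.2.2 * ((6 * T p - 6 * T p ^ 2) * Ty p))
      (nd.const_mul (M1 * (3 / v))) (fun p hp => by
        rw [abs_mul, mul_assoc]
        exact mul_le_mul (hM1 _ hp.2.2) (h.flux_le hv hcv (slab_sub ha hb hp)) (abs_nonneg _) hM1')
    have b4 := dom (g := fun p => u p.2.2 * ((6 - 12 * T p) * (Tx p ^ 2 + Ty p ^ 2)))
      (nd.const_mul (M * 6 * κ⁻¹)) (fun p hp => by
        have h1 := h.mem_unit (slab_sub ha hb hp)
        have h2 := (h.mul_one_sub_mem (slab_sub ha hb hp)).1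
        have h3 : |6 - 12 * T p| ≤ 6 := abs_le.2 ⟨by linarith [h1.2], by linarith [h1.1]⟩
        have h4 : Tx p ^ 2 + Ty p ^ 2 ≤ κ⁻¹ * dissip κ c T Tx Ty p := by
          rw [dissip, mul_add, inv_mul_cancel_left₀ hκ.ne']
          have : 0 ≤ κ⁻¹ * (4 * c * (T p * (1 - T p))) := by positivity
          linarith
        rw [abs_mul, abs_mul, abs_of_nonneg (by positivity : 0 ≤ Tx p ^ 2 + Ty p ^ 2), mul_assoc,
          mul_assoc]
        exact mul_le_mul (h.u_le _ hp.2.2) (mul_le_mul h3 h4 (by positivity) (by norm_num))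
          (by positivity) hM)
    have b5 := dom (g := fun p => u p.2.2 * ((6 * T p - 6 * T p ^ 2) * f (T p)))
      (nf.const_mul (3 / 2 * M)) (fun p hp => by
        have h1 := h.mem_unit (slab_sub ha hb hp)
        have h2 := (h.f_mem (slab_sub ha hb hp)).1
        have h3 : |6 * T p - 6 * T p ^ 2| ≤ 3 / 2 := by
          rw [abs_le]
          constructor <;> nlinarith [sq_nonneg (T p - 1 / 2), h1.1, h1.2]
        rw [abs_mul, abs_mul, abs_of_nonneg h2]
        calc _ ≤ M * (3 / 2 * f (T p)) := mul_le_mul (h.u_le _ hp.2.2)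
              (mul_le_mul_of_nonneg_right h3 h2) (by positivity) hM
          _ = _ := by ring)
    rw [integral_const_mul] at b3 b4 b5
    have b3' := mul_le_mul_of_nonneg_left b3 hκ.le
    have b4' := mul_le_mul_of_nonneg_left b4 hκ.le
    have b5' := mul_le_mul_of_nonneg_left b5 hc.le
    rw [← abs_of_pos hκ, ← abs_mul, abs_of_pos hκ] at b3' b4'
    rw [← abs_of_pos hc, ← abs_mul, abs_of_pos hc] at b5'
    have e4 : κ * (M * 6 * κ⁻¹ * ∫ p in slab a b H, dissip κ c T Tx Ty p) =
        6 * M * ∫ p in slab a b H, dissip κ c T Tx Ty p := by field_simp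
    rw [e4] at b4'
    simp only [hS]
    have := (abs_le.1 b1).1
    have := (abs_le.1 b2).2
    have := (abs_le.1 b3').2
    have := (abs_le.1 b4').2
    have := (abs_le.1 b5').1
    linarith
  have lim := l1.add (l2.const_mul κ)
  have := le_of_tendsto' lim key
  simpa using this

end Front

end BulkBurning

/-! ### Choice of times, and passage from dissipation to reaction. -/

namespace BulkBurning

open Filter Topology

variable {f u : ℝ → ℝ} {κ c H : ℝ} {T Tt Tx Ty Txx Tyy : ℝ × ℝ × ℝ → ℝ} {τ B K M : ℝ}

namespace Front

lemma cont_reaction (h : Front f u κ c H T Tt Tx Ty Txx Tyy τ B K M) :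
    ContinuousOn (fun t => ∫ p in strip H, f (T (t, p))) (Icc 0 τ) := by
  have cf := h.sol.cont_f
  have cT := h.sol.cont
  have cfT : ContinuousOn (fun q => f (T q)) (Ici 0 ×ˢ strip H) := by fun_prop
  refine MeasureTheory.continuousOn_of_dominated
    (bound := fun p : ℝ × ℝ => ((1 + K) * B) / (1 + p.1 ^ 2))
    (fun t ht => (h.integrable_f_slice ht).aestronglyMeasurable) (fun t ht => ?_)
    (integrableOn_strip_fst (integrable_decay _) H) ?_
  · refine (ae_restrict_iff' (measurableSet_strip H)).2 (Eventually.of_forall fun p hp => ?_)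
    have := h.f_mem (p := (t, p)) ⟨ht, hp⟩
    rw [Real.norm_eq_abs, abs_of_nonneg this.1, mul_div_assoc]
    exact this.2.trans (mul_le_mul_of_nonneg_left (div_cube_le h.hB.le _) (by linarith [h.hK]))
  · refine (ae_restrict_iff' (measurableSet_strip H)).2 (Eventually.of_forall fun p hp => ?_)
    exact cfT.comp (f := fun t : ℝ => (t, p)) (by fun_prop) fun t ht => ⟨ht.1, hp⟩

/-- Three times are chosen by averaging: a late `b1` where the reaction is small, which closes the
gradient estimate on `[τ/8, b1]`, then `t1 < t2` inside this interval where the dissipation slice is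
at most a constant over `τ` times its integral. -/
lemma flow_energy_le_reaction (h : Front f u κ c H T Tt Tx Ty Txx Tyy τ B K M) {v γ : ℝ}
    (hv : 0 < v) (hcv : c = v ^ 2 / (4 * κ)) (hγ : 0 < γ)
    (hfγ : ∀ s ∈ Icc (0 : ℝ) 1, γ * (s * (1 - s)) ≤ f s)
    (hu0 : ∫ y in Icc 0 H, u y = 0) {u1 : ℝ → ℝ} {M1 : ℝ} (hu1 : IsWeight u H u u1)
    (hM1 : ∀ y ∈ Icc 0 H, |u1 y| ≤ M1) (hτκ : κ / v ^ 2 ≤ τ) (hτH : H / v ≤ τ) :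
    τ * ∫ y in Icc 0 H, u y * u y ≤ 240 * (12 / γ + 1) * (M + κ * M1 / v) *
      (c * ∫ t in Icc 0 τ, ∫ p in strip H, f (T (t, p))) := by
  have hκ := h.hκ
  have hc := h.hc
  have hM := h.M_nonneg
  have hM1' : 0 ≤ M1 := (abs_nonneg _).trans (hM1 0 ⟨le_rfl, h.hH.le⟩)
  have hτ : 0 < τ := lt_of_lt_of_le (by positivity) hτκ
  set Fs : ℝ → ℝ := fun t => ∫ p in strip H, f (T (t, p)) with hFs
  set I := ∫ t in Icc 0 τ, Fs t
  have nFs : IntegrableOn Fs (Icc 0 τ) := h.cont_reaction.integrableOn_compact isCompact_Icc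
  have Fs0 : ∀ t ∈ Icc 0 τ, 0 ≤ Fs t := fun t ht =>
    setIntegral_nonneg (measurableSet_strip H) fun p hp => (h.f_mem (p := (t, p)) ⟨ht, hp⟩).1
  have aeFs0 : 0 ≤ᵐ[volume.restrict (Icc 0 τ)] Fs :=
    (ae_restrict_iff' measurableSet_Icc).2 (Eventually.of_forall Fs0)
  have hI0 : 0 ≤ I := setIntegral_nonneg measurableSet_Icc Fs0
  have hFsI : ∀ a b, 0 ≤ a → b ≤ τ → ∫ t in Icc a b, Fs t ≤ I := fun a b ha hb =>
    setIntegral_mono_set nFs aeFs0 (Eventually.of_forall (Icc_subset_Icc ha hb))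
  have hslabf : ∀ a b, 0 < a → a ≤ b → b ≤ τ → ∫ p in slab a b H, f (T p) ≤ I := by
    intro a b ha hab hb
    rw [setIntegral_slab (h.integrable_slab_dissip ha hab hb).2.1]
    exact hFsI a b ha.le hb
  -- This is `κ/v² ≤ τ`. It trades the factor `4/τ` from averaging over the last quarter for `16 c`.
  have h4c : 1 ≤ 4 * c * τ := by
    rw [hcv]
    rw [div_le_iff₀ (by positivity)] at hτκ
    have : 4 * (v ^ 2 / (4 * κ)) * τ = τ * v ^ 2 / κ := by field_simp
    rw [this, le_div_iff₀ hκ]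
    linarith
  -- a late time with little reaction
  obtain ⟨b1, hb1, -, hb1le⟩ := exists_good_time (a := 3 * τ / 4) (b := τ) (P := fun _ => True)
    (by linarith) (nFs.mono_set (Icc_subset_Icc_left (by linarith))) (Eventually.of_forall fun _ => trivial)
  have hb1I := hb1le.trans (hFsI (3 * τ / 4) τ (by linarith) le_rfl)
  have hb1τ : b1 ∈ Icc 0 τ := ⟨by linarith [hb1.1], hb1.2⟩
  have hab1 : τ / 8 ≤ b1 := by linarith [hb1.1]
  obtain ⟨ng1, hge⟩ := h.grad_energy (a := τ / 8) (b := b1) (by linarith) hab1 hb1.2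
  obtain ⟨nG1, nf1, nd1⟩ := h.integrable_slab_dissip (a := τ / 8) (b := b1) (by linarith) hab1 hb1.2
  have hG1 : γ * (∫ p in strip H, T (b1, p) * (1 - T (b1, p))) ≤ Fs b1 := by
    rw [← integral_const_mul]
    refine integral_mono_of_nonneg ((ae_restrict_iff' (measurableSet_strip H)).2
      (Eventually.of_forall fun p hp => ?_)) (h.integrable_f_slice hb1τ)
      ((ae_restrict_iff' (measurableSet_strip H)).2 (Eventually.of_forall fun p hp => ?_))
    · exact mul_nonneg hγ.le (h.mul_one_sub_mem (p := (b1, p)) ⟨hb1τ, hp⟩).1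
    · exact hfγ _ (h.mem_unit (p := (b1, p)) ⟨hb1τ, hp⟩)
  have hGG : γ * (∫ p in slab (τ / 8) b1 H, T p * (1 - T p)) ≤ I := by
    refine le_trans ?_ (hslabf (τ / 8) b1 (by linarith) hab1 hb1.2)
    rw [← integral_const_mul]
    refine setIntegral_mono_on (nG1.const_mul γ) nf1 (measurableSet_slab _ _ _) fun p hp => ?_
    exact hfγ _ (h.mem_unit (slab_sub (by linarith) hb1.2 hp))
  set D := ∫ p in slab (τ / 8) b1 H, dissip κ c T Tx Ty p with hD
  have hDeq : D = κ * (∫ p in slab (τ / 8) b1 H, (Tx p ^ 2 + Ty p ^ 2)) +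
      4 * c * ∫ p in slab (τ / 8) b1 H, T p * (1 - T p) := by
    rw [hD, ← integral_const_mul, ← integral_const_mul,
      ← integral_add (ng1.const_mul κ) (nG1.const_mul (4 * c))]
    rfl
  have hcI : 0 ≤ c * I := mul_nonneg hc.le hI0
  -- Half of `16/γ` comes from `T(1-T)` at time `b1`, `4/γ` from its space-time integral; the
  -- reaction term contributes 1/2, rounded up to 1.
  have hDle : D ≤ (12 / γ + 1) * (c * I) := by
    have hf1 := hslabf (τ / 8) b1 (by linarith) hab1 hb1.2
    have s1 : (∫ p in strip H, T (b1, p) * (1 - T (b1, p))) ≤ 16 / γ * (c * I) := by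
      rw [div_mul_eq_mul_div, le_div_iff₀ hγ]
      have e1 : Fs b1 ≤ 4 * c * τ * Fs b1 := le_mul_of_one_le_left (Fs0 _ hb1τ) h4c
      have e2 : c * ((τ - 3 * τ / 4) * Fs b1) ≤ c * I := mul_le_mul_of_nonneg_left hb1I hc.le
      linarith
    have s2 : 4 * c * (∫ p in slab (τ / 8) b1 H, T p * (1 - T p)) ≤ 4 / γ * (c * I) := by
      rw [div_mul_eq_mul_div, le_div_iff₀ hγ]
      have := mul_le_mul_of_nonneg_left hGG hc.le
      linarith
    have s3 := mul_le_mul_of_nonneg_left hf1 hc.le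
    rw [hDeq]
    have e : (12 / γ + 1) * (c * I) = 1 / 2 * (16 / γ * (c * I)) + 4 / γ * (c * I) + c * I := by ring
    rw [e]
    linarith
  have hdmono : ∀ a b, τ / 8 ≤ a → b ≤ b1 → ∫ p in slab a b H, dissip κ c T Tx Ty p ≤ D := by
    intro a b ha hb
    refine setIntegral_mono_set nd1 ((ae_restrict_iff' (measurableSet_slab _ _ _)).2
      (Eventually.of_forall fun p hp => h.dissip_nonneg (slab_sub (by linarith) hb1.2 hp)))
      (Eventually.of_forall (prod_mono (Icc_subset_Icc ha hb) le_rfl))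
  have good : ∀ a b, τ / 8 ≤ a → a < b → b ≤ b1 → ∃ t ∈ Icc a b,
      IntegrableOn (fun p => dissip κ c T Tx Ty (t, p)) (strip H) ∧
      (b - a) * (∫ p in strip H, dissip κ c T Tx Ty (t, p)) ≤ D := by
    intro a b ha hab hb
    have nd := (h.integrable_slab_dissip (a := a) (b := b) (by linarith) hab.le (hb.trans hb1.2)).2.2
    have e := setIntegral_slab nd
    rw [IntegrableOn, restrict_slab] at nd
    obtain ⟨t, ht, hP, hle⟩ := exists_good_time hab nd.integral_prod_left nd.prod_right_ae
    refine ⟨t, ht, hP, hle.trans ?_⟩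
    rw [← e]
    exact hdmono a b ha hb
  -- The windows are disjoint, so `t2 - t1 ≥ τ/4`; both precede `b1 ≥ 3τ/4`, and starting at `τ/8`
  -- avoids `t = 0`, where derivatives are not available. Their lengths `τ/8` and `τ/4` give the
  -- `12/τ` in `q1`.
  obtain ⟨t1, ht1, d1, hd1⟩ := good (τ / 8) (τ / 4) le_rfl (by linarith) (by linarith [hb1.1])
  obtain ⟨t2, ht2, d2, hd2⟩ := good (τ / 2) (3 * τ / 4) (by linarith) (by linarith) hb1.1
  have ht1' := ht1.1
  have ht1'' := ht1.2
  have ht2' := ht2.1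
  have ht2'' := ht2.2
  have main := h.flow_energy_le hv hcv hu0 hu1 hM1 (a := t1) (b := t2) (by linarith) (by linarith)
    (by linarith) d1 d2
  have hd12 := hdmono t1 t2 ht1' (by linarith [hb1.1])
  have hf12 := hslabf t1 t2 (by linarith) (by linarith) (by linarith)
  set D1 := ∫ p in strip H, dissip κ c T Tx Ty (t1, p)
  set D2 := ∫ p in strip H, dissip κ c T Tx Ty (t2, p)
  set U2 := ∫ y in Icc 0 H, u y * u y
  have hU2 : 0 ≤ U2 := integral_nonneg fun y => mul_self_nonneg _
  have hD0 : 0 ≤ D := setIntegral_nonneg (measurableSet_slab _ _ _) fun p hp =>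
    h.dissip_nonneg (slab_sub (by linarith) hb1.2 hp)
  have p1 : M * H * (3 / v) * D1 + M * H * (3 / v) * D2 ≤ 36 * (M * D) := by
    have q1 : D1 + D2 ≤ 12 / τ * D := by
      rw [div_mul_eq_mul_div, le_div_iff₀ hτ]; linarith
    -- The only use of `H/v ≤ τ`: the Poincaré factor `H` of the mean-zero bound is paid by the
    -- `1/τ` from averaging.
    have q2 : H * (3 / v) ≤ 3 * τ := by
      have : H * (3 / v) = 3 * (H / v) := by ring
      linarith
    calc M * H * (3 / v) * D1 + M * H * (3 / v) * D2 = M * (H * (3 / v)) * (D1 + D2) := by ring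
      _ ≤ M * (H * (3 / v)) * (12 / τ * D) := mul_le_mul_of_nonneg_left q1
          (by have := h.hH; positivity)
      _ ≤ M * (3 * τ) * (12 / τ * D) := by gcongr
      _ = _ := by field_simp; ring
  have p2 : (κ * M1 * (3 / v) + 6 * M) * (∫ p in slab t1 t2 H, dissip κ c T Tx Ty p) ≤
      (κ * M1 * (3 / v) + 6 * M) * D := mul_le_mul_of_nonneg_left hd12 (by positivity)
  have p3 : c * (3 / 2 * M) * (∫ p in slab t1 t2 H, f (T p)) ≤ c * (3 / 2 * M) * I :=
    mul_le_mul_of_nonneg_left hf12 (by positivity)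
  have p4 : τ / 4 * U2 ≤ (t2 - t1) * U2 := mul_le_mul_of_nonneg_right (by linarith) hU2
  set Λ := 12 / γ + 1 with hΛ
  have hΛ1 : 1 ≤ Λ := by
    have : 0 < 12 / γ := by positivity
    linarith
  set r := κ * M1 / v with hr
  have hr0 : 0 ≤ r := by positivity
  have e3 : κ * M1 * (3 / v) = 3 * r := by rw [hr]; ring
  rw [e3] at p2 main
  have p5 : (42 * M + 3 * r) * D ≤ (42 * M + 3 * r) * (Λ * (c * I)) :=
    mul_le_mul_of_nonneg_left hDle (by positivity)
  have p6 : M * (c * I) ≤ M * (Λ * (c * I)) :=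
    mul_le_mul_of_nonneg_left (le_mul_of_one_le_left hcI hΛ1) hM
  have p7 : 0 ≤ M * (Λ * (c * I)) := by positivity
  have p8 : 0 ≤ r * (Λ * (c * I)) := by positivity
  have e9 : 240 * Λ * (M + r) * (c * I) = 240 * (M * (Λ * (c * I))) + 240 * (r * (Λ * (c * I))) := by
    ring
  rw [e9]
  linarith

end Front

lemma exists_continuous_extension {g : ℝ → ℝ} {a b : ℝ} (hab : a ≤ b)
    (hg : ContinuousOn g (Icc a b)) : ∃ g' : ℝ → ℝ, Continuous g' ∧ EqOn g' g (Icc a b) :=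
  ⟨IccExtend hab ((Icc a b).domRestrict g), hg.domRestrict.Icc_extend',
    fun _ hx => IccExtend_of_mem hab _ hx⟩

lemma le_normSup {g : ℝ → ℝ} {H : ℝ} (hg : ContinuousOn g (Icc 0 H)) {y : ℝ} (hy : y ∈ Icc 0 H) :
    |g y| ≤ normSup H g :=
  le_csSup (isCompact_Icc.image_of_continuousOn hg.abs).bddAbove ⟨y, hy, rfl⟩

/-- Cauchy–Schwarz against the constant 1, by expanding the square of `H|g|` minus its average. -/
lemma sq_integral_abs_le {g : ℝ → ℝ} {H : ℝ} (hH : 0 < H) (hg : Continuous g) :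
    (∫ y in Icc 0 H, |g y|) ^ 2 ≤ H * ∫ y in Icc 0 H, g y * g y := by
  set m := ∫ y in Icc 0 H, |g y|
  have n1 : IntegrableOn (fun y => g y * g y) (Icc 0 H) :=
    (hg.mul hg).continuousOn.integrableOn_compact isCompact_Icc
  have n2 : IntegrableOn (fun y => |g y|) (Icc 0 H) := hg.abs.continuousOn.integrableOn_compact isCompact_Icc
  have n3 : IntegrableOn (fun _ : ℝ => m ^ 2) (Icc 0 H) :=
    continuousOn_const.integrableOn_compact isCompact_Icc
  have h0 : 0 ≤ ∫ y in Icc 0 H, (H * |g y| - m) ^ 2 := integral_nonneg fun y => sq_nonneg _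
  have e : ∫ y in Icc 0 H, (H * |g y| - m) ^ 2 =
      H ^ 2 * (∫ y in Icc 0 H, g y * g y) - 2 * H * m * m + H * m ^ 2 := by
    have e1 : ∀ y, (H * |g y| - m) ^ 2 = H ^ 2 * (g y * g y) - 2 * H * m * |g y| + m ^ 2 := fun y => by
      have := abs_mul_abs_self (g y)
      linear_combination H ^ 2 * this
    simp_rw [e1]
    rw [integral_add ((n1.const_mul _).sub' (n2.const_mul _)) n3,
      integral_sub (n1.const_mul _) (n2.const_mul _), integral_const_mul, integral_const_mul,
      setIntegral_const, Measure.real, Real.volume_Icc, ENNReal.toReal_ofReal (by linarith)]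
    simp [m]
  rw [e] at h0
  have : 0 ≤ H * (H * (∫ y in Icc 0 H, g y * g y) - m ^ 2) := by linarith
  linarith [nonneg_of_mul_nonneg_right this hH]

/-- Write the hypothesis with `U (1 + r)`, `r = κ U1 / (v U)`. Since `n1 ≤ U`, `r² ≤ q = κ² / (v²
h_u²)`, and `1 + r ≤ 2(1 + q)` doubles 240 to 480. If `U1 = 0`, division by zero makes `q = 0`,
consistent with `r = 0`. -/
lemma final_ratio {n1 U U1 κ v Λ V : ℝ} (hκ : 0 < κ) (hv : 0 < v) (hΛ : 0 < Λ) (hV : 0 ≤ V)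
    (hn : 0 ≤ n1) (hnU : n1 ≤ U) (hU1 : 0 ≤ U1) (h : n1 ^ 2 ≤ 240 * Λ * (U + κ * U1 / v) * V) :
    1 / (480 * Λ) * (1 + κ ^ 2 / (v ^ 2 * (n1 / U1) ^ 2))⁻¹ * (n1 ^ 2 / U) ≤ V := by
  rcases hn.eq_or_lt with h0 | hn0
  · rw [← h0]; simpa using hV
  have hU : 0 < U := hn0.trans_le hnU
  set q := κ ^ 2 / (v ^ 2 * (n1 / U1) ^ 2) with hq
  have hq0 : 0 ≤ q := by positivity
  set r := κ * U1 / v / U with hr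
  have hr0 : 0 ≤ r := by positivity
  have hrq : r ^ 2 ≤ q := by
    rcases hU1.eq_or_lt with h1 | h1
    · simp [hr, ← h1, hq0]
    · have e : q = (κ * U1 / v / n1) ^ 2 := by rw [hq]; field_simp
      rw [e, hr]
      gcongr
  have h1 : 1 + r ≤ 2 * (1 + q) := by nlinarith [sq_nonneg (r - 1)]
  have h2 : n1 ^ 2 / U ≤ 240 * Λ * (1 + r) * V := by
    rw [div_le_iff₀ hU]
    refine h.trans (le_of_eq ?_)
    rw [hr]; field_simp
  calc 1 / (480 * Λ) * (1 + q)⁻¹ * (n1 ^ 2 / U)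
      ≤ 1 / (480 * Λ) * (1 + q)⁻¹ * (240 * Λ * (2 * (1 + q)) * V) := by
        refine mul_le_mul_of_nonneg_left (h2.trans ?_) (by positivity)
        gcongr
    _ = V := by field_simp; ring

end BulkBurning

/-! ### Assembly of the theorem. -/

open BulkBurning

theorem theorem2 (f : ℝ → ℝ) (hf : BulkBurning.IsConcaveKPP f) :
    ∃ C > 0, ∀ (κ v₀ H : ℝ), 0 < κ → 0 < v₀ → 0 < H →
      ∀ u : ℝ → ℝ, BulkBurning.IsShear H u →
      ∀ T : ℝ → ℝ → ℝ → ℝ,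
        (BulkBurning.IsNeumannSolution f κ v₀ H u T ∨
          BulkBurning.IsPeriodicSolution f κ v₀ H u T) →
      ∀ τ : ℝ, max (κ / v₀ ^ 2) (H / v₀) ≤ τ →
        (∀ᵐ t ∂(MeasureTheory.volume.restrict (Set.Ioc 0 τ)),
          MeasureTheory.IntegrableOn (fun p : ℝ × ℝ => BulkBurning.dt T t p.1 p.2)
            (BulkBurning.strip H)) ∧
        IntervalIntegrable (BulkBurning.burningRate H T) MeasureTheory.volume 0 τ ∧
        C * (1 + κ ^ 2 / (v₀ ^ 2 * BulkBurning.shearScale H u ^ 2))⁻¹ *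
            (BulkBurning.norm1 H u ^ 2 / BulkBurning.normSup H u)
          ≤ BulkBurning.avgBurningRate H T τ := by
  obtain ⟨γ, hγ, K, hK, hb⟩ := hf.bounds
  have hΛ : 0 < 12 / γ + 1 := by positivity
  refine ⟨1 / (480 * (12 / γ + 1)), by positivity, ?_⟩
  intro κ v H hκ hv hH u hu T hT τ hτm
  have hτκ : κ / v ^ 2 ≤ τ := (le_max_left _ _).trans hτm
  have hτH : H / v ≤ τ := (le_max_right _ _).trans hτm
  have hτ : 0 < τ := lt_of_lt_of_le (by positivity) hτκ
  have cu : ContinuousOn u (Icc 0 H) := hu.contDiffOn.continuousOn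
  have cu1 : ContinuousOn (derivWithin u (Icc 0 H)) (Icc 0 H) :=
    hu.contDiffOn.continuousOn_derivWithin (uniqueDiffOn_Icc hH) le_rfl
  obtain ⟨f', cf', ef⟩ := exists_continuous_extension zero_le_one hf.contDiffOn.continuousOn
  obtain ⟨u', cu', eu⟩ := exists_continuous_extension hH.le cu
  obtain ⟨u1', cu1', eu1⟩ := exists_continuous_extension hH.le cu1
  set c := v ^ 2 / (4 * κ) with hc
  have hc0 : 0 < c := by positivity
  obtain ⟨Ty, Tyy, sol⟩ : ∃ Ty Tyy, StripSol f' u' κ c H (unc T) (unc (dt T)) (unc (dx T)) Ty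
      (unc (dx (dx T))) Tyy := by
    rcases hT with h | h
    · exact ⟨_, _, h.stripSol hH cf' cu' ef eu⟩
    · exact ⟨_, _, h.stripSol hH cf' cu' ef eu⟩
  have hloc : IsLocalized (Icc 0 H) (T 0) := by
    rcases hT with h | h
    · exact h.solution.localized
    · exact (h.solution.of_univ hH).2.localized
  have uM : ∀ y ∈ Icc 0 H, |u' y| ≤ normSup H u := fun y hy => by
    rw [eu hy]; exact le_normSup cu hy
  have u1M : ∀ y ∈ Icc 0 H, |u1' y| ≤ normSup H (derivWithin u (Icc 0 H)) := fun y hy => by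
    rw [eu1 hy]; exact le_normSup cu1 hy
  have hf0 : ∀ s ∈ Icc (0 : ℝ) 1, 0 ≤ f' s := fun s hs => by
    rw [ef hs]
    exact (mul_nonneg hγ.le (mul_nonneg hs.1 (sub_nonneg.2 hs.2))).trans (hb s hs).1
  have hf1 : ∀ s ∈ Icc (0 : ℝ) 1, f' s ≤ s := fun s hs => by
    rw [ef hs]; exact (hb s hs).2.1
  obtain ⟨B, hB, hdec⟩ := sol.decay hH hκ hc0.le hf1 hf0 uM hloc τ
  have front : Front f' u' κ c H (unc T) (unc (dt T)) (unc (dx T)) Ty (unc (dx (dx T))) Tyy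
      τ B K (normSup H u) :=
    ⟨sol, hH, hκ, hc0, hB, hK, uM, hf0, hf1, fun s hs => by rw [ef hs]; exact (hb s hs).2.2, hdec⟩
  have hu0 : ∫ y in Icc 0 H, u' y = 0 := by
    rw [setIntegral_congr_fun measurableSet_Icc eu, integral_Icc_eq_integral_Ioc,
      ← intervalIntegral.integral_of_le hH.le]
    exact hu.mean_zero
  have wt : IsWeight u' H u' u1' := by
    refine ⟨cu', cu1', fun y hy => ?_, id⟩
    have hn : Icc 0 H ∈ nhds y := Icc_mem_nhds hy.1 hy.2
    have hy' := Ioo_subset_Icc_self hy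
    have hd := (((hu.contDiffOn.differentiableOn one_ne_zero) y hy').hasDerivWithinAt).hasDerivAt hn
    rw [eu1 hy']
    exact hd.congr_of_eventuallyEq (Filter.eventually_of_mem hn eu)
  have ae1 := front.ae_time_integrable hτ
  -- The burning rate agrees almost everywhere with a function continuous up to `t = 0`; this gives
  -- its integrability in time as well as its average.
  have aeV : ∀ᵐ t ∂(volume.restrict (Ioc 0 τ)),
      c * (∫ p in strip H, f' (unc T (t, p))) / H = burningRate H T t := by
    filter_upwards [ae1, ae_restrict_mem measurableSet_Ioc] with t ht hmem
    rw [← front.integral_time_eq hu0 hmem ht]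
    rfl
  have cF : ContinuousOn (fun t => c * (∫ p in strip H, f' (unc T (t, p))) / H) (Icc 0 τ) :=
    (continuousOn_const.mul front.cont_reaction).div_const H
  have nV : IntegrableOn (fun t => c * (∫ p in strip H, f' (unc T (t, p))) / H) (Ioc 0 τ) :=
    (cF.integrableOn_compact isCompact_Icc).mono_set Ioc_subset_Icc_self
  refine ⟨ae1, ?_, ?_⟩
  · rw [intervalIntegrable_iff_integrableOn_Ioc_of_le hτ.le]
    exact Integrable.congr nV aeV
  set R := c * ∫ t in Icc 0 τ, ∫ p in strip H, f' (unc T (t, p)) with hR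
  have eV : avgBurningRate H T τ = R / (τ * H) := by
    rw [avgBurningRate, intervalIntegral.integral_of_le hτ.le, ← integral_congr_ae aeV,
      integral_div, integral_const_mul, ← integral_Icc_eq_integral_Ioc, ← hR]
    field_simp
  have hR0 : 0 ≤ R := mul_nonneg hc0.le (setIntegral_nonneg measurableSet_Icc fun t ht =>
    setIntegral_nonneg (measurableSet_strip H) fun p hp => (front.f_mem (p := (t, p)) ⟨ht, hp⟩).1)
  have main := front.flow_energy_le_reaction hv hc hγ
    (fun s hs => by rw [ef hs]; exact (hb s hs).1) hu0 wt u1M hτκ hτH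
  have en1 : norm1 H u = (∫ y in Icc 0 H, |u' y|) / H := by
    rw [norm1, intervalIntegral.integral_of_le hH.le, ← integral_Icc_eq_integral_Ioc]
    congr 1
    exact setIntegral_congr_fun measurableSet_Icc fun y hy => by simp only [eu hy]
  have hn0 : 0 ≤ norm1 H u := by
    rw [en1]
    exact div_nonneg (integral_nonneg fun y => abs_nonneg _) hH.le
  have hnU : norm1 H u ≤ normSup H u := by
    rw [en1, div_le_iff₀ hH]
    have := norm_setIntegral_le_of_norm_le_const (μ := volume) (s := Icc 0 H)
      (f := fun y => |u' y|) (C := normSup H u) (by simp)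
      (fun y hy => by rw [Real.norm_eq_abs, abs_abs]; exact uM y hy)
    rw [Measure.real, Real.volume_Icc, ENNReal.toReal_ofReal (by linarith), sub_zero] at this
    exact (le_abs_self _).trans this
  have hU1 : 0 ≤ normSup H (derivWithin u (Icc 0 H)) :=
    (abs_nonneg _).trans (u1M 0 ⟨le_rfl, hH.le⟩)
  rw [eV, shearScale]
  refine final_ratio hκ hv hΛ (by positivity) hn0 hnU hU1 ?_
  -- The flow estimate bounds `∫ u²`; Cauchy–Schwarz supplies the `L¹` norm of the statement.
  have cs := sq_integral_abs_le hH cu'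
  rw [en1, div_pow, div_le_iff₀ (by positivity)]
  refine cs.trans ?_
  have m2 := mul_le_mul_of_nonneg_left main hH.le
  have e2 : 240 * (12 / γ + 1) * (normSup H u + κ * normSup H (derivWithin u (Icc 0 H)) / v) *
      (R / (τ * H)) * H ^ 2 = H * (240 * (12 / γ + 1) *
      (normSup H u + κ * normSup H (derivWithin u (Icc 0 H)) / v) * R) / τ := by
    field_simp
  rw [e2, le_div_iff₀ hτ]
  linarith
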